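/- Let $m\ge 2$ be an integer, $\eta\in(0,1)$ and $0<\lambda<\min\{\eta,1-\eta,1/m\}$. Let $S^1=\mathbb R/\mathbb Z$, let $D\subset\mathbb R^2$ be the closed unit disk, $\mathcal T=S^1\times D\subset S^1\times\mathbb R^2$, $U=\operatorname{int}\mathcal T$, and assume that the solenoid map $$F(t,x,y)=(mt,\ \lambda x+\eta\cos 2\pi t,\ \lambda y+\eta\sin 2\pi t)$$ is injective on $\mathcal T$ (i.e. a diffeomorphism onto its image). Let $\theta\in(0,1)$. Then $F:U\to U$ is a $C^{1+\theta}$ diffeomorphism onto its image with $\overline{F(U)}\subset U$, and its attractor $\Lambda=\bigcap_{n\ge0}\overline{F^n(U)}=\bigcap_{n\ge 0}F^n(\mathcal T)$ is equal to its nonwandering set. Moreover there is a $DF$-invariant splitting $T_x(S^1\times\mathbb R^2)=E^u(x)\oplus E^s(x)$, $x\in\Lambda$, such that the following hold. (A1) $F|_\Lambda$ is topologically transitive. (A2) $\Lambda$ is hyperbolic: there are $\nu>1$ and $\zeta<1$ with $\|d_xF v\|\ge\nu\|v\|$ for $v\in E^u(x)$ and $\|d_xFv\|\le\zeta\|v\|$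 for $v\in E^s(x)$, $x\in\Lambda$. This holds both for the flat product metric and, with possibly different constants, for the metric $g$ in (A5). (A3) $\dim E^u(x)=1$ for every $x\in\Lambda$. (A4) The point $p=(0,\eta/(1-\lambda),0)$ lies in $\Lambda$ and $F(p)=p$. Put $\gamma=\log m$ and $\beta=\log(1/\lambda)$. Then $\beta>\gamma>0$, and there is a $C^\infty$ coordinate system $\phi$ on an open subset of $U$ containing $p$, with $\phi(p)=0$ and with $d_p\phi$ mapping $E^u(p)$ and $E^s(p)$ onto $\mathbb R\oplus 0$ and $0\oplus\mathbb R^2$, such that on a neighbourhood of $p$ the map $F$, read in the coordinates $\phi$, is the time-one map of the flow of the linear vector field $\dot z=Az$, $A=\gamma\,\mathrm{id}_{\mathbb R}\oplus(-\beta)\,\mathrm{id}_{\mathbb R^2}$. (A5) There is a continuous Riemannian metric $g$ on $S^1\times\mathbb R^2$, for which (A2) holds, such that $F$ lies in arbitrarily small $C^1$-neighbourhoods of model maps, in the following sense. A model map is a $C^{1+\theta}$ diffeomorphism $f_0$ of $U$ onto its image with $\overline{f_0(U)}\subset U$, whose attractor $\Lambda_0=\bigcap_{n\ge 0}\overline{f_0^n(U)}$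 is its nonwandering set and is hyperbolic (with respect to $g$) with one-dimensional unstable subspaces $E^u_{f_0}$; for which there is $l>1$ with $\|d_xf_0v\|_g=l\|v\|_g$ for all $x\in\Lambda_0$ and $v\in E^u_{f_0}(x)$; and for which the SRB measure and the measure of maximal entropy on $\Lambda_0$ both exist, are unique, and coincide. The claim is that for every choice of sizes $\varepsilon(f_0)>0$ there is a model map $f_0$ such that $F$ is $\varepsilon(f_0)$-close to $f_0$ in the $C^1$ topology on $U$. Here an SRB measure on the attractor is an invariant Borel probability measure on it whose Lyapunov exponents are almost everywhere nonzero and whose conditional measures on the elements of every measurable partition subordinate to the unstable manifolds (such partitions being required to exist) are almost surely absolutely continuous with respect to the leaf volume; a measure of maximal entropy is an invariant Borel probability measure on the attractor that maximizes the Kolmogorov–Sinai entropy. -/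

import Mathlib

open Set Filter Topology MeasureTheory ProbabilityTheory
open scoped ENNReal NNReal ContDiff

noncomputable section

namespace Solenoid

/-! ### The ambient manifold `S¹ × ℝ²`, the solid torus and differential calculus on it -/

/-- The plane `ℝ²` with its Euclidean norm. -/
abbrev Plane : Type := EuclideanSpace ℝ (Fin 2)

/-- The manifold `S¹ × ℝ²`, with `S¹ = ℝ / ℤ`; it contains the solid torus. -/
abbrev Space : Type := UnitAddCircle × Plane

/-- The tangent space of `S¹ × ℝ²` at any point (the tangent bundle is trivialised by
translations). -/
abbrev Tan : Type := ℝ × Plane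

/-- The solid torus `S¹ × D`, with `D` the closed unit disk. -/
def solidTorus : Set Space := {x | ‖x.2‖ ≤ 1}

/-- The interior of the solid torus. -/
def openSolidTorus : Set Space := {x | ‖x.2‖ < 1}

/-- The covering map `ℝ × ℝ² → S¹ × ℝ²`. -/
def cover (v : Tan) : Space := ((v.1 : UnitAddCircle), v.2)

/-- The inverse of the covering map near `0`: the circle coordinate is represented by a number in
`(-1/2, 1/2]`. The maps `y ↦ chart (y - x)` are charts of `S¹ × ℝ²` centred at `x`,
with inverses `v ↦ x + cover v`. -/
def chart (x : Space) : Tan := ((AddCircle.equivIoc (1 : ℝ) (-1 / 2) x.1 : ℝ), x.2)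

/-- The expression of `f` in the charts centred at `x` and at `f x`. -/
def localRep (f : Space → Space) (x : Space) (v : Tan) : Tan := chart (f (x + cover v) - f x)

/-- The differential `d_x f`. -/
def differential (f : Space → Space) (x : Space) : Tan →L[ℝ] Tan := fderiv ℝ (localRep f x) 0

/-- The product `d_{f^{n-1} x} f ∘ ⋯ ∘ d_x f`, i.e. the differential of `f^n` at `x`. -/
def iterDifferential (f : Space → Space) (x : Space) : ℕ → (Tan →L[ℝ] Tan)
  | 0 => ContinuousLinearMap.id ℝ Tan
  | n + 1 => (differential f (f^[n] x)).comp (iterDifferential f x n)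

/-- A (continuous) Riemannian metric on `S¹ × ℝ²`. -/
structure RiemannianMetric where
  form : Space → Tan →L[ℝ] Tan →L[ℝ] ℝ
  symm : ∀ x v w, form x v w = form x w v
  pos : ∀ x v, v ≠ 0 → 0 < form x v v
  continuous : Continuous form

/-- The norm on the tangent space at `x` given by a Riemannian metric. -/
def RiemannianMetric.norm (g : RiemannianMetric) (x : Space) (v : Tan) : ℝ :=
  Real.sqrt (g.form x v v)

/-- The flat product metric on `S¹ × ℝ²`. -/
def flatMetric : RiemannianMetric where
  form _ := (innerSL ℝ : ℝ →L[ℝ] ℝ →L[ℝ] ℝ).bilinearComp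
      (ContinuousLinearMap.fst ℝ ℝ Plane) (ContinuousLinearMap.fst ℝ ℝ Plane) +
    (innerSL ℝ : Plane →L[ℝ] Plane →L[ℝ] ℝ).bilinearComp
      (ContinuousLinearMap.snd ℝ ℝ Plane) (ContinuousLinearMap.snd ℝ ℝ Plane)
  symm x v w := by
    simp only [add_apply, ContinuousLinearMap.bilinearComp_apply,
      innerSL_apply_apply, ContinuousLinearMap.coe_fst', ContinuousLinearMap.coe_snd']
    rw [real_inner_comm, real_inner_comm v.2]
  pos x v hv := by
    simp only [add_apply, ContinuousLinearMap.bilinearComp_apply,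
      innerSL_apply_apply, ContinuousLinearMap.coe_fst', ContinuousLinearMap.coe_snd',
      real_inner_self_eq_norm_sq]
    by_cases h : v.1 = 0
    · have h2 : v.2 ≠ 0 := fun h2 => hv (Prod.ext h h2)
      have := norm_pos_iff.2 h2
      positivity
    · have := norm_pos_iff.2 h
      positivity
  continuous := continuous_const

/-! ### Attractors and the hypotheses (A1)–(A4) -/

/-- The set `Λ = ⋂ₙ closure (fⁿ(U))`. -/
def attractor (f : Space → Space) (U : Set Space) : Set Space := ⋂ n : ℕ, closure (f^[n] '' U)

/-- The nonwandering set of `f : U → M`. -/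
def nonwandering (f : Space → Space) (U : Set Space) : Set Space :=
  {x | x ∈ U ∧ ∀ W ∈ 𝓝 x, ∃ n : ℕ, 1 ≤ n ∧ (f^[n] '' (W ∩ U) ∩ W).Nonempty}

/-- The standing assumptions: `f : U → M` is a `C^{1+θ}` diffeomorphism onto its image with
`closure (f(U)) ⊆ U`, and its attractor is its nonwandering set. Only the values of `f` on `U`
matter. -/
structure IsAttractorMap (θ : ℝ≥0) (U : Set Space) (f : Space → Space) : Prop where
  isOpen : IsOpen U
  contDiff : ∀ x ∈ U, ContDiffAt ℝ 1 (localRep f x) 0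
  holder : ∃ C : ℝ≥0, HolderOnWith C θ (differential f) U
  injOn : InjOn f U
  immersion : ∀ x ∈ U, Function.Bijective (differential f x)
  trapping : closure (f '' U) ⊆ U
  nonwandering_eq : nonwandering f U = attractor f U

/-- (A1) `f` restricted to `K` is topologically transitive. -/
def HypA1 (f : Space → Space) (K : Set Space) : Prop :=
  ∀ V W : Set Space, IsOpen V → IsOpen W → (V ∩ K).Nonempty → (W ∩ K).Nonempty →
    ∃ n : ℕ, (f^[n] '' (V ∩ K) ∩ (W ∩ K)).Nonempty

/-- (A2) `K` is hyperbolic for `f` with splitting `E^u ⊕ E^s`, with respect to the metric `g`. -/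
structure HypA2 (g : RiemannianMetric) (f : Space → Space) (K : Set Space)
    (Eu Es : Space → Submodule ℝ Tan) : Prop where
  isCompl : ∀ x ∈ K, IsCompl (Eu x) (Es x)
  map_unstable : ∀ x ∈ K, (Eu x).map (differential f x).toLinearMap = Eu (f x)
  map_stable : ∀ x ∈ K, (Es x).map (differential f x).toLinearMap = Es (f x)
  expansion : ∃ ν : ℝ, 1 < ν ∧ ∀ x ∈ K, ∀ v ∈ Eu x,
    ν * g.norm x v ≤ g.norm (f x) (differential f x v)
  contraction : ∃ ζ : ℝ, ζ < 1 ∧ ∀ x ∈ K, ∀ v ∈ Es x,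
    g.norm (f x) (differential f x v) ≤ ζ * g.norm x v

/-- (A3) The unstable subspaces are one-dimensional. -/
def HypA3 (K : Set Space) (Eu : Space → Submodule ℝ Tan) : Prop :=
  ∀ x ∈ K, Module.finrank ℝ (Eu x) = 1

/-- `y'` is the image of `y` under the time-one map of the flow of `ẋ = A x`. -/
def IsTimeOneImage (A : Tan →L[ℝ] Tan) (y y' : Tan) : Prop :=
  ∃ c : ℝ → Tan, (∀ s, HasDerivAt c (A (c s)) s) ∧ c 0 = y ∧ c 1 = y'

/-- The linear vector field `A = γ id_u ⊕ (-β) id_s` on `ℝ ⊕ ℝ²`. -/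
def linearField (γ β : ℝ) : Tan →L[ℝ] Tan :=
  (γ • ContinuousLinearMap.id ℝ ℝ).prodMap (-β • ContinuousLinearMap.id ℝ Plane)

/-- A `C^∞` local coordinate system `φ` on an open subset of `S¹ × ℝ²`. -/
structure IsSmoothChart (φ : OpenPartialHomeomorph Space Tan) : Prop where
  contDiff : ∀ x ∈ φ.source, ContDiffAt ℝ ∞ (fun v : Tan => φ (x + cover v)) 0
  contDiff_symm : ∀ y ∈ φ.target,
    ContDiffAt ℝ ∞ (fun v : Tan => chart (φ.symm (y + v) - φ.symm y)) 0

/-- (A4) `p` is a fixed point of `f` in the attractor and, in suitable smooth coordinates near `p`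
which send `p` to `0` and identify `E^u(p) ⊕ E^s(p)` with `ℝ ⊕ ℝ²`, the map `f` is in a
neighbourhood `V` of `p` the time-one map of the flow of `ẋ = A x`,
`A = γ id_u ⊕ (-β) id_s`, where `β > γ > 0`. -/
def HypA4 (f : Space → Space) (U : Set Space) (Eu Es : Space → Submodule ℝ Tan)
    (p : Space) (γ β : ℝ) : Prop :=
  0 < γ ∧ γ < β ∧ p ∈ attractor f U ∧ f p = p ∧
  ∃ φ : OpenPartialHomeomorph Space Tan, IsSmoothChart φ ∧
    p ∈ φ.source ∧ φ.source ⊆ U ∧ φ p = 0 ∧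
    (Eu p).map (fderiv ℝ (fun v : Tan => φ (p + cover v)) 0).toLinearMap
      = LinearMap.range (LinearMap.inl ℝ ℝ Plane) ∧
    (Es p).map (fderiv ℝ (fun v : Tan => φ (p + cover v)) 0).toLinearMap
      = LinearMap.range (LinearMap.inr ℝ ℝ Plane) ∧
    ∃ V ∈ 𝓝 p, V ⊆ φ.source ∧ ∀ x ∈ V, f x ∈ φ.source ∧
      IsTimeOneImage (linearField γ β) (φ x) (φ (f x))

/-! ### Invariant measures, entropy, SRB measures, and the hypothesis (A5) -/

/-- `μ` is an `f`-invariant Borel probability measure on `K`. -/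
def IsInvariantOn (f : Space → Space) (K : Set Space) (μ : ProbabilityMeasure Space) : Prop :=
  (μ : Measure Space) Kᶜ = 0 ∧ (μ : Measure Space).map f = μ

/-- The entropy `H_μ(ξ ∨ f⁻¹ξ ∨ ⋯ ∨ f^{-(n-1)}ξ)` of the `n`-th refinement of the finite partition
into the fibres of `ξ`. -/
def partitionEntropy (f : Space → Space) (μ : ProbabilityMeasure Space) {k : ℕ}
    (ξ : Space → Fin k) (n : ℕ) : ℝ :=
  ∑ w : Fin n → Fin k,
    Real.negMulLog ((μ : Measure Space).real {x | ∀ i : Fin n, ξ (f^[i] x) = w i})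

/-- The Kolmogorov–Sinai entropy `h_μ(f)`. -/
def entropy (f : Space → Space) (μ : ProbabilityMeasure Space) : EReal :=
  ⨆ (k : ℕ) (ξ : Space → Fin k) (_ : Measurable ξ),
    limsup (fun n : ℕ => ((partitionEntropy f μ ξ n / n : ℝ) : EReal)) atTop

/-- `μ` is a measure of maximal entropy of `f` restricted to `K`. -/
def IsMaximalEntropy (f : Space → Space) (K : Set Space) (μ : ProbabilityMeasure Space) : Prop :=
  IsInvariantOn f K μ ∧ ∀ ν, IsInvariantOn f K ν → entropy f ν ≤ entropy f μ

/-- `X` is a backward orbit of `x` in `K`. -/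
def IsBackwardOrbit (f : Space → Space) (K : Set Space) (x : Space) (X : ℕ → Space) : Prop :=
  X 0 = x ∧ ∀ n, X n ∈ K ∧ f (X (n + 1)) = X n

/-- The (global) unstable manifold of `x` in the attractor `K`. -/
def unstableSet (f : Space → Space) (K : Set Space) (x : Space) : Set Space :=
  {y | ∃ X Y : ℕ → Space, IsBackwardOrbit f K x X ∧ IsBackwardOrbit f K y Y ∧
    Tendsto (fun n => dist (X n) (Y n)) atTop (𝓝 0)}

/-- The local unstable manifold of size `r` of `x` in the attractor `K`. -/
def localUnstableSet (f : Space → Space) (K : Set Space) (r : ℝ) (x : Space) : Set Space :=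
  {y | ∃ X Y : ℕ → Space, IsBackwardOrbit f K x X ∧ IsBackwardOrbit f K y Y ∧
    ∀ n, dist (X n) (Y n) ≤ r}

/-- The measurable partition of `K` into the fibres of `q` is subordinate to the unstable
manifolds: for almost every `x`, its element containing `x` lies in the unstable manifold of `x`
and contains a neighbourhood of `x` in it. -/
def IsSubordinate (f : Space → Space) (K : Set Space) (μ : ProbabilityMeasure Space)
    (q : Space → ℝ) : Prop :=
  Measurable q ∧ ∀ᵐ x ∂(μ : Measure Space),
    {y | y ∈ K ∧ q y = q x} ⊆ unstableSet f K x ∧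
    ∃ r > 0, localUnstableSet f K r x ⊆ {y | y ∈ K ∧ q y = q x}

/-- `μ` is an SRB measure of `f` on the attractor `K` (with one-dimensional unstable manifolds):
it is invariant and hyperbolic (all Lyapunov exponents are nonzero almost everywhere), and its
conditional measures on unstable manifolds are absolutely continuous with respect to the leaf
volume, which on the one-dimensional leaves is arc length, i.e. the one-dimensional Hausdorff
measure. -/
structure IsSRB (f : Space → Space) (K : Set Space) (μ : ProbabilityMeasure Space) : Prop where
  invariant : IsInvariantOn f K μ
  hyperbolic : ∀ᵐ x ∂(μ : Measure Space), ∀ v : Tan, v ≠ 0 → ∃ χ : ℝ, χ ≠ 0 ∧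
    Tendsto (fun n : ℕ => Real.log ‖iterDifferential f x n v‖ / n) atTop (𝓝 χ)
  exists_subordinate : ∃ q, IsSubordinate f K μ q
  absolutelyContinuous : ∀ q, IsSubordinate f K μ q → ∀ᵐ x ∂(μ : Measure Space),
    condDistrib id q (μ : Measure Space) (q x) ≪ (μH[1]).restrict (unstableSet f K x)

/-- `f` and `f₀` are `ε`-close in the `C¹` topology on `U`. -/
def IsC1Close (U : Set Space) (ε : ℝ) (f f₀ : Space → Space) : Prop :=
  ∀ x ∈ U, dist (f x) (f₀ x) < ε ∧ ‖differential f x - differential f₀ x‖ < ε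

/-- `f₀` is a map of the same class as `f` whose attractor is hyperbolic with one-dimensional
unstable subspaces, with uniform expansion (with respect to `g`), for which
the SRB measure and the measure of maximal entropy coincide (each of them exists and is unique). -/
def IsModelMap (θ : ℝ≥0) (g : RiemannianMetric) (U : Set Space) (f₀ : Space → Space) : Prop :=
  IsAttractorMap θ U f₀ ∧
  (∃ Eu Es : Space → Submodule ℝ Tan,
    HypA2 g f₀ (attractor f₀ U) Eu Es ∧ HypA3 (attractor f₀ U) Eu ∧
    ∃ l : ℝ, 1 < l ∧ ∀ x ∈ attractor f₀ U, ∀ v ∈ Eu x,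
      g.norm (f₀ x) (differential f₀ x v) = l * g.norm x v) ∧
  ∃ μ : ProbabilityMeasure Space, (∀ ν, IsSRB f₀ (attractor f₀ U) ν ↔ ν = μ) ∧
    ∀ ν, IsMaximalEntropy f₀ (attractor f₀ U) ν ↔ ν = μ

/-- (A5) `f` lies in a sufficiently small `C¹`-neighbourhood of a model map `f₀`: whatever
size `ε f₀ > 0` is required of the neighbourhoods of the maps `f₀`, some model map `f₀` is
`ε f₀`-close to `f`. -/
def HypA5 (θ : ℝ≥0) (g : RiemannianMetric) (U : Set Space) (f : Space → Space) : Prop :=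
  ∀ ε : (Space → Space) → ℝ, (∀ h, 0 < ε h) →
    ∃ f₀, IsModelMap θ g U f₀ ∧ IsC1Close U (ε f₀) f f₀

/-! ### The solenoid map -/

/-- The map `(t, x, y) ↦ (m t, a x + η cos 2πt, d y + η sin 2πt)`; here
`AddCircle.toCircle t = exp(2πit)`. -/
def solenoidMap (m : ℕ) (a d η : ℝ) (x : Space) : Space :=
  (m • x.1, !₂[a * x.2 0 + η * (AddCircle.toCircle x.1 : ℂ).re,
    d * x.2 1 + η * (AddCircle.toCircle x.1 : ℂ).im])

theorem solenoidMap_coe (m : ℕ) (a d η t : ℝ) (z : Plane) :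
    solenoidMap m a d η ((t : UnitAddCircle), z) =
      (((m * t : ℝ) : UnitAddCircle), !₂[a * z 0 + η * Real.cos (2 * Real.pi * t),
        d * z 1 + η * Real.sin (2 * Real.pi * t)]) := by
  have h : (AddCircle.toCircle (t : UnitAddCircle) : ℂ) =
      Complex.exp ((2 * Real.pi * t : ℝ) * Complex.I) := by
    rw [AddCircle.toCircle_apply_mk, Circle.coe_exp]
    simp
  have hm : m • (t : UnitAddCircle) = ((m * t : ℝ) : UnitAddCircle) := by
    rw [← nsmul_eq_mul, AddCircle.coe_nsmul]
  simp only [solenoidMap, h, hm, Complex.exp_ofReal_mul_I_re, Complex.exp_ofReal_mul_I_im]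

end Solenoid

end

/-! Written as `F(t, z) = (mt, λz + η circ t)`, the solenoid map has an attractor that is a copy of
the compact group `Sol m`, the inverse limit of the circle under multiplication by `m`. Solving `z₀
= λz₁ + η circ t₁` backwards gives the series in `embed`. It intertwines multiplication by `m` with
`F` (`solenoidMap_embed`), is injective because `F` is, and has the attractor as its image
(`range_embed`). Transitivity then comes from the one-parameter subgroup `flow` of `Sol m`, and the
nonwandering property from Poincaré recurrence for Haar measure.

The stable planes are `0 ⊕ ℝ²`. The unstable line is spanned by `(1, slope)`, with `slope` again a
geometric series, and `DF` maps `(1, slope t)` to `m (1, slope (m • t))`. A continuous metric in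
which these vectors have length one and are orthogonal to the stable planes makes the unstable
expansion exactly `m`. Near the fixed point, `F` is affine in `z`, so subtracting a smooth solution
of `w(ms) = λw(s) + η circ s` makes it linear.

For (A5) the model map is `F` itself, at distance zero. What remains is that both the SRB measure
and the measure of maximal entropy exist, are unique and equal the image of Haar measure.

Maximal entropy: the `m`-adic cells of the circle coordinate generate under iteration, so the
entropy is at most the Shannon entropy of the `n`-cells divided by `n` (`entropy_le`), hence at most
`log m`. Equality makes every cell distribution uniform, and the cells determine an invariant
measure (`eq_of_measure_cell_eq`).

SRB, uniqueness: unstable leaves are flow orbits, transverse to the fibres of the circle projection.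
Absolute continuity along leaves therefore makes the projected measure absolutely continuous, and
ergodicity of multiplication by `m` makes it Lebesgue.

SRB, existence: Haar measure is invariant under the flow. For any subordinate partition this yields
a kernel that spreads mass along orbit pieces and fixes the conditional measures
(`condDistrib_eq_comp`), which are thereby absolutely continuous on leaves. -/

noncomputable section

namespace Solenoid

section

/-! ### Shannon entropy of finite-valued random variables -/

section ShannonEntropy

variable {Ω A B : Type*} [MeasurableSpace Ω] [Fintype A] [Fintype B]

/-- The Shannon entropy of the finite-valued random variable `X`. -/
def shannon (μ : Measure Ω) (X : Ω → A) : ℝ :=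
  ∑ a, Real.negMulLog (μ.real (X ⁻¹' {a}))

theorem shannon_nonneg (μ : Measure Ω) [IsProbabilityMeasure μ] (X : Ω → A) :
    0 ≤ shannon μ X :=
  Finset.sum_nonneg fun _ _ => Real.negMulLog_nonneg measureReal_nonneg measureReal_le_one

theorem shannon_of_uniform (μ : Measure Ω) {X : Ω → A}
    (h : ∀ a, μ.real (X ⁻¹' {a}) = (Fintype.card A : ℝ)⁻¹) :
    shannon μ X = Real.log (Fintype.card A) := by
  rw [shannon, Finset.sum_congr rfl fun a _ => by rw [h a], Finset.sum_const, Finset.card_univ,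
    nsmul_eq_mul, Real.negMulLog, Real.log_inv]
  -- For empty `A` both sides vanish, as `Real.log 0 = 0`.
  rcases Nat.eq_zero_or_pos (Fintype.card A) with h0 | h0
  · simp [h0]
  · field_simp

variable [MeasurableSpace A] [MeasurableSpace B] [MeasurableSingletonClass A]
  [MeasurableSingletonClass B]

theorem sum_measureReal_fibre (μ : Measure Ω) [IsFiniteMeasure μ] {X : Ω → A} (hX : Measurable X)
    {S : Set Ω} (hS : MeasurableSet S) : ∑ a, μ.real (X ⁻¹' {a} ∩ S) = μ.real S := by
  have h : S = ⋃ a ∈ (Finset.univ : Finset A), (X ⁻¹' {a} ∩ S) := by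
    ext x; simp
  conv_rhs => rw [h]
  rw [measureReal_biUnion_finset]
  · intro a _ b _ hab
    refine Set.disjoint_left.2 ?_
    rintro x ⟨hx, -⟩ ⟨hx', -⟩
    exact hab (by rw [← mem_singleton_iff.1 hx, ← mem_singleton_iff.1 hx'])
  · exact fun a _ => (hX (measurableSet_singleton a)).inter hS

theorem negMulLog_le_of_le {p q : ℝ} (hp : 0 ≤ p) (hpq : p ≤ q) :
    -(p * Real.log q) ≤ Real.negMulLog p := by
  rcases hp.eq_or_lt with rfl | hp
  · simp
  · have := Real.log_le_log hp hpq
    simp only [Real.negMulLog]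
    nlinarith

/-- Gibbs' inequality term by term: `log u ≤ u - 1` at `u = q / p`, multiplied by `p`. The errors `q
- p` cancel in a sum over two probability vectors. -/
theorem mul_log_sub_le {p q : ℝ} (hp : 0 ≤ p) (hq : 0 ≤ q) (h : q = 0 → p = 0) :
    Real.negMulLog p ≤ -(p * Real.log q) + (q - p) := by
  rcases hp.eq_or_lt with rfl | hp
  · simpa using hq
  · have hq' : 0 < q := hq.lt_of_ne fun h' => hp.ne' (h h'.symm)
    have h1 := Real.log_le_sub_one_of_pos (div_pos hq' hp)
    rw [Real.log_div hq'.ne' hp.ne'] at h1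
    have h2 : p * (Real.log q - Real.log p) ≤ p * (q / p - 1) := by gcongr
    rw [mul_sub, mul_sub, mul_div_cancel₀ _ hp.ne'] at h2
    simp only [Real.negMulLog]
    linarith

theorem eq_of_mul_log_sub_eq {p q : ℝ} (hp : 0 ≤ p) (hq : 0 < q)
    (h : Real.negMulLog p = -(p * Real.log q) + (q - p)) : p = q := by
  rcases hp.eq_or_lt with rfl | hp
  · simp at h; exact h
  · by_contra hne
    have h1 := Real.log_lt_sub_one_of_pos (div_pos hq hp)
      (fun h' => hne ((div_eq_one_iff_eq hp.ne').1 h').symm)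
    rw [Real.log_div hq.ne' hp.ne'] at h1
    have h2 : p * (Real.log q - Real.log p) < p * (q / p - 1) := by gcongr
    rw [mul_sub, mul_sub, mul_div_cancel₀ _ hp.ne'] at h2
    simp only [Real.negMulLog] at h
    linarith

/-- A function of `Y` has at most the entropy of `Y`. -/
theorem shannon_le_of_determined (μ : Measure Ω) [IsProbabilityMeasure μ] {X : Ω → A} {Y : Ω → B}
    (hX : Measurable X) (hY : Measurable Y) (h : ∀ u u', Y u = Y u' → X u = X u') :
    shannon μ X ≤ shannon μ Y := by
  -- A `Y`-fibre is either disjoint from a given `X`-fibre or contained in it.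
  have key : ∀ b, ∀ a, μ.real (X ⁻¹' {a} ∩ Y ⁻¹' {b}) = 0 ∨
      μ.real (X ⁻¹' {a} ∩ Y ⁻¹' {b}) = μ.real (Y ⁻¹' {b}) := by
    intro b a
    by_cases hne : (X ⁻¹' {a} ∩ Y ⁻¹' {b}).Nonempty
    · right
      obtain ⟨u, h1, h2⟩ := hne
      congr 1
      refine inter_eq_right.2 fun u' h3 => ?_
      rw [mem_preimage, mem_singleton_iff] at *
      rw [← h1]
      exact h _ _ (h3.trans h2.symm)
    · left
      rw [not_nonempty_iff_eq_empty.1 hne, measureReal_empty]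
  have h1 : shannon μ X = ∑ a, ∑ b, -(μ.real (X ⁻¹' {a} ∩ Y ⁻¹' {b}) *
      Real.log (μ.real (X ⁻¹' {a}))) := by
    refine Finset.sum_congr rfl fun a _ => ?_
    rw [Finset.sum_neg_distrib, ← Finset.sum_mul]
    have := sum_measureReal_fibre μ hY (hX (measurableSet_singleton a))
    simp_rw [inter_comm (X ⁻¹' {a})]
    rw [this, Real.negMulLog]
    ring
  rw [h1, Finset.sum_comm]
  refine Finset.sum_le_sum fun b _ => ?_
  have h2 := sum_measureReal_fibre μ hX (hY (measurableSet_singleton b))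
  calc ∑ a, -(μ.real (X ⁻¹' {a} ∩ Y ⁻¹' {b}) * Real.log (μ.real (X ⁻¹' {a})))
      ≤ ∑ a, -(μ.real (X ⁻¹' {a} ∩ Y ⁻¹' {b}) * Real.log (μ.real (Y ⁻¹' {b}))) := by
        refine Finset.sum_le_sum fun a _ => ?_
        rcases key b a with h0 | h0
        · simp [h0]
        · have h3 : μ.real (Y ⁻¹' {b}) ≤ μ.real (X ⁻¹' {a}) := by
            rw [← h0]; exact measureReal_mono inter_subset_left
          rw [h0]
          exact (negMulLog_le_of_le measureReal_nonneg h3).trans_eq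
            (by rw [Real.negMulLog, neg_mul])
    _ = Real.negMulLog (μ.real (Y ⁻¹' {b})) := by
        rw [Finset.sum_neg_distrib, ← Finset.sum_mul, h2, Real.negMulLog]; ring

/-- Gibbs' inequality for the joint law against the product of its marginals; both have total mass
one, so the error terms cancel. -/
theorem shannon_prodMk_le (μ : Measure Ω) [IsProbabilityMeasure μ] {X : Ω → A} {Y : Ω → B}
    (hX : Measurable X) (hY : Measurable Y) :
    shannon μ (fun u => (X u, Y u)) ≤ shannon μ X + shannon μ Y := by
  set p : A → B → ℝ := fun a b => μ.real (X ⁻¹' {a} ∩ Y ⁻¹' {b}) with hp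
  set x : A → ℝ := fun a => μ.real (X ⁻¹' {a})
  set y : B → ℝ := fun b => μ.real (Y ⁻¹' {b})
  have hpx : ∀ a, ∑ b, p a b = x a := fun a => by
    have := sum_measureReal_fibre μ hY (hX (measurableSet_singleton a))
    simp_rw [hp, inter_comm (X ⁻¹' {a})]
    exact this
  have hpy : ∀ b, ∑ a, p a b = y b := fun b =>
    sum_measureReal_fibre μ hX (hY (measurableSet_singleton b))
  have hx1 : ∑ a, x a = 1 := by
    simpa using sum_measureReal_fibre μ hX MeasurableSet.univ
  have hy1 : ∑ b, y b = 1 := by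
    simpa using sum_measureReal_fibre μ hY MeasurableSet.univ
  have hp0 : ∀ a b, 0 ≤ p a b := fun _ _ => measureReal_nonneg
  have hle1 : ∀ a b, p a b ≤ x a := fun a b => measureReal_mono inter_subset_left
  have hle2 : ∀ a b, p a b ≤ y b := fun a b => measureReal_mono inter_subset_right
  have h0 : shannon μ (fun u => (X u, Y u)) = ∑ a, ∑ b, Real.negMulLog (p a b) := by
    rw [shannon, Fintype.sum_prod_type]
    refine Finset.sum_congr rfl fun a _ => Finset.sum_congr rfl fun b _ => ?_
    congr 2
    ext u
    simp [Prod.ext_iff]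
  have h1 : ∀ a b, Real.negMulLog (p a b) ≤
      -(p a b * Real.log (x a)) + -(p a b * Real.log (y b)) + (x a * y b - p a b) := by
    intro a b
    have hxy : x a * y b = 0 → p a b = 0 := by
      intro h
      rcases mul_eq_zero.1 h with h | h
      · exact le_antisymm (h ▸ hle1 a b) (hp0 a b)
      · exact le_antisymm (h ▸ hle2 a b) (hp0 a b)
    have h2 := mul_log_sub_le (hp0 a b) (mul_nonneg (a := x a) (b := y b) measureReal_nonneg
      measureReal_nonneg) hxy
    by_cases h : p a b = 0
    · rw [h] at h2 ⊢; simpa using h2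
    · have hx0 : x a ≠ 0 := fun h' => h (hxy (by rw [h', zero_mul]))
      have hy0 : y b ≠ 0 := fun h' => h (hxy (by rw [h', mul_zero]))
      rw [Real.log_mul hx0 hy0] at h2
      linarith
  rw [h0]
  calc ∑ a, ∑ b, Real.negMulLog (p a b)
      ≤ ∑ a, ∑ b, (-(p a b * Real.log (x a)) + -(p a b * Real.log (y b)) +
          (x a * y b - p a b)) :=
        Finset.sum_le_sum fun a _ => Finset.sum_le_sum fun b _ => h1 a b
    _ = shannon μ X + shannon μ Y := by
        simp only [Finset.sum_add_distrib, Finset.sum_sub_distrib, Finset.sum_neg_distrib]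
        have e1 : ∑ a, ∑ b, p a b * Real.log (x a) = ∑ a, x a * Real.log (x a) := by
          refine Finset.sum_congr rfl fun a _ => ?_
          rw [← Finset.sum_mul, hpx]
        have e2 : ∑ a, ∑ b, p a b * Real.log (y b) = ∑ b, y b * Real.log (y b) := by
          rw [Finset.sum_comm]
          refine Finset.sum_congr rfl fun b _ => ?_
          rw [← Finset.sum_mul, hpy]
        have e3 : ∑ a, ∑ b, x a * y b = 1 := by
          simp_rw [← Finset.mul_sum, hy1, mul_one, hx1]
        have e4 : ∑ a, ∑ b, p a b = 1 := by simp_rw [hpx, hx1]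
        rw [e1, e2, e3, e4]
        simp only [shannon, Real.negMulLog, neg_mul, Finset.sum_neg_distrib]
        simp only [x, y]
        ring

/-- The entropy of a finite family is at most the sum of the entropies. -/
theorem shannon_pi_le (μ : Measure Ω) [IsProbabilityMeasure μ] (n : ℕ) {X : Fin n → Ω → A}
    (hX : ∀ i, Measurable (X i)) :
    shannon μ (fun u i => X i u) ≤ ∑ i, shannon μ (X i) := by
  classical
  induction n with
  | zero =>
    have h : ∀ a, (fun u (i : Fin 0) => X i u) ⁻¹' {a} = univ := fun a =>
      eq_univ_of_forall fun u => Subsingleton.elim _ _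
    simp [shannon, h]
  | succ n ih =>
    rw [Fin.sum_univ_castSucc]
    have hm : Measurable fun u (i : Fin n) => X i.castSucc u := measurable_pi_lambda _ fun i => hX _
    refine (shannon_le_of_determined μ (measurable_pi_lambda _ hX)
      (hm.prodMk (hX (Fin.last n))) fun u u' h => ?_).trans
      ((shannon_prodMk_le μ hm (hX (Fin.last n))).trans
        (add_le_add_left (ih fun i => hX i.castSucc) _))
    rw [Prod.ext_iff] at h
    funext i
    refine Fin.lastCases h.2 (fun i => congrFun h.1 i) i

theorem shannon_comp_measurePreserving {μ : Measure Ω} {T : Ω → Ω} (hT : MeasurePreserving T μ μ)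
    {X : Ω → A} (hX : Measurable X) : shannon μ (X ∘ T) = shannon μ X := by
  refine Finset.sum_congr rfl fun a _ => ?_
  rw [preimage_comp, measureReal_def, hT.measure_preimage
    (hX (measurableSet_singleton a)).nullMeasurableSet, measureReal_def]

/-- Maximal entropy characterises the uniform distribution. -/
theorem eq_uniform_of_log_card_le_shannon (μ : Measure Ω) [IsProbabilityMeasure μ] {X : Ω → A}
    (hX : Measurable X) (h : Real.log (Fintype.card A) ≤ shannon μ X) (a : A) :
    μ.real (X ⁻¹' {a}) = (Fintype.card A : ℝ)⁻¹ := by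
  set N : ℝ := (Fintype.card A : ℝ)
  have : Nonempty A := ⟨a⟩
  have hN : 0 < N := Nat.cast_pos.2 Fintype.card_pos
  set p : A → ℝ := fun a => μ.real (X ⁻¹' {a})
  have hp1 : ∑ a, p a = 1 := by simpa using sum_measureReal_fibre μ hX MeasurableSet.univ
  -- Gibbs' inequality against the uniform vector. These bounds add up to exactly `log N`, so
  -- equality must hold in every term.
  have hle : ∀ b ∈ Finset.univ, Real.negMulLog (p b) ≤ -(p b * Real.log N⁻¹) + (N⁻¹ - p b) :=
    fun b _ => mul_log_sub_le measureReal_nonneg (by positivity)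
      fun h => absurd h (by positivity)
  have hs : ∑ b, (-(p b * Real.log N⁻¹) + (N⁻¹ - p b)) = Real.log N := by
    rw [Finset.sum_add_distrib, Finset.sum_sub_distrib, Finset.sum_neg_distrib, ← Finset.sum_mul,
      hp1, Finset.sum_const, Finset.card_univ, nsmul_eq_mul, Real.log_inv]
    change _ + (N * N⁻¹ - 1) = _
    rw [mul_inv_cancel₀ hN.ne']
    ring
  have heq := (Finset.sum_eq_sum_iff_of_le hle).1
    (le_antisymm (Finset.sum_le_sum hle) (hs.trans_le h)) a (Finset.mem_univ a)
  exact eq_of_mul_log_sub_eq measureReal_nonneg (by positivity) heq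

/-- Binary entropy is continuous and vanishes at `0`. This bounds the cost of recording the rare
errors made when a partition is approximated by cells. -/
theorem shannon_indicator_lt (μ : Measure Ω) [IsProbabilityMeasure μ] {ε : ℝ} (hε : 0 < ε) :
    ∃ δ > 0, ∀ X : Ω → Bool, Measurable X → μ.real (X ⁻¹' {true}) < δ → shannon μ X < ε := by
  have hc : Continuous fun p : ℝ => Real.negMulLog p + Real.negMulLog (1 - p) := by fun_prop
  have h0 := hc.tendsto 0
  simp only [Real.negMulLog_zero, sub_zero, Real.negMulLog_one, add_zero] at h0
  obtain ⟨δ, hδ, h⟩ := Metric.eventually_nhds_iff.1 (h0.eventually (gt_mem_nhds hε))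
  refine ⟨δ, hδ, fun X hX hlt => ?_⟩
  have h1 : μ.real (X ⁻¹' {false}) = 1 - μ.real (X ⁻¹' {true}) := by
    have := sum_measureReal_fibre μ hX MeasurableSet.univ
    simp at this
    linarith
  have h2 := @h (μ.real (X ⁻¹' {true}))
    (by rwa [Real.dist_eq, sub_zero, abs_of_nonneg measureReal_nonneg])
  rw [shannon, Fintype.sum_bool, h1]
  exact h2

end ShannonEntropy

end

section

/-! ### The solenoid map and its differential -/

/-- The parameter range of the solenoid map. -/
structure IsAdmissible (m : ℕ) (lam η : ℝ) : Prop where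
  two_le : 2 ≤ m
  η_pos : 0 < η
  lam_pos : 0 < lam
  add_lt : lam + η < 1
  mul_lt : m * lam < 1

namespace IsAdmissible

variable {m : ℕ} {lam η : ℝ}

theorem m_pos (H : IsAdmissible m lam η) : 0 < m := by have := H.two_le; omega

theorem two_le_real (H : IsAdmissible m lam η) : (2 : ℝ) ≤ m := by exact_mod_cast H.two_le

theorem lam_lt_one (H : IsAdmissible m lam η) : lam < 1 := by linarith [H.add_lt, H.η_pos]

end IsAdmissible

theorem exists_coe_eq_abs_eq_norm (a : UnitAddCircle) :
    ∃ s : ℝ, (s : UnitAddCircle) = a ∧ |s| = ‖a‖ := by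
  induction a using QuotientAddGroup.induction_on with
  | H r =>
    refine ⟨r - round r, ?_, (UnitAddCircle.norm_eq).symm⟩
    rw [AddCircle.coe_sub, sub_eq_self]
    exact (AddCircle.coe_eq_zero_iff (1 : ℝ)).2 ⟨round r, by simp⟩

theorem norm_coe_le (s : ℝ) : ‖(s : UnitAddCircle)‖ ≤ |s| := by
  rw [UnitAddCircle.norm_eq]
  have := round_le s 0
  simpa using this

theorem norm_coe_eq {s : ℝ} (hs : |s| ≤ 1 / 2) : ‖(s : UnitAddCircle)‖ = |s| :=
  (AddCircle.norm_coe_eq_abs_iff (1 : ℝ) one_ne_zero).2 (by simpa using hs)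

/-- The isometry `x + iy ↦ (x, y)`. -/
abbrev toPlane : ℂ ≃ₗᵢ[ℝ] Plane := Complex.orthonormalBasisOneI.repr

/-- The unit vector `(cos 2πt, sin 2πt)`. -/
def circ (t : UnitAddCircle) : Plane := toPlane (AddCircle.toCircle t : ℂ)

/-- The derivative of `circ`. -/
def dcirc (t : UnitAddCircle) : Plane :=
  toPlane (2 * Real.pi * Complex.I * (AddCircle.toCircle t : ℂ))

theorem toCircle_coe_eq_exp (s : ℝ) :
    (AddCircle.toCircle (s : UnitAddCircle) : ℂ) = Complex.exp (2 * Real.pi * Complex.I * s) := by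
  rw [AddCircle.toCircle_apply_mk, Circle.coe_exp]
  congr 1
  push_cast
  ring

theorem toCircle_add_coe (a : UnitAddCircle) (s : ℝ) :
    (AddCircle.toCircle (a + (s : UnitAddCircle)) : ℂ) =
      AddCircle.toCircle a * Complex.exp (2 * Real.pi * Complex.I * s) := by
  rw [AddCircle.toCircle_add, Circle.coe_mul, toCircle_coe_eq_exp]

theorem toPlane_apply (z : ℂ) : toPlane z = !₂[z.re, z.im] := by
  ext i
  rw [Complex.orthonormalBasisOneI_repr_apply]

/-- The working form of the map: over each `t` it is affine in the plane with linear part `lam`. -/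
theorem solenoidMap_eq (m : ℕ) (lam η : ℝ) (x : Space) :
    solenoidMap m lam lam η x = (m • x.1, lam • x.2 + η • circ x.1) := by
  refine Prod.ext rfl ?_
  ext i
  fin_cases i <;> simp [solenoidMap, circ, toPlane_apply]

theorem continuous_circ : Continuous circ :=
  toPlane.continuous.comp (continuous_subtype_val.comp AddCircle.continuous_toCircle)

theorem continuous_dcirc : Continuous dcirc :=
  toPlane.continuous.comp (continuous_const.mul
    (continuous_subtype_val.comp AddCircle.continuous_toCircle))

theorem norm_circ (t : UnitAddCircle) : ‖circ t‖ = 1 := by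
  rw [circ, LinearIsometryEquiv.norm_map, Circle.norm_coe]

theorem norm_two_pi_I : ‖(2 * Real.pi * Complex.I : ℂ)‖ = 2 * Real.pi := by
  simp [abs_of_pos Real.pi_pos]

theorem norm_dcirc (t : UnitAddCircle) : ‖dcirc t‖ = 2 * Real.pi := by
  rw [dcirc, LinearIsometryEquiv.norm_map, norm_mul, Circle.norm_coe, norm_two_pi_I, mul_one]

theorem norm_toCircle_sub_le (a b : UnitAddCircle) :
    ‖(AddCircle.toCircle a : ℂ) - AddCircle.toCircle b‖ ≤ 2 * Real.pi * ‖a - b‖ := by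
  obtain ⟨s, hs, hs'⟩ := exists_coe_eq_abs_eq_norm (a - b)
  have ha : a = b + (s : UnitAddCircle) := by rw [hs]; abel
  rw [← hs', ha, toCircle_add_coe, ← mul_sub_one, norm_mul, Circle.norm_coe, one_mul]
  have := Real.norm_exp_I_mul_ofReal_sub_one_le (x := 2 * Real.pi * s)
  rw [Real.norm_eq_abs, abs_mul, abs_of_pos Real.two_pi_pos] at this
  convert this using 4
  push_cast
  ring

theorem norm_circ_sub_le (a b : UnitAddCircle) : ‖circ a - circ b‖ ≤ 2 * Real.pi * ‖a - b‖ := by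
  rw [circ, circ, ← map_sub, LinearIsometryEquiv.norm_map]
  exact norm_toCircle_sub_le a b

theorem norm_dcirc_sub_le (a b : UnitAddCircle) :
    ‖dcirc a - dcirc b‖ ≤ (2 * Real.pi) ^ 2 * ‖a - b‖ := by
  rw [dcirc, dcirc, ← map_sub, LinearIsometryEquiv.norm_map, ← mul_sub, norm_mul, norm_two_pi_I,
    pow_two, mul_assoc (2 * Real.pi)]
  gcongr
  exact norm_toCircle_sub_le a b

theorem contDiff_circ_add (a : UnitAddCircle) :
    ContDiff ℝ ∞ fun s : ℝ => circ (a + (s : UnitAddCircle)) := by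
  simp_rw [circ, toCircle_add_coe]
  refine toPlane.toContinuousLinearEquiv.contDiff.comp (contDiff_const.mul ?_)
  exact Complex.contDiff_exp.comp (contDiff_const.mul Complex.ofRealCLM.contDiff)

theorem hasDerivAt_circ_add (a : UnitAddCircle) (s : ℝ) :
    HasDerivAt (fun s : ℝ => circ (a + (s : UnitAddCircle))) (dcirc (a + s)) s := by
  simp_rw [circ, dcirc, toCircle_add_coe]
  have h1 : HasDerivAt (fun s : ℝ => (2 * Real.pi * Complex.I * (s : ℂ)))
      (2 * Real.pi * Complex.I) s := by
    simpa using (Complex.ofRealCLM.hasDerivAt (x := s)).const_mul (2 * Real.pi * Complex.I : ℂ)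
  have h2 := (h1.cexp.const_mul (AddCircle.toCircle a : ℂ))
  have h3 := toPlane.toContinuousLinearEquiv.hasFDerivAt.comp_hasDerivAt s h2
  have e : (2 * Real.pi * Complex.I * ((AddCircle.toCircle a : ℂ) *
      Complex.exp (2 * Real.pi * Complex.I * s)) : ℂ) = AddCircle.toCircle a *
      (Complex.exp (2 * Real.pi * Complex.I * s) * (2 * Real.pi * Complex.I)) := by ring
  rw [e]
  exact h3

theorem chart_coe {s : ℝ} (hs : |s| < 1 / 2) (z : Plane) :
    chart ((s : UnitAddCircle), z) = (s, z) := by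
  rw [chart, AddCircle.equivIoc_coe_eq]
  rw [abs_lt] at hs
  constructor <;> linarith

theorem eventually_abs_fst_mul_lt (c : ℝ) {r : ℝ} (hr : 0 < r) :
    ∀ᶠ v : Tan in 𝓝 0, |c * v.1| < r := by
  have h : Continuous fun v : Tan => |c * v.1| := by fun_prop
  exact (h.tendsto 0).eventually (gt_mem_nhds (by simpa using hr))

/-- The solenoid map in the charts centred at `x` and its image. -/
def solRep (m : ℕ) (lam η : ℝ) (a : UnitAddCircle) (v : Tan) : Tan :=
  (m * v.1, lam • v.2 + η • (circ (a + (v.1 : UnitAddCircle)) - circ a))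

/-- `chart` undoes `cover` only for circle displacements below `1 / 2`. The image displacement is `m
* v.1`, so the formula holds only near `0`. -/
theorem localRep_solenoidMap (m : ℕ) (lam η : ℝ) (x : Space) :
    localRep (solenoidMap m lam lam η) x =ᶠ[𝓝 0] solRep m lam η x.1 := by
  filter_upwards [eventually_abs_fst_mul_lt m (r := 1 / 2) (by norm_num)] with v hv
  rw [localRep, solenoidMap_eq, solenoidMap_eq, solRep]
  rw [← chart_coe hv]
  congr 1
  refine Prod.ext ?_ ?_
  · simp [cover, ← nsmul_eq_mul]
  · simp only [cover, Prod.snd_sub, Prod.snd_add, Prod.fst_add, smul_add, smul_sub]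
    abel

/-- The differential of the solenoid map. -/
def solDiff (m : ℕ) (lam η : ℝ) (a : UnitAddCircle) : Tan →L[ℝ] Tan :=
  ((m : ℝ) • ContinuousLinearMap.fst ℝ ℝ Plane).prod
    (lam • ContinuousLinearMap.snd ℝ ℝ Plane +
      (ContinuousLinearMap.fst ℝ ℝ Plane).smulRight (η • dcirc a))

theorem solDiff_apply (m : ℕ) (lam η : ℝ) (a : UnitAddCircle) (v : Tan) :
    solDiff m lam η a v = (m * v.1, lam • v.2 + v.1 • η • dcirc a) := by
  simp [solDiff]

theorem contDiff_solRep (m : ℕ) (lam η : ℝ) (a : UnitAddCircle) :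
    ContDiff ℝ ∞ (solRep m lam η a) := by
  have h := (contDiff_circ_add a).comp (contDiff_fst (𝕜 := ℝ) (E := ℝ) (F := Plane))
  have h' : ContDiff ℝ ∞ fun v : Tan => circ (a + (v.1 : UnitAddCircle)) := h
  unfold solRep
  fun_prop

theorem hasFDerivAt_solRep (m : ℕ) (lam η : ℝ) (a : UnitAddCircle) :
    HasFDerivAt (solRep m lam η a) (solDiff m lam η a) 0 := by
  have h1 : HasFDerivAt (fun v : Tan => (m : ℝ) * v.1)
      ((m : ℝ) • ContinuousLinearMap.fst ℝ ℝ Plane) 0 :=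
    ((m : ℝ) • ContinuousLinearMap.fst ℝ ℝ Plane).hasFDerivAt
  have h2 : HasFDerivAt (fun v : Tan => lam • v.2) (lam • ContinuousLinearMap.snd ℝ ℝ Plane) 0 :=
    (lam • ContinuousLinearMap.snd ℝ ℝ Plane).hasFDerivAt
  have h3 : HasFDerivAt (fun v : Tan => circ (a + (v.1 : UnitAddCircle)))
      ((ContinuousLinearMap.fst ℝ ℝ Plane).smulRight (dcirc a)) 0 := by
    have h4 := (hasDerivAt_circ_add a 0).hasFDerivAt
    have h5 := HasFDerivAt.comp (0 : Tan) (g := fun s : ℝ => circ (a + (s : UnitAddCircle)))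
      (f := fun v : Tan => v.1) h4 (ContinuousLinearMap.fst ℝ ℝ Plane).hasFDerivAt
    have e : (ContinuousLinearMap.fst ℝ ℝ Plane).smulRight (dcirc a) =
        (ContinuousLinearMap.toSpanSingleton ℝ (dcirc (a + ((0 : ℝ) : UnitAddCircle)))).comp
          (ContinuousLinearMap.fst ℝ ℝ Plane) := by
      refine ContinuousLinearMap.ext fun v => ?_
      simp
    rw [e]
    exact h5
  have h6 := h1.prodMk (h2.add ((h3.sub_const (circ a)).const_smul η))
  have e : solDiff m lam η a = ((m : ℝ) • ContinuousLinearMap.fst ℝ ℝ Plane).prod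
      (lam • ContinuousLinearMap.snd ℝ ℝ Plane +
        η • (ContinuousLinearMap.fst ℝ ℝ Plane).smulRight (dcirc a)) := by
    refine ContinuousLinearMap.ext fun v => ?_
    simp [solDiff, smul_comm η]
  rw [e]
  exact h6

theorem differential_solenoidMap (m : ℕ) (lam η : ℝ) (x : Space) :
    differential (solenoidMap m lam lam η) x = solDiff m lam η x.1 := by
  rw [differential, (localRep_solenoidMap m lam η x).fderiv_eq]
  exact (hasFDerivAt_solRep m lam η x.1).fderiv

theorem differential_solenoidMap_apply (m : ℕ) (lam η : ℝ) (x : Space) (v : Tan) :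
    differential (solenoidMap m lam lam η) x v =
      (m * v.1, lam • v.2 + v.1 • η • dcirc x.1) := by
  rw [differential_solenoidMap, solDiff_apply]

theorem continuous_solenoidMap (m : ℕ) (lam η : ℝ) : Continuous (solenoidMap m lam lam η) := by
  have : solenoidMap m lam lam η = fun x => (m • x.1, lam • x.2 + η • circ x.1) :=
    funext (solenoidMap_eq m lam η)
  rw [this]
  have := continuous_circ
  fun_prop

theorem norm_differential_sub_le (m : ℕ) (lam : ℝ) {η : ℝ} (hη : 0 ≤ η) (x y : Space) :
    ‖differential (solenoidMap m lam lam η) x - differential (solenoidMap m lam lam η) y‖ ≤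
      η * (2 * Real.pi) ^ 2 * dist x y := by
  refine ContinuousLinearMap.opNorm_le_bound _ (by positivity) fun v => ?_
  rw [sub_apply, differential_solenoidMap_apply, differential_solenoidMap_apply, Prod.mk_sub_mk,
    sub_self, add_sub_add_left_eq_sub, ← smul_sub, ← smul_sub, Prod.norm_mk, norm_zero,
    max_eq_right (norm_nonneg _), norm_smul, norm_smul, Real.norm_of_nonneg hη]
  calc ‖v.1‖ * (η * ‖dcirc x.1 - dcirc y.1‖) ≤ ‖v‖ * (η * ((2 * Real.pi) ^ 2 * dist x y)) := by
        gcongr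
        · exact norm_fst_le v
        · refine (norm_dcirc_sub_le _ _).trans ?_
          rw [← dist_eq_norm]
          gcongr
          rw [Prod.dist_eq]
          exact le_max_left _ _
    _ = _ := by ring

theorem bijective_differential {m : ℕ} {lam η : ℝ} (H : IsAdmissible m lam η) (x : Space) :
    Function.Bijective (differential (solenoidMap m lam lam η) x) := by
  have hm : (m : ℝ) ≠ 0 := Nat.cast_ne_zero.2 H.m_pos.ne'
  have hl := H.lam_pos.ne'
  refine (Function.bijective_iff_has_inverse).2
    ⟨fun w => ((m : ℝ)⁻¹ * w.1, lam⁻¹ • (w.2 - ((m : ℝ)⁻¹ * w.1) • η • dcirc x.1)), ?_, ?_⟩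
  · intro v
    rw [differential_solenoidMap_apply]
    refine Prod.ext ?_ ?_
    · simp [hm]
    · simp [hm, hl]
  · intro v
    rw [differential_solenoidMap_apply]
    refine Prod.ext ?_ ?_
    · simp [hm]
    · simp [hl]

/-! ### The solid torus and trapping -/

theorem isCompact_solidTorus : IsCompact solidTorus := by
  have : solidTorus = (univ : Set UnitAddCircle) ×ˢ Metric.closedBall (0 : Plane) 1 := by
    ext x; simp [solidTorus]
  rw [this]
  exact isCompact_univ.prod (isCompact_closedBall _ _)

theorem isOpen_openSolidTorus : IsOpen openSolidTorus :=
  isOpen_lt (by fun_prop) continuous_const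

theorem openSolidTorus_subset : openSolidTorus ⊆ solidTorus := fun x hx =>
  le_of_lt (show ‖x.2‖ < 1 from hx)

theorem closure_openSolidTorus : closure openSolidTorus = solidTorus := by
  have h1 : openSolidTorus = (univ : Set UnitAddCircle) ×ˢ Metric.ball (0 : Plane) 1 := by
    ext x; simp [openSolidTorus]
  have h2 : solidTorus = (univ : Set UnitAddCircle) ×ˢ Metric.closedBall (0 : Plane) 1 := by
    ext x; simp [solidTorus]
  rw [h1, h2, closure_prod_eq, closure_univ, closure_ball _ one_ne_zero]

theorem norm_solenoidMap_snd_le {m : ℕ} {lam η : ℝ} (H : IsAdmissible m lam η) {x : Space}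
    (hx : x ∈ solidTorus) : ‖(solenoidMap m lam lam η x).2‖ ≤ lam + η := by
  rw [solenoidMap_eq]
  refine (norm_add_le _ _).trans ?_
  rw [norm_smul, norm_smul, norm_circ, Real.norm_of_nonneg H.lam_pos.le,
    Real.norm_of_nonneg H.η_pos.le, mul_one]
  have : lam * ‖x.2‖ ≤ lam * 1 := mul_le_mul_of_nonneg_left hx H.lam_pos.le
  linarith

theorem mapsTo_solidTorus_openSolidTorus {m : ℕ} {lam η : ℝ} (H : IsAdmissible m lam η) :
    MapsTo (solenoidMap m lam lam η) solidTorus openSolidTorus := fun _ hx =>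
  (norm_solenoidMap_snd_le H hx).trans_lt H.add_lt

theorem mapsTo_solidTorus {m : ℕ} {lam η : ℝ} (H : IsAdmissible m lam η) :
    MapsTo (solenoidMap m lam lam η) solidTorus solidTorus := fun _ hx =>
  openSolidTorus_subset (mapsTo_solidTorus_openSolidTorus H hx)

/-- A continuous map commutes with closure on sets whose closure is compact. -/
theorem closure_iterate_image (m : ℕ) (lam η : ℝ) (n : ℕ) :
    closure ((solenoidMap m lam lam η)^[n] '' openSolidTorus) =
      (solenoidMap m lam lam η)^[n] '' solidTorus := by
  rw [← closure_openSolidTorus, image_closure_of_isCompact]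
  · rw [closure_openSolidTorus]; exact isCompact_solidTorus
  · exact ((continuous_solenoidMap m lam η).iterate n).continuousOn

theorem attractor_solenoidMap (m : ℕ) (lam η : ℝ) :
    attractor (solenoidMap m lam lam η) openSolidTorus =
      ⋂ n : ℕ, (solenoidMap m lam lam η)^[n] '' solidTorus := by
  simp_rw [attractor, closure_iterate_image]

end

section

/-! ### The abstract solenoid as a compact group -/

/-- The inverse limit of the circle under multiplication by `m`. -/
def invLimit (m : ℕ) : AddSubgroup (ℕ → UnitAddCircle) where
  carrier := {t | ∀ n, m • t (n + 1) = t n}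
  add_mem' := fun ha hb n => by simp [← ha n, ← hb n]
  zero_mem' := fun n => by simp
  neg_mem' := fun ha n => by simp [← ha n]

/-- The inverse limit of the circle under multiplication by `m`, as a type. -/
abbrev Sol (m : ℕ) : Type := invLimit m

section InverseLimit

variable {m : ℕ}

theorem Sol.nsmul_succ (t : Sol m) (n : ℕ) : m • t.1 (n + 1) = t.1 n := t.2 n

theorem Sol.pow_nsmul_add (t : Sol m) (n k : ℕ) : m ^ k • t.1 (n + k) = t.1 n := by
  induction k with
  | zero => simp
  | succ k ih => rw [pow_succ, mul_nsmul', ← add_assoc, t.nsmul_succ, ih]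

theorem isClosed_invLimit (m : ℕ) : IsClosed (invLimit m : Set (ℕ → UnitAddCircle)) := by
  have : (invLimit m : Set (ℕ → UnitAddCircle)) = ⋂ n, {t | m • t (n + 1) = t n} := by
    ext t; simp [invLimit]
  rw [this]
  exact isClosed_iInter fun n => isClosed_eq (by fun_prop) (by fun_prop)

instance : CompactSpace (Sol m) :=
  isCompact_iff_compactSpace.1 (isClosed_invLimit m).isCompact

instance : PolishSpace (Sol m) := (isClosed_invLimit m).polishSpace

/-- The normalised Haar measure of the solenoid. -/
def haar (m : ℕ) : Measure (Sol m) := Measure.addHaarMeasure ⊤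

instance : (haar m).IsAddHaarMeasure := by unfold haar; infer_instance

instance : IsProbabilityMeasure (haar m) := ⟨by
  have := Measure.addHaarMeasure_self (K₀ := (⊤ : TopologicalSpace.PositiveCompacts (Sol m)))
  simpa [haar] using this⟩

/-- The shift, the inverse of multiplication by `m` on the solenoid. -/
def shift (t : Sol m) : Sol m := ⟨fun n => t.1 (n + 1), fun n => t.2 (n + 1)⟩

theorem shift_val (t : Sol m) (n : ℕ) : (shift t).1 n = t.1 (n + 1) := rfl

theorem nsmul_shift (t : Sol m) : m • shift t = t :=
  Subtype.ext (funext fun n => t.2 n)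

theorem shift_iterate_val (t : Sol m) (n k : ℕ) : (shift^[k] t).1 n = t.1 (n + k) := by
  induction k generalizing t with
  | zero => rfl
  | succ k ih => rw [Function.iterate_succ_apply, ih, shift_val]; rfl

theorem pow_nsmul_shift_iterate (t : Sol m) (k : ℕ) : m ^ k • shift^[k] t = t :=
  Subtype.ext (funext fun n => by
    change m ^ k • (shift^[k] t).1 n = t.1 n
    rw [shift_iterate_val, t.pow_nsmul_add])

theorem Sol.nsmul_val_succ (t : Sol m) (n : ℕ) : (m • t).1 (n + 1) = t.1 n := t.2 n

/-- A continuous surjective endomorphism of a compact group preserves normalised Haar measure;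
`shift` provides the preimages. -/
theorem measurePreserving_nsmul_haar : MeasurePreserving (fun t : Sol m => m • t)
    (haar m) (haar m) :=
  AddMonoidHom.measurePreserving (f := (nsmulAddMonoidHom m : Sol m →+ Sol m)) (continuous_nsmul m)
    (fun t => ⟨shift t, nsmul_shift t⟩) rfl

/-- Two points of the solenoid which agree in the coordinate `N` agree in the lower ones. -/
theorem Sol.eq_of_le {t u : Sol m} {N n : ℕ} (h : t.1 N = u.1 N) (hn : n ≤ N) :
    t.1 n = u.1 n := by
  obtain ⟨k, rfl⟩ := Nat.exists_eq_add_of_le hn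
  rw [← t.pow_nsmul_add n k, h, u.pow_nsmul_add]

/-- An open set of the solenoid contains a cylinder around each of its points. -/
theorem exists_cylinder_subset {V : Set (Sol m)} (hV : IsOpen V) {t : Sol m} (ht : t ∈ V) :
    ∃ N, ∀ u : Sol m, u.1 N = t.1 N → u ∈ V := by
  obtain ⟨W, hW, rfl⟩ := isOpen_induced_iff.1 hV
  obtain ⟨I, b, hb, hsub⟩ := isOpen_pi_iff.1 hW _ ht
  refine ⟨I.sup id, fun u hu => hsub fun i hi => ?_⟩
  have : u.1 i = t.1 i := Sol.eq_of_le hu (Finset.le_sup (f := id) hi)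
  rw [this]
  exact (hb i hi).2

/-- The one-parameter subgroup of the solenoid. -/
def flow (m : ℕ) [NeZero m] (s : ℝ) : Sol m :=
  ⟨fun n => ((s / m ^ n : ℝ) : UnitAddCircle), fun n => by
    have : (m : ℝ) ≠ 0 := NeZero.ne _
    rw [← AddCircle.coe_nsmul, nsmul_eq_mul]
    congr 1
    rw [pow_succ]
    field_simp⟩

variable [NeZero m]

theorem flow_val (s : ℝ) (n : ℕ) : (flow m s).1 n = ((s / m ^ n : ℝ) : UnitAddCircle) := rfl

theorem flow_add (s s' : ℝ) : flow m (s + s') = flow m s + flow m s' :=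
  Subtype.ext (funext fun n => by
    change (((s + s') / m ^ n : ℝ) : UnitAddCircle) = (s / m ^ n : ℝ) + (s' / m ^ n : ℝ)
    rw [add_div, AddCircle.coe_add])

theorem flow_zero : flow m 0 = 0 :=
  Subtype.ext (funext fun n => by rw [flow_val, zero_div, AddCircle.coe_zero]; rfl)

theorem flow_neg (s : ℝ) : flow m (-s) = -flow m s := by
  rw [eq_neg_iff_add_eq_zero, ← flow_add, neg_add_cancel, flow_zero]

theorem nsmul_flow (k : ℕ) (s : ℝ) : k • flow m s = flow m (k * s) :=
  Subtype.ext (funext fun n => by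
    change k • ((s / m ^ n : ℝ) : UnitAddCircle) = ((k * s / m ^ n : ℝ) : UnitAddCircle)
    rw [← AddCircle.coe_nsmul, nsmul_eq_mul, mul_div_assoc])

theorem continuous_flow : Continuous (flow m) := by
  refine Continuous.subtype_mk (continuous_pi fun n => ?_) _
  exact (AddCircle.continuous_mk' (1 : ℝ)).comp (continuous_id.div_const _)

theorem Sol.val_zero_surjective : Function.Surjective fun t : Sol m => t.1 0 := by
  intro a
  obtain ⟨s, hs, -⟩ := exists_coe_eq_abs_eq_norm a
  exact ⟨flow m s, by simpa [flow_val] using hs⟩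

theorem measurePreserving_val_zero : MeasurePreserving (fun t : Sol m => t.1 0)
    (haar m) (volume : Measure UnitAddCircle) :=
  AddMonoidHom.measurePreserving
    (f := (Pi.evalAddMonoidHom (fun _ : ℕ => UnitAddCircle) 0).comp (invLimit m).subtype)
    ((continuous_apply 0).comp continuous_subtype_val) Sol.val_zero_surjective (by simp)

/-- Points of the solenoid all of whose coordinates are small lie on a short arc through `0`. -/
theorem exists_eq_flow_of_forall_norm_lt {d : Sol m}
    (h : ∀ n, ‖d.1 n‖ < 1 / (m + 1)) : ∃ s, |s| = ‖d.1 0‖ ∧ d = flow m s := by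
  choose δ hδ hδ' using fun n => exists_coe_eq_abs_eq_norm (d.1 n)
  have hm : (0 : ℝ) < m := Nat.cast_pos.2 (Nat.pos_of_ne_zero (NeZero.ne m))
  -- The difference of the two sides is an integer of absolute value below `(m + 1) * (1 / (m + 1))
  -- = 1`, hence zero.
  have hrec : ∀ n, m * δ (n + 1) = δ n := by
    intro n
    have h1 : ((m * δ (n + 1) - δ n : ℝ) : UnitAddCircle) = 0 := by
      rw [AddCircle.coe_sub, hδ, ← nsmul_eq_mul, AddCircle.coe_nsmul, hδ, d.nsmul_succ, sub_self]
    obtain ⟨k, hk⟩ := (AddCircle.coe_eq_zero_iff (1 : ℝ)).1 h1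
    have h2 : |m * δ (n + 1) - δ n| < 1 := by
      calc |m * δ (n + 1) - δ n| ≤ |m * δ (n + 1)| + |δ n| := abs_sub _ _
        _ = m * ‖d.1 (n + 1)‖ + ‖d.1 n‖ := by rw [abs_mul, Nat.abs_cast, hδ', hδ']
        _ < m * (1 / (m + 1)) + 1 / (m + 1) := by gcongr <;> exact h _
        _ = 1 := by field_simp
    rw [← hk, zsmul_one, ← Int.cast_abs] at h2
    have h3 : |k| < 1 := by exact_mod_cast h2
    rw [Int.abs_lt_one_iff] at h3
    rw [h3, zero_smul] at hk
    linarith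
  refine ⟨δ 0, hδ' 0, Subtype.ext (funext fun n => ?_)⟩
  rw [flow_val, ← hδ]
  congr 1
  induction n with
  | zero => simp
  | succ n ih =>
    rw [pow_succ, ← div_div, ← ih, ← hrec n]
    field_simp

/-- After enough shifts all coordinates are small and the previous lemma applies; multiplying back
by `m ^ N` only rescales the flow time. -/
theorem exists_eq_flow_of_tendsto {d : Sol m}
    (h : Tendsto (fun n => ‖d.1 n‖) atTop (𝓝 0)) : ∃ s, d = flow m s := by
  obtain ⟨N, hN⟩ := eventually_atTop.1 (h.eventually (gt_mem_nhds (show (0 : ℝ) < 1 / (m + 1) by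
    positivity)))
  obtain ⟨s, -, hs⟩ := exists_eq_flow_of_forall_norm_lt (d := shift^[N] d) fun n => by
    rw [shift_iterate_val]; exact hN _ (by omega)
  refine ⟨(m ^ N : ℕ) * s, ?_⟩
  rw [← nsmul_flow, ← hs, pow_nsmul_shift_iterate]

/-- Multiplication by `m` on the solenoid is topologically transitive. -/
theorem exists_iterate_mem (hm : 2 ≤ m) {V W : Set (Sol m)} (hV : IsOpen V) (hW : IsOpen W)
    {t u : Sol m} (ht : t ∈ V) (hu : u ∈ W) : ∃ n : ℕ, ∃ v ∈ V, m ^ n • v ∈ W := by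
  obtain ⟨N, hN⟩ := exists_cylinder_subset hW hu
  have hc : Continuous fun s => t + flow m s := continuous_const.add continuous_flow
  have h0 : ∀ᶠ s in 𝓝 (0 : ℝ), t + flow m s ∈ V := hc.continuousAt.eventually_mem
    (hV.mem_nhds (by simpa [flow_zero] using ht))
  obtain ⟨ε, hε, hball⟩ := Metric.eventually_nhds_iff.1 h0
  have hm0 : (m : ℝ) ≠ 0 := NeZero.ne _
  have hm1 : (1 : ℝ) < m := by exact_mod_cast (by omega : 1 < m)
  obtain ⟨n, hn⟩ := pow_unbounded_of_one_lt ((m : ℝ) ^ N / ε) hm1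
  obtain ⟨s, hs, hs'⟩ := exists_coe_eq_abs_eq_norm (u.1 N - (m ^ n • t).1 N)
  have hs1 : |s| ≤ 1 := by
    have := AddCircle.norm_le_half_period (1 : ℝ) (x := u.1 N - (m ^ n • t).1 N) one_ne_zero
    rw [← hs', abs_one] at this
    linarith
  -- This time is tiny for large `n`, yet multiplication by `m ^ n` turns it into a displacement of
  -- exactly `s` in coordinate `N`.
  refine ⟨n, t + flow m (s * m ^ N / m ^ n), hball ?_, hN _ ?_⟩
  · rw [dist_zero_right, Real.norm_eq_abs, abs_div, abs_mul, abs_pow, abs_pow, Nat.abs_cast,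
      div_lt_iff₀ (by positivity)]
    rw [div_lt_iff₀ hε] at hn
    calc |s| * (m : ℝ) ^ N ≤ 1 * m ^ N := by gcongr
      _ < ε * m ^ n := by linarith
  · rw [nsmul_add, nsmul_flow]
    change (m ^ n • t).1 N + (flow m _).1 N = _
    have e : ((m ^ n : ℕ) : ℝ) * (s * m ^ N / m ^ n) / m ^ N = s := by
      push_cast
      field_simp
    rw [flow_val, e, hs]
    abel

end InverseLimit

/-! ### The embedding of the solenoid -/

section Embedding

variable {m : ℕ} {lam η : ℝ}

/-- The embedding of the abstract solenoid into `S¹ × ℝ²` as the attractor. -/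
def embed (m : ℕ) (lam η : ℝ) (t : Sol m) : Space :=
  (t.1 0, ∑' n : ℕ, (lam ^ n * η) • circ (t.1 (n + 1)))

theorem summable_pow_mul (H : IsAdmissible m lam η) (c : ℝ) :
    Summable fun n : ℕ => lam ^ n * c :=
  (summable_geometric_of_lt_one H.lam_pos.le H.lam_lt_one).mul_right c

theorem norm_embed_term (H : IsAdmissible m lam η) (n : ℕ) (a : UnitAddCircle) :
    ‖(lam ^ n * η) • circ a‖ = lam ^ n * η := by
  have := H.lam_pos
  have := H.η_pos
  rw [norm_smul, norm_circ, mul_one, Real.norm_of_nonneg (by positivity)]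

theorem summable_embed (H : IsAdmissible m lam η) (f : ℕ → UnitAddCircle) :
    Summable fun n : ℕ => (lam ^ n * η) • circ (f n) :=
  Summable.of_norm (by simpa only [norm_embed_term H] using summable_pow_mul H η)

theorem continuous_embed (H : IsAdmissible m lam η) : Continuous (embed m lam η) := by
  refine Continuous.prodMk ((continuous_apply 0).comp continuous_subtype_val) ?_
  refine continuous_tsum (fun n => ?_) (summable_pow_mul H η) fun n t =>
    (norm_embed_term H n _).le
  have h : Continuous fun t : Sol m => circ (t.1 (n + 1)) :=
    continuous_circ.comp ((continuous_apply _).comp continuous_subtype_val)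
  exact h.const_smul (lam ^ n * η)

theorem embed_mem (H : IsAdmissible m lam η) (t : Sol m) : embed m lam η t ∈ openSolidTorus := by
  have h1 : ‖(embed m lam η t).2‖ ≤ ∑' n : ℕ, lam ^ n * η := by
    refine (norm_tsum_le_tsum_norm ?_).trans_eq ?_
    · simpa only [norm_embed_term H] using summable_pow_mul H η
    · simp only [norm_embed_term H]
  rw [tsum_mul_right, tsum_geometric_of_lt_one H.lam_pos.le H.lam_lt_one] at h1
  refine h1.trans_lt ?_
  rw [inv_mul_eq_div, div_lt_one] <;> linarith [H.add_lt, H.lam_lt_one]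

/-- Multiplication by `m` puts a new coordinate in front of the sequence `n ↦ t.1 (n + 1)`: the head
of the new series is `η • circ (t.1 0)` and its tail is `lam` times the old series. -/
theorem solenoidMap_embed (H : IsAdmissible m lam η) (t : Sol m) :
    solenoidMap m lam lam η (embed m lam η t) = embed m lam η (m • t) := by
  rw [solenoidMap_eq]
  refine Prod.ext rfl ?_
  simp only [embed, Sol.nsmul_val_succ]
  rw [(summable_embed H fun n => t.1 n).tsum_eq_zero_add, add_comm]
  congr 1
  · simp
  · rw [← Summable.tsum_const_smul lam (summable_embed H fun n => t.1 (n + 1))]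
    refine tsum_congr fun n => ?_
    rw [smul_smul, pow_succ]
    congr 1
    ring

theorem iterate_solenoidMap_embed (H : IsAdmissible m lam η) (n : ℕ) (t : Sol m) :
    (solenoidMap m lam lam η)^[n] (embed m lam η t) = embed m lam η (m ^ n • t) := by
  induction n with
  | zero => simp
  | succ n ih => rw [Function.iterate_succ_apply', ih, solenoidMap_embed H, pow_succ, mul_nsmul]

theorem iterate_solenoidMap_fst (m : ℕ) (lam η : ℝ) (n : ℕ) (x : Space) :
    ((solenoidMap m lam lam η)^[n] x).1 = m ^ n • x.1 := by
  induction n with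
  | zero => simp
  | succ n ih =>
    rw [Function.iterate_succ_apply', solenoidMap_eq]
    simp only [ih]
    rw [pow_succ, mul_nsmul]

theorem injOn_iterate (H : IsAdmissible m lam η)
    (hinj : InjOn (solenoidMap m lam lam η) solidTorus) (n : ℕ) :
    InjOn (solenoidMap m lam lam η)^[n] solidTorus :=
  hinj.iterate (mapsTo_solidTorus H) n

/-- Coordinate `0` is visible in the circle factor. For the others, injectivity of `F` lets an
equality of images be pulled back to the shifted sequences. -/
theorem embed_injective (H : IsAdmissible m lam η)
    (hinj : InjOn (solenoidMap m lam lam η) solidTorus) : Function.Injective (embed m lam η) := by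
  have key : ∀ n : ℕ, ∀ t u : Sol m, embed m lam η t = embed m lam η u → t.1 n = u.1 n := by
    intro n
    induction n with
    | zero => exact fun t u h => congrArg Prod.fst h
    | succ n ih =>
      intro t u h
      refine ih (shift t) (shift u) (hinj (openSolidTorus_subset (embed_mem H _))
        (openSolidTorus_subset (embed_mem H _)) ?_)
      rw [solenoidMap_embed H, solenoidMap_embed H, nsmul_shift, nsmul_shift, h]
  exact fun t u h => Subtype.ext (funext fun n => key n t u h)

theorem isClosedEmbedding_embed (H : IsAdmissible m lam η)
    (hinj : InjOn (solenoidMap m lam lam η) solidTorus) : IsClosedEmbedding (embed m lam η) :=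
  (continuous_embed H).isClosedEmbedding (embed_injective H hinj)

theorem measurableEmbedding_embed (H : IsAdmissible m lam η)
    (hinj : InjOn (solenoidMap m lam lam η) solidTorus) : MeasurableEmbedding (embed m lam η) :=
  (isClosedEmbedding_embed H hinj).measurableEmbedding

/-- A backward orbit in the solid torus determines the contracted coordinates. -/
theorem eq_embed_of_backward (H : IsAdmissible m lam η) {X : ℕ → Space}
    (hX : ∀ n, X n ∈ solidTorus) (hF : ∀ n, solenoidMap m lam lam η (X (n + 1)) = X n) :
    ∃ t : Sol m, X 0 = embed m lam η t := by
  have h1 : ∀ n, m • (X (n + 1)).1 = (X n).1 := fun n => by rw [← hF n, solenoidMap_eq]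
  refine ⟨⟨fun n => (X n).1, h1⟩, Prod.ext rfl ?_⟩
  have h2 : ∀ n, (X 0).2 = ∑ i ∈ Finset.range n, (lam ^ i * η) • circ (X (i + 1)).1 +
      lam ^ n • (X n).2 := by
    intro n
    induction n with
    | zero => simp
    | succ n ih =>
      have h3 : (X n).2 = lam • (X (n + 1)).2 + η • circ (X (n + 1)).1 := by
        rw [← hF n, solenoidMap_eq]
      rw [ih, h3, Finset.sum_range_succ, smul_add, smul_smul, smul_smul, pow_succ]
      abel
  have h4 : Tendsto (fun n => ∑ i ∈ Finset.range n, (lam ^ i * η) • circ (X (i + 1)).1 +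
      lam ^ n • (X n).2) atTop
      (𝓝 ((∑' n : ℕ, (lam ^ n * η) • circ (X (n + 1)).1) + 0)) := by
    refine (summable_embed H fun n => (X (n + 1)).1).hasSum.tendsto_sum_nat.add ?_
    refine squeeze_zero_norm (fun n => ?_)
      (tendsto_pow_atTop_nhds_zero_of_lt_one H.lam_pos.le H.lam_lt_one)
    rw [norm_smul, Real.norm_of_nonneg (by have := H.lam_pos; positivity)]
    exact mul_le_of_le_one_right (by have := H.lam_pos; positivity) (hX n)
  simp_rw [← h2, add_zero] at h4
  exact tendsto_nhds_unique tendsto_const_nhds h4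

/-- For a point of the attractor choose `X n` in the torus with `F^n (X n) = x`. Injectivity of the
iterates forces `F (X (n + 1)) = X n`, and a bounded backward orbit is summed by the series. -/
theorem range_embed (H : IsAdmissible m lam η)
    (hinj : InjOn (solenoidMap m lam lam η) solidTorus) :
    range (embed m lam η) = attractor (solenoidMap m lam lam η) openSolidTorus := by
  rw [attractor_solenoidMap]
  ext x
  constructor
  · rintro ⟨t, rfl⟩
    refine mem_iInter.2 fun n => ⟨embed m lam η (shift^[n] t),
      openSolidTorus_subset (embed_mem H _), ?_⟩
    rw [iterate_solenoidMap_embed H, pow_nsmul_shift_iterate]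
  · intro hx
    choose X hX hX' using mem_iInter.1 hx
    obtain ⟨t, ht⟩ := eq_embed_of_backward H hX fun n => by
      refine injOn_iterate H hinj n (mapsTo_solidTorus H (hX _)) (hX n) ?_
      rw [← Function.iterate_succ_apply, hX', hX']
    exact ⟨t, ht.symm.trans (hX' 0)⟩

/-- The only backward orbits in the attractor are the obvious ones. -/
theorem isBackwardOrbit_iff (H : IsAdmissible m lam η)
    (hinj : InjOn (solenoidMap m lam lam η) solidTorus) (t : Sol m) (X : ℕ → Space) :
    IsBackwardOrbit (solenoidMap m lam lam η)
      (attractor (solenoidMap m lam lam η) openSolidTorus) (embed m lam η t) X ↔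
      ∀ n, X n = embed m lam η (shift^[n] t) := by
  rw [← range_embed H hinj]
  constructor
  · rintro ⟨h0, hX⟩ n
    induction n with
    | zero => exact h0
    | succ n ih =>
      obtain ⟨u, hu⟩ := (hX (n + 1)).1
      refine hinj ?_ (openSolidTorus_subset (embed_mem H _)) ?_
      · rw [← hu]; exact openSolidTorus_subset (embed_mem H _)
      · rw [(hX n).2, ih, solenoidMap_embed H, Function.iterate_succ_apply', nsmul_shift]
  · intro h
    refine ⟨h 0, fun n => ⟨h n ▸ mem_range_self _, ?_⟩⟩
    rw [h, h, solenoidMap_embed H, Function.iterate_succ_apply', nsmul_shift]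

end Embedding

end

section

variable {m : ℕ} {lam η : ℝ}

theorem IsAdmissible.neZero (H : IsAdmissible m lam η) : NeZero m := ⟨H.m_pos.ne'⟩

/-! ### The attractor as nonwandering set, transitivity -/

/-- The differential is Lipschitz, and on a bounded set Lipschitz implies Hölder of every exponent
at most one. -/
theorem holderOnWith_differential (m : ℕ) (lam : ℝ) {η : ℝ} (hη : 0 ≤ η) {θ : ℝ≥0} (hθ : θ ≤ 1) :
    ∃ C : ℝ≥0, HolderOnWith C θ (differential (solenoidMap m lam lam η)) openSolidTorus := by
  have hL : LipschitzWith (Real.toNNReal (η * (2 * Real.pi) ^ 2))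
      (differential (solenoidMap m lam lam η)) := by
    refine LipschitzWith.of_dist_le_mul fun x y => ?_
    rw [dist_eq_norm, Real.coe_toNNReal _ (by positivity)]
    exact norm_differential_sub_le m lam hη x y
  have hb := isCompact_solidTorus.isBounded.subset openSolidTorus_subset
  have h1 := (holderOnWith_one.2 (hL.lipschitzOnWith (s := openSolidTorus)))
  refine ⟨_, HolderOnWith.of_le (D := (Metric.ediam openSolidTorus).toNNReal)
    (fun x hx y hy => ?_) h1 hθ⟩
  rw [ENNReal.coe_toNNReal hb.ediam_ne_top]
  exact Metric.edist_le_ediam_of_mem hx hy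

/-- Poincaré recurrence: Haar measure is invariant and positive on nonempty open sets, so each
neighbourhood contains a returning point. -/
theorem attractor_subset_nonwandering (H : IsAdmissible m lam η)
    (hinj : InjOn (solenoidMap m lam lam η) solidTorus) :
    attractor (solenoidMap m lam lam η) openSolidTorus ⊆
      nonwandering (solenoidMap m lam lam η) openSolidTorus := by
  have := H.neZero
  rw [← range_embed H hinj]
  rintro _ ⟨t, rfl⟩
  refine ⟨embed_mem H t, fun W hW => ?_⟩
  have hW' : embed m lam η ⁻¹' interior W ∈ 𝓝 t :=
    (continuous_embed H).continuousAt.preimage_mem_nhds (interior_mem_nhds.2 hW)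
  obtain ⟨u, hu, n, hn, hun⟩ := (measurePreserving_nsmul_haar (m := m)).exists_mem_iterate_mem
    (isOpen_interior.preimage (continuous_embed H)).measurableSet.nullMeasurableSet
    (Measure.measure_pos_of_mem_nhds (haar m) hW').ne'
  have hit : ∀ k, (fun t : Sol m => m • t)^[k] u = m ^ k • u := by
    intro k
    induction k with
    | zero => simp
    | succ k ih => rw [Function.iterate_succ_apply', ih, pow_succ, mul_nsmul]
  rw [hit] at hun
  refine ⟨n, Nat.one_le_iff_ne_zero.2 hn, embed m lam η (m ^ n • u),
    ⟨embed m lam η u, ⟨interior_subset hu, embed_mem H u⟩, iterate_solenoidMap_embed H n u⟩,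
    interior_subset hun⟩

/-- If `x` is not in the compact set `F^N(T)`, a neighbourhood avoiding it can return only at times
`n < N`. Were all those iterates of `x` different from `x`, shrinking the neighbourhood would
exclude these returns too. So `x` is periodic, and then `x = F^(nN) x` lies in `F^N(T)` after all.
-/
theorem nonwandering_subset_attractor (H : IsAdmissible m lam η) :
    nonwandering (solenoidMap m lam lam η) openSolidTorus ⊆
      attractor (solenoidMap m lam lam η) openSolidTorus := by
  set F := solenoidMap m lam lam η
  have hF : Continuous F := continuous_solenoidMap m lam η
  have hmaps : MapsTo F solidTorus solidTorus := mapsTo_solidTorus H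
  have hanti : ∀ i j, i ≤ j → F^[j] '' solidTorus ⊆ F^[i] '' solidTorus := by
    intro i j hij
    obtain ⟨k, rfl⟩ := Nat.exists_eq_add_of_le hij
    rw [Function.iterate_add, image_comp]
    exact image_mono ((hmaps.iterate k).image_subset)
  rintro x ⟨hxU, hx⟩
  rw [attractor_solenoidMap]
  refine mem_iInter.2 fun N => ?_
  by_contra hxN
  have hclosed : IsClosed (F^[N] '' solidTorus) :=
    (isCompact_solidTorus.image (hF.iterate N)).isClosed
  have hper : ∃ n, 1 ≤ n ∧ n < N ∧ F^[n] x = x := by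
    by_contra! hcon
    have hW : ∀ n ∈ Finset.Ico 1 N, ∃ W ∈ 𝓝 x, ∀ y ∈ W, F^[n] y ∉ W := by
      intro n hn
      rw [Finset.mem_Ico] at hn
      obtain ⟨A, B, hA, hB, hAB⟩ := t2_separation_nhds (hcon n hn.1 hn.2)
      refine ⟨F^[n] ⁻¹' A ∩ B, inter_mem ((hF.iterate n).continuousAt.preimage_mem_nhds hA) hB,
        fun y hy hy' => disjoint_left.1 hAB hy.1 hy'.2⟩
    choose! W hWx hW using hW
    obtain ⟨n, hn1, _, ⟨y, ⟨hy, hyU⟩, rfl⟩, hyW⟩ := hx ((F^[N] '' solidTorus)ᶜ ∩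
      ⋂ n ∈ Finset.Ico 1 N, W n) (inter_mem (hclosed.isOpen_compl.mem_nhds hxN)
        ((Filter.biInter_finset_mem _).2 hWx))
    by_cases hnN : n < N
    · have hmem : n ∈ Finset.Ico 1 N := Finset.mem_Ico.2 ⟨hn1, hnN⟩
      exact hW n hmem y (mem_iInter₂.1 hy.2 n hmem) (mem_iInter₂.1 hyW.2 n hmem)
    · exact hyW.1 (hanti N n (not_lt.1 hnN) ⟨y, openSolidTorus_subset hyU, rfl⟩)
  obtain ⟨n, hn, -, hnx⟩ := hper
  have h1 : F^[n * N] x = x := by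
    rw [Function.iterate_mul]
    exact Function.iterate_fixed hnx N
  exact hxN (hanti N (n * N) (Nat.le_mul_of_pos_left N hn)
    ⟨x, openSolidTorus_subset hxU, h1⟩)

theorem isAttractorMap_solenoidMap (H : IsAdmissible m lam η)
    (hinj : InjOn (solenoidMap m lam lam η) solidTorus) {θ : ℝ≥0} (hθ : θ ≤ 1) :
    IsAttractorMap θ openSolidTorus (solenoidMap m lam lam η) where
  isOpen := isOpen_openSolidTorus
  contDiff x _ := ((contDiff_solRep m lam η x.1).contDiffAt.congr_of_eventuallyEq
    (localRep_solenoidMap m lam η x)).of_le (by exact_mod_cast le_top)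
  holder := holderOnWith_differential m lam H.η_pos.le hθ
  injOn := hinj.mono openSolidTorus_subset
  immersion x _ := bijective_differential H x
  trapping := by
    have := closure_iterate_image m lam η 1
    rw [Function.iterate_one] at this
    rw [this]
    exact (mapsTo_solidTorus_openSolidTorus H).image_subset
  nonwandering_eq := (nonwandering_subset_attractor H).antisymm
    (attractor_subset_nonwandering H hinj)

theorem hypA1_solenoidMap (H : IsAdmissible m lam η)
    (hinj : InjOn (solenoidMap m lam lam η) solidTorus) :
    HypA1 (solenoidMap m lam lam η) (attractor (solenoidMap m lam lam η) openSolidTorus) := by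
  have := H.neZero
  rw [← range_embed H hinj]
  rintro V W hV hW ⟨_, hxV, t, rfl⟩ ⟨_, hyW, u, rfl⟩
  have hc := continuous_embed H
  obtain ⟨n, v, hv, hvW⟩ := exists_iterate_mem H.two_le (hV.preimage hc) (hW.preimage hc) hxV hyW
  exact ⟨n, _, ⟨_, ⟨hv, mem_range_self v⟩, rfl⟩,
    by rw [iterate_solenoidMap_embed H]; exact ⟨hvW, mem_range_self _⟩⟩

/-! ### The hyperbolic splitting -/

/-- The slope of the unstable direction. -/
def slope (m : ℕ) (lam η : ℝ) (t : Sol m) : Plane :=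
  ∑' n : ℕ, ((lam / m) ^ n * (η / m)) • dcirc (t.1 (n + 1))

theorem IsAdmissible.ratio_nonneg (H : IsAdmissible m lam η) : 0 ≤ lam / m :=
  div_nonneg H.lam_pos.le (Nat.cast_nonneg m)

theorem IsAdmissible.ratio_lt_one (H : IsAdmissible m lam η) : lam / m < 1 := by
  have := H.two_le_real
  rw [div_lt_one (by linarith)]
  linarith [H.lam_lt_one]

theorem norm_slope_term (H : IsAdmissible m lam η) (n : ℕ) (a : UnitAddCircle) :
    ‖((lam / m) ^ n * (η / m)) • dcirc a‖ = (lam / m) ^ n * (η / m * (2 * Real.pi)) := by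
  have := H.ratio_nonneg
  have := H.η_pos
  rw [norm_smul, norm_dcirc, Real.norm_of_nonneg (by positivity), mul_assoc]

theorem summable_slope_norm (H : IsAdmissible m lam η) :
    Summable fun n : ℕ => (lam / m) ^ n * (η / m * (2 * Real.pi)) :=
  (summable_geometric_of_lt_one H.ratio_nonneg H.ratio_lt_one).mul_right _

theorem summable_slope (H : IsAdmissible m lam η) (f : ℕ → UnitAddCircle) :
    Summable fun n : ℕ => ((lam / m) ^ n * (η / m)) • dcirc (f n) :=
  Summable.of_norm (by simpa only [norm_slope_term H] using summable_slope_norm H)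

theorem continuous_slope (H : IsAdmissible m lam η) : Continuous (slope m lam η) := by
  refine continuous_tsum (fun n => ?_) (summable_slope_norm H) fun n t =>
    (norm_slope_term H n _).le
  have h : Continuous fun t : Sol m => dcirc (t.1 (n + 1)) :=
    continuous_dcirc.comp ((continuous_apply _).comp continuous_subtype_val)
  exact h.const_smul ((lam / m) ^ n * (η / m))

/-- The invariance equation of the unstable line field: it says that `DF` maps `(1, slope t)` to `m
(1, slope (m • t))`. -/
theorem smul_slope_nsmul (H : IsAdmissible m lam η) (t : Sol m) :
    (m : ℝ) • slope m lam η (m • t) = lam • slope m lam η t + η • dcirc (t.1 0) := by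
  have hm : (m : ℝ) ≠ 0 := Nat.cast_ne_zero.2 H.m_pos.ne'
  simp only [slope, Sol.nsmul_val_succ]
  rw [(summable_slope H fun n => t.1 n).tsum_eq_zero_add, add_comm, smul_add]
  congr 1
  · rw [← Summable.tsum_const_smul _ (summable_slope H fun n => t.1 (n + 1)),
      ← Summable.tsum_const_smul _ ((summable_nat_add_iff 1).2 (summable_slope H fun n => t.1 n))]
    refine tsum_congr fun n => ?_
    rw [smul_smul, smul_smul, pow_succ]
    congr 1
    field_simp
  · rw [smul_smul]
    congr 1
    field_simp

theorem norm_slope_le (H : IsAdmissible m lam η) (t : Sol m) :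
    ‖slope m lam η t‖ ≤ 2 * Real.pi * η / (m - lam) := by
  have hm := H.two_le_real
  have hl := H.lam_lt_one
  refine (norm_tsum_le_tsum_norm ?_).trans_eq ?_
  · simpa only [norm_slope_term H] using summable_slope_norm H
  · simp only [norm_slope_term H]
    rw [tsum_mul_right, tsum_geometric_of_lt_one H.ratio_nonneg H.ratio_lt_one]
    have h1 : (m : ℝ) - lam ≠ 0 := by linarith
    have h2 : (m : ℝ) ≠ 0 := by linarith
    rw [one_sub_div h2]
    field_simp

/-- With `r`, `r'` the two norms, invariance gives `2πη ≤ λr + mr'`, while `(m - λ)r ≤ 2πη`. Hence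
`(m - 2λ)r ≤ mr'`, and `m - 2λ ≥ 1`. This is what makes the flat metric expand in a single step,
without an adapted norm. -/
theorem norm_slope_le_nsmul (H : IsAdmissible m lam η) (t : Sol m) :
    ‖slope m lam η t‖ ≤ m * ‖slope m lam η (m • t)‖ := by
  have hm := H.two_le_real
  have hl := H.lam_lt_one
  have h1 : 2 * Real.pi * η ≤ lam * ‖slope m lam η t‖ + m * ‖slope m lam η (m • t)‖ := by
    have h2 : η • dcirc (t.1 0) =
        (m : ℝ) • slope m lam η (m • t) - lam • slope m lam η t := by
      rw [smul_slope_nsmul H]; abel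
    have h3 := norm_sub_le ((m : ℝ) • slope m lam η (m • t)) (lam • slope m lam η t)
    rw [← h2, norm_smul, norm_smul, norm_smul, norm_dcirc, Real.norm_of_nonneg H.η_pos.le,
      Real.norm_of_nonneg H.lam_pos.le, Real.norm_of_nonneg (by linarith)] at h3
    linarith
  have h4 := norm_slope_le H t
  rw [le_div_iff₀ (by linarith)] at h4
  have h5 : lam ≤ 1 / 2 := by nlinarith [H.mul_lt, H.lam_pos]
  nlinarith [norm_nonneg (slope m lam η t)]

/-- A continuous extension of the unstable slope to the ambient manifold. -/
theorem exists_slope_extension (H : IsAdmissible m lam η)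
    (hinj : InjOn (solenoidMap m lam lam η) solidTorus) :
    ∃ W : Space → Plane, Continuous W ∧ ∀ t, W (embed m lam η t) = slope m lam η t := by
  -- Tietze's theorem on the closed image of the solenoid, applied to `Fin 2 → ℝ` in place of the
  -- Euclidean plane.
  obtain ⟨g, hg⟩ := ContinuousMap.exists_extension (isClosedEmbedding_embed H hinj)
    ⟨fun t => WithLp.ofLp (slope m lam η t), (PiLp.continuous_ofLp 2 _).comp (continuous_slope H)⟩
  refine ⟨fun x => WithLp.toLp 2 (g x), (PiLp.continuous_toLp 2 _).comp g.continuous, fun t => ?_⟩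
  have := congrArg (fun h => h t) hg
  simp only [ContinuousMap.comp_apply, ContinuousMap.coe_mk] at this
  exact (congrArg (WithLp.toLp 2) this).trans rfl

/-- The line field spanned by `(1, W)`. -/
def unstableLine (W : Space → Plane) (x : Space) : Submodule ℝ Tan := ℝ ∙ ((1 : ℝ), W x)

/-- The stable plane field. -/
def stablePlane (_ : Space) : Submodule ℝ Tan := LinearMap.range (LinearMap.inr ℝ ℝ Plane)

theorem mem_unstableLine {W : Space → Plane} {x : Space} {v : Tan} :
    v ∈ unstableLine W x ↔ v.2 = v.1 • W x := by
  rw [unstableLine, Submodule.mem_span_singleton]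
  constructor
  · rintro ⟨a, rfl⟩; simp
  · intro h; exact ⟨v.1, Prod.ext (by simp) (by simp [h])⟩

theorem mem_stablePlane {x : Space} {v : Tan} : v ∈ stablePlane x ↔ v.1 = 0 := by
  rw [stablePlane, LinearMap.mem_range]
  constructor
  · rintro ⟨a, rfl⟩; simp
  · intro h; exact ⟨v.2, Prod.ext (by simp [h]) (by simp)⟩

theorem finrank_unstableLine (W : Space → Plane) (x : Space) :
    Module.finrank ℝ (unstableLine W x) = 1 :=
  finrank_span_singleton fun h => one_ne_zero (congrArg Prod.fst h)

theorem isCompl_unstableLine (W : Space → Plane) (x : Space) :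
    IsCompl (unstableLine W x) (stablePlane x) := by
  constructor
  · rw [Submodule.disjoint_def]
    intro v hv hv'
    rw [mem_unstableLine] at hv
    rw [mem_stablePlane] at hv'
    exact Prod.ext hv' (by rw [hv, hv', zero_smul]; rfl)
  · rw [codisjoint_iff, eq_top_iff]
    intro v _
    refine Submodule.mem_sup.2 ⟨(v.1, v.1 • W x), mem_unstableLine.2 rfl, (0, v.2 - v.1 • W x),
      mem_stablePlane.2 rfl, ?_⟩
    simp

theorem differential_embed_unstable (H : IsAdmissible m lam η) {W : Space → Plane}
    (hW : ∀ t, W (embed m lam η t) = slope m lam η t) (t : Sol m) :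
    differential (solenoidMap m lam lam η) (embed m lam η t) (1, W (embed m lam η t)) =
      (m : ℝ) • (1, W (embed m lam η (m • t))) := by
  rw [differential_solenoidMap_apply, hW, hW, Prod.smul_mk, smul_slope_nsmul H, one_smul]
  simp [embed]

/-- The invariance of the splitting reduces hyperbolicity to estimates of the norms. -/
theorem hypA2_of_norm (H : IsAdmissible m lam η)
    (hinj : InjOn (solenoidMap m lam lam η) solidTorus) {W : Space → Plane}
    (hW : ∀ t, W (embed m lam η t) = slope m lam η t) (g : RiemannianMetric)
    (hs : ∀ x y : Space, ∀ z : Plane, g.norm y (0, lam • z) ≤ lam * g.norm x (0, z))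
    {ν : ℝ} (hν : 1 < ν) (hu : ∀ (t : Sol m) (c : ℝ), ν * g.norm (embed m lam η t)
      (c • (1, slope m lam η t)) ≤ g.norm (embed m lam η (m • t))
        ((c * m) • (1, slope m lam η (m • t)))) :
    HypA2 g (solenoidMap m lam lam η) (attractor (solenoidMap m lam lam η) openSolidTorus)
      (unstableLine W) stablePlane := by
  rw [← range_embed H hinj]
  refine ⟨fun x _ => isCompl_unstableLine W x, ?_, ?_, ⟨ν, hν, ?_⟩, ⟨lam, H.lam_lt_one, ?_⟩⟩
  · rintro _ ⟨t, rfl⟩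
    have hd := differential_embed_unstable H hW t
    rw [unstableLine, unstableLine, Submodule.map_span, image_singleton, solenoidMap_embed H]
    change Submodule.span ℝ {differential _ _ _} = _
    rw [hd]
    exact Submodule.span_singleton_smul_eq (IsUnit.mk0 _ (Nat.cast_ne_zero.2 H.m_pos.ne')) _
  · intro x _
    ext v
    rw [Submodule.mem_map, mem_stablePlane]
    constructor
    · rintro ⟨w, hw, rfl⟩
      rw [mem_stablePlane] at hw
      change (differential _ _ w).1 = 0
      rw [differential_solenoidMap_apply, hw, mul_zero]
    · intro hv
      refine ⟨(0, lam⁻¹ • v.2), mem_stablePlane.2 rfl, ?_⟩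
      change differential _ _ _ = v
      rw [differential_solenoidMap_apply]
      exact Prod.ext (by simp [hv]) (by simp [H.lam_pos.ne'])
  · rintro _ ⟨t, rfl⟩ v hv
    obtain ⟨c, rfl⟩ := Submodule.mem_span_singleton.1 hv
    have hd := differential_embed_unstable H hW t
    rw [map_smul, hd, solenoidMap_embed H, smul_smul, hW, hW]
    exact hu t c
  · intro x _ v hv
    rw [mem_stablePlane] at hv
    rw [differential_solenoidMap_apply, hv, mul_zero, zero_smul, add_zero]
    have : v = (0, v.2) := Prod.ext hv rfl
    conv_rhs => rw [this]
    exact hs _ _ _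

theorem flatMetric_norm (x : Space) (v : Tan) :
    flatMetric.norm x v = Real.sqrt (v.1 ^ 2 + ‖v.2‖ ^ 2) := by
  rw [RiemannianMetric.norm]
  congr 1
  simp [flatMetric, pow_two]

/-- With `r ≤ R` and `r ≤ mr'` one has `m²(1 + r'²) ≥ (1 + r²) + (m² - 1) ≥ (1 + (m² - 1)/(1 +
R²))(1 + r²)`, which is where the expansion constant comes from. -/
theorem hypA2_flatMetric (H : IsAdmissible m lam η)
    (hinj : InjOn (solenoidMap m lam lam η) solidTorus) {W : Space → Plane}
    (hW : ∀ t, W (embed m lam η t) = slope m lam η t) :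
    HypA2 flatMetric (solenoidMap m lam lam η)
      (attractor (solenoidMap m lam lam η) openSolidTorus) (unstableLine W) stablePlane := by
  set R := 2 * Real.pi * η / (m - lam)
  have hm := H.two_le_real
  have hq : 0 < ((m : ℝ) ^ 2 - 1) / (1 + R ^ 2) := by
    have : 0 < (m : ℝ) ^ 2 - 1 := by nlinarith
    positivity
  refine hypA2_of_norm H hinj hW flatMetric (fun x y z => ?_)
    (ν := Real.sqrt (1 + ((m : ℝ) ^ 2 - 1) / (1 + R ^ 2))) ?_ fun t c => ?_
  · rw [flatMetric_norm, flatMetric_norm]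
    simp only [norm_smul, Real.norm_of_nonneg H.lam_pos.le]
    rw [zero_pow two_ne_zero, zero_add, zero_add, Real.sqrt_sq (by have := H.lam_pos; positivity),
      Real.sqrt_sq (norm_nonneg _)]
  · rw [Real.lt_sqrt zero_le_one]
    linarith
  · rw [flatMetric_norm, flatMetric_norm, ← Real.sqrt_mul (by positivity)]
    refine Real.sqrt_le_sqrt ?_
    simp only [Prod.smul_mk, smul_eq_mul, mul_one, norm_smul, Real.norm_eq_abs, mul_pow, sq_abs]
    set r := ‖slope m lam η t‖
    set r' := ‖slope m lam η (m • t)‖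
    have h1 : r ≤ R := norm_slope_le H t
    have h2 : r ≤ m * r' := norm_slope_le_nsmul H t
    have hr : 0 ≤ r := norm_nonneg _
    have h3 : r ^ 2 ≤ (m : ℝ) ^ 2 * r' ^ 2 := by rw [← mul_pow]; gcongr
    have h4 : ((m : ℝ) ^ 2 - 1) / (1 + R ^ 2) * (1 + r ^ 2) ≤ (m : ℝ) ^ 2 - 1 := by
      rw [div_mul_eq_mul_div, div_le_iff₀ (by positivity)]
      have : r ^ 2 ≤ R ^ 2 := by gcongr
      have : 0 < (m : ℝ) ^ 2 - 1 := by nlinarith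
      gcongr
    have h5 : (1 + ((m : ℝ) ^ 2 - 1) / (1 + R ^ 2)) * (1 + r ^ 2) ≤
        (m : ℝ) ^ 2 + (m : ℝ) ^ 2 * r' ^ 2 := by linarith
    nlinarith [mul_le_mul_of_nonneg_left h5 (sq_nonneg c)]

/-! ### The adapted metric -/

/-- The shear of the tangent space taking `(1, w)` to `(1, 0)` and fixing the stable plane. -/
def shear (w : Plane) : Tan →L[ℝ] Tan :=
  ContinuousLinearMap.id ℝ Tan - (ContinuousLinearMap.fst ℝ ℝ Plane).smulRight ((0 : ℝ), w)

theorem shear_apply (w : Plane) (v : Tan) : shear w v = (v.1, v.2 - v.1 • w) :=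
  Prod.ext (by simp [shear]) (by simp [shear])

theorem continuous_shear : Continuous shear := by
  unfold shear
  have h : Continuous fun w : Plane => ((0 : ℝ), w) := by fun_prop
  exact continuous_const.sub ((ContinuousLinearMap.smulRightL ℝ Tan Tan
    (ContinuousLinearMap.fst ℝ ℝ Plane)).continuous.comp h)

/-- The Riemannian metric for which `(1, W)` has norm one and is orthogonal to the stable plane. -/
def adaptedMetric (W : Space → Plane) (hW : Continuous W) : RiemannianMetric where
  form x := (flatMetric.form x).bilinearComp (shear (W x)) (shear (W x))
  symm x v w := flatMetric.symm x (shear (W x) v) (shear (W x) w)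
  pos x v hv := by
    refine flatMetric.pos x _ fun h => hv ?_
    replace h : shear (W x) v = 0 := h
    rw [shear_apply] at h
    have h1 : v.1 = 0 := congrArg Prod.fst h
    have h2 : v.2 - v.1 • W x = 0 := congrArg Prod.snd h
    rw [h1, zero_smul, sub_zero] at h2
    exact Prod.ext h1 h2
  continuous := by
    have h := continuous_shear.comp hW
    have h1 : Continuous fun x => (flatMetric.form x).comp (shear (W x)) :=
      flatMetric.continuous.clm_comp h
    -- The second argument is precomposed by flipping, composing and flipping back.
    have h2 := (ContinuousLinearMap.flipₗᵢ ℝ Tan Tan ℝ).continuous.comp h1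
    exact (ContinuousLinearMap.flipₗᵢ ℝ Tan Tan ℝ).continuous.comp (h2.clm_comp h)

theorem adaptedMetric_norm {W : Space → Plane} (hW : Continuous W) (x : Space) (v : Tan) :
    (adaptedMetric W hW).norm x v = Real.sqrt (v.1 ^ 2 + ‖v.2 - v.1 • W x‖ ^ 2) := by
  have h := flatMetric_norm x (shear (W x) v)
  rw [shear_apply] at h
  rw [← h, ← shear_apply, RiemannianMetric.norm, RiemannianMetric.norm, adaptedMetric,
    ContinuousLinearMap.bilinearComp_apply]

theorem adaptedMetric_norm_unstable {W : Space → Plane} (hW : Continuous W) (x : Space) (c : ℝ) :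
    (adaptedMetric W hW).norm x (c • (1, W x)) = |c| := by
  rw [adaptedMetric_norm]
  simp [Real.sqrt_sq_eq_abs]

theorem hypA2_adaptedMetric (H : IsAdmissible m lam η)
    (hinj : InjOn (solenoidMap m lam lam η) solidTorus) {W : Space → Plane} (hc : Continuous W)
    (hW : ∀ t, W (embed m lam η t) = slope m lam η t) :
    HypA2 (adaptedMetric W hc) (solenoidMap m lam lam η)
      (attractor (solenoidMap m lam lam η) openSolidTorus) (unstableLine W) stablePlane := by
  have hm := H.two_le_real
  refine hypA2_of_norm H hinj hW _ (fun x y z => ?_) (ν := m) (by linarith) fun t c => ?_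
  · rw [adaptedMetric_norm, adaptedMetric_norm]
    simp only [zero_smul, sub_zero, norm_smul, Real.norm_of_nonneg H.lam_pos.le]
    rw [zero_pow two_ne_zero, zero_add, zero_add, Real.sqrt_sq (by have := H.lam_pos; positivity),
      Real.sqrt_sq (norm_nonneg _)]
  · rw [← hW, ← hW, adaptedMetric_norm_unstable, adaptedMetric_norm_unstable, abs_mul,
      Nat.abs_cast, mul_comm]

/-- An equality, as required of a model map: the unit vector `(1, W)` goes to exactly `m` times a
unit vector. -/
theorem adaptedMetric_expansion (H : IsAdmissible m lam η)
    (hinj : InjOn (solenoidMap m lam lam η) solidTorus) {W : Space → Plane} (hc : Continuous W)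
    (hW : ∀ t, W (embed m lam η t) = slope m lam η t) {x : Space}
    (hx : x ∈ attractor (solenoidMap m lam lam η) openSolidTorus) {v : Tan}
    (hv : v ∈ unstableLine W x) :
    (adaptedMetric W hc).norm (solenoidMap m lam lam η x)
      (differential (solenoidMap m lam lam η) x v) = m * (adaptedMetric W hc).norm x v := by
  rw [← range_embed H hinj] at hx
  obtain ⟨t, rfl⟩ := hx
  obtain ⟨c, rfl⟩ := Submodule.mem_span_singleton.1 hv
  have hd := differential_embed_unstable H hW t
  rw [map_smul, hd, solenoidMap_embed H, smul_smul, adaptedMetric_norm_unstable,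
    adaptedMetric_norm_unstable, abs_mul, Nat.abs_cast, mul_comm]

end

section

variable {m : ℕ} {lam η : ℝ}

/-! ### Linearisation at the fixed point -/

/-- The parametrisation of the local unstable manifold of the fixed point, as a complex function. -/
def unstableGraphC (m : ℕ) (lam η : ℝ) (z : ℂ) : ℂ :=
  ∑' n : ℕ, ((lam ^ n * η : ℝ) : ℂ) * Complex.exp (2 * Real.pi * Complex.I * (z / m ^ (n + 1)))

theorem norm_unstableGraphC_term_le (H : IsAdmissible m lam η) {r : ℝ} (n : ℕ) {z : ℂ}
    (hz : ‖z‖ ≤ r) :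
    ‖((lam ^ n * η : ℝ) : ℂ) * Complex.exp (2 * Real.pi * Complex.I * (z / m ^ (n + 1)))‖ ≤
      lam ^ n * (η * Real.exp (2 * Real.pi * r)) := by
  have := H.lam_pos
  have := H.η_pos
  have hm : (1 : ℝ) ≤ m := by linarith [H.two_le_real]
  rw [norm_mul, Complex.norm_real, Real.norm_of_nonneg (by positivity), mul_assoc]
  gcongr
  refine (Complex.norm_exp_le_exp_norm _).trans (Real.exp_le_exp.2 ?_)
  rw [norm_mul, norm_two_pi_I, norm_div, norm_pow, Complex.norm_natCast]
  gcongr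
  exact (div_le_self (norm_nonneg _) (one_le_pow₀ hm)).trans hz

theorem differentiable_unstableGraphC (H : IsAdmissible m lam η) :
    Differentiable ℂ (unstableGraphC m lam η) := by
  intro z
  have h := Complex.differentiableOn_tsum_of_summable_norm (U := Metric.ball 0 (‖z‖ + 1))
    (summable_pow_mul H (η * Real.exp (2 * Real.pi * (‖z‖ + 1))))
    (F := fun n z => ((lam ^ n * η : ℝ) : ℂ) *
      Complex.exp (2 * Real.pi * Complex.I * (z / m ^ (n + 1)))) (fun n => by fun_prop)
    Metric.isOpen_ball
    fun n w hw => norm_unstableGraphC_term_le H n (by simpa using (mem_ball_zero_iff.1 hw).le)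
  exact (h z (by simp)).differentiableAt (Metric.isOpen_ball.mem_nhds (by simp))

/-- The local unstable manifold of the fixed point is the graph of this function. -/
def unstableGraph (m : ℕ) (lam η : ℝ) (s : ℝ) : Plane := toPlane (unstableGraphC m lam η s)

/-- The series is a locally uniform limit of entire functions, so smoothness on the line comes from
holomorphy, without termwise differentiation. -/
theorem contDiff_unstableGraph (H : IsAdmissible m lam η) :
    ContDiff ℝ ∞ (unstableGraph m lam η) := by
  have h1 : ContDiff ℂ ∞ (unstableGraphC m lam η) := (differentiable_unstableGraphC H).contDiff
  have h2 : ContDiff ℝ ∞ (unstableGraphC m lam η) := h1.restrict_scalars ℝ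
  exact toPlane.toContinuousLinearEquiv.contDiff.comp (h2.comp Complex.ofRealCLM.contDiff)

/-- Invariance of the graph under `F`. Subtracting this solution turns the fibre map `z ↦ λz + η
circ s` into `z ↦ λz`, which is the linearisation. -/
theorem unstableGraph_mul (H : IsAdmissible m lam η) (s : ℝ) :
    unstableGraph m lam η (m * s) = lam • unstableGraph m lam η s + η • circ (s : ℝ) := by
  have hm : (m : ℂ) ≠ 0 := Nat.cast_ne_zero.2 H.m_pos.ne'
  have hs : ∀ z : ℂ, Summable fun n : ℕ => ((lam ^ n * η : ℝ) : ℂ) *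
      Complex.exp (2 * Real.pi * Complex.I * (z / m ^ (n + 1))) := fun z =>
    Summable.of_norm_bounded (summable_pow_mul H (η * Real.exp (2 * Real.pi * ‖z‖)))
      fun n => norm_unstableGraphC_term_le H n le_rfl
  have key : unstableGraphC m lam η ((m * s : ℝ) : ℂ) = lam * unstableGraphC m lam η s +
      η * Complex.exp (2 * Real.pi * Complex.I * s) := by
    rw [unstableGraphC, (hs _).tsum_eq_zero_add, unstableGraphC, ← tsum_mul_left, add_comm]
    congr 1
    · refine tsum_congr fun n => ?_
      have : (((m * s : ℝ) : ℂ) / m ^ (n + 1 + 1)) = s / m ^ (n + 1) := by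
        push_cast
        rw [pow_succ (m : ℂ) (n + 1)]
        field_simp
      rw [this]
      push_cast
      ring
    · have : (((m * s : ℝ) : ℂ) / m ^ (0 + 1)) = s := by
        push_cast
        field_simp
      rw [this]
      simp
  rw [unstableGraph, key, map_add, unstableGraph, circ, toCircle_coe_eq_exp,
    ← map_smul, ← map_smul, Complex.real_smul, Complex.real_smul]

theorem unstableGraph_zero (H : IsAdmissible m lam η) :
    unstableGraph m lam η 0 = !₂[η / (1 - lam), 0] := by
  have h := unstableGraph_mul H 0
  have hl : (1 - lam) ≠ 0 := by linarith [H.lam_lt_one]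
  rw [mul_zero, circ, toCircle_coe_eq_exp] at h
  have h2 : (1 - lam) • unstableGraph m lam η 0 = η • toPlane 1 := by
    rw [sub_smul, one_smul, sub_eq_iff_eq_add, add_comm]
    simpa using h
  have h3 : unstableGraph m lam η 0 = (1 - lam)⁻¹ • η • toPlane 1 := by
    rw [← h2, smul_smul, inv_mul_cancel₀ hl, one_smul]
  rw [h3, toPlane_apply]
  ext i
  fin_cases i <;> simp [div_eq_inv_mul]

/-- Differentiating the functional equation at `0` gives the same linear equation as
`smul_slope_nsmul` at the fixed sequence `0`; it has one solution because `m ≠ lam`. -/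
theorem hasDerivAt_unstableGraph_zero (H : IsAdmissible m lam η) :
    HasDerivAt (unstableGraph m lam η) (slope m lam η 0) 0 := by
  have hm : (m : ℝ) - lam ≠ 0 := by linarith [H.two_le_real, H.lam_lt_one]
  have hd : DifferentiableAt ℝ (unstableGraph m lam η) 0 :=
    (contDiff_unstableGraph H).differentiable (by simp) 0
  have h1 := hd.hasDerivAt
  have h2 : HasDerivAt (fun s : ℝ => unstableGraph m lam η (m * s))
      ((m : ℝ) • deriv (unstableGraph m lam η) 0) 0 := by
    have h3 : HasDerivAt (fun s : ℝ => (m : ℝ) * s) m 0 := by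
      simpa using (hasDerivAt_id (0 : ℝ)).const_mul (m : ℝ)
    refine HasDerivAt.scomp (g₁ := unstableGraph m lam η) (0 : ℝ) ?_ h3
    simpa using h1
  have h4 : HasDerivAt (fun s : ℝ => lam • unstableGraph m lam η s + η • circ (s : ℝ))
      (lam • deriv (unstableGraph m lam η) 0 + η • dcirc 0) 0 := by
    have h5 := hasDerivAt_circ_add 0 0
    simp only [zero_add, AddCircle.coe_zero] at h5
    exact (h1.const_smul lam).add (h5.const_smul η)
  simp_rw [unstableGraph_mul H] at h2
  have h6 := h2.unique h4
  have h7 := smul_slope_nsmul H (0 : Sol m)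
  rw [smul_zero] at h7
  have h8 : ((m : ℝ) - lam) • deriv (unstableGraph m lam η) 0 =
      ((m : ℝ) - lam) • slope m lam η 0 := by
    rw [sub_smul, sub_smul, h6, h7]
    simp
  rw [← smul_right_injective _ hm h8]
  exact h1

/-- The fixed point is the image of the neutral element, which multiplication by `m` fixes. -/
theorem embed_zero (H : IsAdmissible m lam η) :
    embed m lam η 0 = (((0 : ℝ) : UnitAddCircle), !₂[η / (1 - lam), 0]) := by
  rw [← unstableGraph_zero H]
  refine Prod.ext rfl ?_
  simp only [embed, unstableGraph, unstableGraphC]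
  have h0 : ∀ n : ℕ, (0 : Sol m).1 n = ((0 : ℝ) : UnitAddCircle) := fun n => rfl
  have h1 : ∀ n : ℕ, (lam ^ n * η) • circ ((0 : Sol m).1 (n + 1)) =
      toPlane ((lam ^ n * η : ℝ) : ℂ) := fun n => by
    rw [h0, circ, toCircle_coe_eq_exp, ← map_smul, Complex.real_smul]
    simp
  simp_rw [h1]
  have h2 : toPlane (∑' n : ℕ, ((lam ^ n * η : ℝ) : ℂ)) =
      ∑' n : ℕ, toPlane ((lam ^ n * η : ℝ) : ℂ) :=
    toPlane.toContinuousLinearEquiv.map_tsum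
  rw [← h2]
  simp

/-- The domain of the linearising coordinates. -/
def linSource : Set Space :=
  {x | x.1 ≠ (((-1 / 2 : ℝ)) : UnitAddCircle)} ∩ openSolidTorus

theorem isOpen_linSource : IsOpen linSource :=
  (isOpen_ne_fun (by fun_prop) (by fun_prop)).inter isOpen_openSolidTorus

theorem chart_fst_mem (x : Space) : (chart x).1 ∈ Ioc (-1 / 2 : ℝ) (1 / 2) := by
  have := (AddCircle.equivIoc (1 : ℝ) (-1 / 2) x.1).2
  norm_num at this ⊢
  exact this

theorem coe_chart_fst (x : Space) : ((chart x).1 : UnitAddCircle) = x.1 :=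
  AddCircle.coe_equivIoc

theorem abs_chart_fst_lt {x : Space} (hx : x ∈ linSource) : |(chart x).1| < 1 / 2 := by
  have h := chart_fst_mem x
  rw [abs_lt]
  refine ⟨by linarith [h.1], lt_of_le_of_ne h.2 fun h' => hx.1 ?_⟩
  rw [← coe_chart_fst x, h', ← sub_eq_zero, ← AddCircle.coe_sub, AddCircle.coe_eq_zero_iff]
  exact ⟨1, by norm_num⟩

theorem coe_ne_half {s : ℝ} (hs : |s| < 1 / 2) :
    (s : UnitAddCircle) ≠ (((-1 / 2 : ℝ)) : UnitAddCircle) := by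
  intro h
  have h1 := chart_coe hs 0
  rw [h] at h1
  have h2 : (((-1 / 2 : ℝ)) : UnitAddCircle) = ((1 / 2 : ℝ) : UnitAddCircle) := by
    rw [← sub_eq_zero, ← AddCircle.coe_sub, AddCircle.coe_eq_zero_iff]
    exact ⟨-1, by norm_num⟩
  rw [h2, chart, AddCircle.equivIoc_coe_eq (by constructor <;> norm_num)] at h1
  have h3 : (1 / 2 : ℝ) = s := congrArg Prod.fst h1
  rw [← h3, abs_of_pos (by norm_num)] at hs
  exact lt_irrefl _ hs

theorem continuousOn_chart : ContinuousOn chart linSource := by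
  intro x hx
  refine ContinuousAt.continuousWithinAt ?_
  have h := AddCircle.continuousAt_equivIoc (1 : ℝ) (-1 / 2) hx.1
  have h1 : ContinuousAt (fun x : Space => ((AddCircle.equivIoc (1 : ℝ) (-1 / 2) x.1 : ℝ))) x :=
    continuous_subtype_val.continuousAt.comp (h.comp continuous_fst.continuousAt)
  exact h1.prodMk continuous_snd.continuousAt

/-- The coordinates which linearise the solenoid map near its fixed point. -/
def linChart (H : IsAdmissible m lam η) : OpenPartialHomeomorph Space Tan where
  toFun x := ((chart x).1, x.2 - unstableGraph m lam η (chart x).1)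
  invFun v := ((v.1 : UnitAddCircle), v.2 + unstableGraph m lam η v.1)
  source := linSource
  target := {v | |v.1| < 1 / 2} ∩ {v | ‖v.2 + unstableGraph m lam η v.1‖ < 1}
  map_source' x hx := ⟨abs_chart_fst_lt hx, by
    rw [mem_ofPred_eq, sub_add_cancel]; exact hx.2⟩
  map_target' v hv := ⟨coe_ne_half hv.1, hv.2⟩
  left_inv' x hx := Prod.ext (coe_chart_fst x) (by simp)
  right_inv' v hv := by
    have h := chart_coe hv.1
    simp only [h, add_sub_cancel_right]
  open_source := isOpen_linSource
  open_target := by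
    have h := (contDiff_unstableGraph H).continuous
    exact (isOpen_lt (by fun_prop) continuous_const).inter
      (isOpen_lt (by fun_prop) continuous_const)
  continuousOn_toFun := by
    have h := (contDiff_unstableGraph H).continuous
    have h1 : ContinuousOn (fun x => (chart x).1) linSource :=
      continuous_fst.comp_continuousOn continuousOn_chart
    exact h1.prodMk (continuous_snd.continuousOn.sub (h.comp_continuousOn h1))
  continuousOn_invFun := by
    have h := (contDiff_unstableGraph H).continuous
    have h1 : Continuous fun v : Tan => (v.1 : UnitAddCircle) :=
      (AddCircle.continuous_mk' (1 : ℝ)).comp continuous_fst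
    exact (h1.prodMk (by fun_prop)).continuousOn

theorem linChart_apply (H : IsAdmissible m lam η) (x : Space) :
    linChart H x = ((chart x).1, x.2 - unstableGraph m lam η (chart x).1) := rfl

theorem linChart_symm_apply (H : IsAdmissible m lam η) (v : Tan) :
    (linChart H).symm v = ((v.1 : UnitAddCircle), v.2 + unstableGraph m lam η v.1) := rfl

theorem linChart_add_cover (H : IsAdmissible m lam η) {x : Space} (hx : x ∈ linSource) :
    (fun v : Tan => linChart H (x + cover v)) =ᶠ[𝓝 0] fun v =>
      ((chart x).1 + v.1, x.2 + v.2 - unstableGraph m lam η ((chart x).1 + v.1)) := by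
  -- The distance to the cut of the circle: smaller displacements do not wrap around.
  have hr : 0 < 1 / 2 - |(chart x).1| := by linarith [abs_chart_fst_lt hx]
  filter_upwards [eventually_abs_fst_mul_lt 1 hr] with v hv
  rw [one_mul] at hv
  have h1 : |(chart x).1 + v.1| < 1 / 2 := (abs_add_le _ _).trans_lt (by linarith)
  have h2 : x + cover v = ((((chart x).1 + v.1 : ℝ) : UnitAddCircle), x.2 + v.2) := by
    refine Prod.ext ?_ rfl
    simp only [AddCircle.coe_add, coe_chart_fst, cover, Prod.fst_add]
  rw [linChart_apply, h2, chart_coe h1]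

theorem isSmoothChart_linChart (H : IsAdmissible m lam η) : IsSmoothChart (linChart H) where
  contDiff x hx := by
    have h := contDiff_unstableGraph H
    refine ContDiffAt.congr_of_eventuallyEq ?_ (linChart_add_cover H hx)
    refine ContDiff.contDiffAt ?_
    fun_prop
  contDiff_symm y hy := by
    have h := contDiff_unstableGraph H
    have h1 : ContDiff ℝ ∞ fun v : Tan =>
      (v.1, v.2 + unstableGraph m lam η (y.1 + v.1) - unstableGraph m lam η y.1) := by fun_prop
    refine h1.contDiffAt.congr_of_eventuallyEq ?_
    filter_upwards [eventually_abs_fst_mul_lt 1 (r := 1 / 2) (by norm_num)] with v hv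
    rw [one_mul] at hv
    have h2 : (linChart H).symm (y + v) - (linChart H).symm y = ((v.1 : UnitAddCircle),
        v.2 + unstableGraph m lam η (y.1 + v.1) - unstableGraph m lam η y.1) := by
      rw [linChart_symm_apply, linChart_symm_apply]
      refine Prod.ext ?_ ?_
      · simp
      · simp only [Prod.snd_sub, Prod.snd_add, Prod.fst_add]
        abel
    rw [h2, chart_coe hv]

theorem isTimeOneImage_linearField (γ β : ℝ) (y : Tan) :
    IsTimeOneImage (linearField γ β) y (Real.exp γ * y.1, Real.exp (-β) • y.2) := by
  refine ⟨fun s => (Real.exp (γ * s) * y.1, Real.exp (-β * s) • y.2), fun s => ?_, by simp,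
    by simp⟩
  have h : ∀ a : ℝ, HasDerivAt (fun s => Real.exp (a * s)) (Real.exp (a * s) * a) s := fun a => by
    simpa using ((hasDerivAt_id s).const_mul a).exp
  have h1 := ((h γ).mul_const y.1).prodMk ((h (-β)).smul_const y.2)
  have e : linearField γ β (Real.exp (γ * s) * y.1, Real.exp (-β * s) • y.2) =
      (Real.exp (γ * s) * γ * y.1, (Real.exp (-β * s) * -β) • y.2) := by
    refine Prod.ext ?_ ?_
    · simp [linearField]; ring
    · simp [linearField, smul_smul]; ring_nf
  rw [e]
  exact h1

theorem hypA4_solenoidMap (H : IsAdmissible m lam η)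
    (hinj : InjOn (solenoidMap m lam lam η) solidTorus) {W : Space → Plane}
    (hW : ∀ t, W (embed m lam η t) = slope m lam η t) :
    HypA4 (solenoidMap m lam lam η) openSolidTorus (unstableLine W) stablePlane
      (((0 : ℝ) : UnitAddCircle), !₂[η / (1 - lam), 0]) (Real.log m) (Real.log (1 / lam)) := by
  have hm := H.two_le_real
  have hm0 : (0 : ℝ) < m := by linarith
  have hl := H.lam_pos
  rw [← embed_zero H]
  set p := embed m lam η 0 with hp
  have hp1 : p = (((0 : ℝ) : UnitAddCircle), !₂[η / (1 - lam), 0]) := embed_zero H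
  have hchart : chart p = (0, p.2) := by
    rw [hp1, chart_coe (by norm_num)]
  have hps : p ∈ linSource := ⟨by rw [hp1]; exact coe_ne_half (by norm_num), embed_mem H 0⟩
  have hp2 : p.2 = unstableGraph m lam η 0 := by rw [hp1, unstableGraph_zero H]
  -- The coordinates differentiate at `p` to a shear, which sends `(1, slope 0)` to `(1, 0)` and
  -- fixes the stable plane pointwise.
  have hd : HasFDerivAt (fun v : Tan => linChart H (p + cover v)) (shear (slope m lam η 0)) 0 := by
    refine HasFDerivAt.congr_of_eventuallyEq ?_ (linChart_add_cover H hps)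
    rw [hchart]
    have h1 : HasFDerivAt (fun v : Tan => unstableGraph m lam η (0 + v.1))
        ((ContinuousLinearMap.fst ℝ ℝ Plane).smulRight (slope m lam η 0)) 0 := by
      have h2 : HasDerivAt (unstableGraph m lam η) (slope m lam η 0) ((fun v : Tan => 0 + v.1) 0) :=
        by simpa using hasDerivAt_unstableGraph_zero H
      have h3 : HasFDerivAt (fun v : Tan => 0 + v.1) (ContinuousLinearMap.fst ℝ ℝ Plane) 0 :=
        (ContinuousLinearMap.fst ℝ ℝ Plane).hasFDerivAt.const_add 0
      have h4 := HasFDerivAt.comp (0 : Tan) h2.hasFDerivAt h3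
      have e : (ContinuousLinearMap.fst ℝ ℝ Plane).smulRight (slope m lam η 0) =
          (ContinuousLinearMap.toSpanSingleton ℝ (slope m lam η 0)).comp
            (ContinuousLinearMap.fst ℝ ℝ Plane) := by
        refine ContinuousLinearMap.ext fun v => ?_
        simp
      rw [e]
      exact h4
    have h5 : HasFDerivAt (fun v : Tan => (0 : ℝ) + v.1) (ContinuousLinearMap.fst ℝ ℝ Plane) 0 :=
      (ContinuousLinearMap.fst ℝ ℝ Plane).hasFDerivAt.const_add 0
    have h6 : HasFDerivAt (fun v : Tan => p.2 + v.2) (ContinuousLinearMap.snd ℝ ℝ Plane) 0 :=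
      (ContinuousLinearMap.snd ℝ ℝ Plane).hasFDerivAt.const_add p.2
    have h7 := h5.prodMk (h6.sub h1)
    have e : shear (slope m lam η 0) = (ContinuousLinearMap.fst ℝ ℝ Plane).prod
        (ContinuousLinearMap.snd ℝ ℝ Plane -
          (ContinuousLinearMap.fst ℝ ℝ Plane).smulRight (slope m lam η 0)) := by
      refine ContinuousLinearMap.ext fun v => ?_
      rw [shear_apply]
      simp
    rw [e]
    exact h7
  refine ⟨Real.log_pos (by linarith), Real.log_lt_log hm0 ?_, ?_, ?_, linChart H,
    isSmoothChart_linChart H, hps, inter_subset_right, ?_, ?_, ?_, ?_⟩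
  · rw [lt_div_iff₀ hl]
    exact H.mul_lt
  · rw [← range_embed H hinj]
    exact mem_range_self _
  · rw [hp, solenoidMap_embed H, smul_zero]
  · rw [linChart_apply, hchart, hp2]
    simp
  · rw [hd.fderiv, unstableLine, Submodule.map_span, image_singleton]
    change Submodule.span ℝ {shear _ _} = _
    rw [shear_apply, hp, hW]
    ext v
    rw [Submodule.mem_span_singleton, LinearMap.mem_range]
    refine exists_congr fun a => ?_
    simp
  · rw [hd.fderiv]
    ext v
    rw [Submodule.mem_map, LinearMap.mem_range]
    constructor
    · rintro ⟨w, hw, rfl⟩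
      rw [mem_stablePlane] at hw
      refine ⟨w.2, ?_⟩
      change _ = shear _ w
      rw [shear_apply, hw]
      simp
    · rintro ⟨w, rfl⟩
      refine ⟨(0, w), mem_stablePlane.2 rfl, ?_⟩
      change shear _ _ = _
      rw [shear_apply]
      simp
  · have hc : ContinuousAt (fun x => m * (chart x).1) p :=
      ((continuousOn_chart.continuousAt (isOpen_linSource.mem_nhds hps)).fst).const_mul _
    have hev : ∀ᶠ x in 𝓝 p, |m * (chart x).1| < 1 / 2 := by
      refine hc.abs.eventually (gt_mem_nhds ?_)
      simp only [hchart]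
      norm_num
    -- On this neighbourhood the image does not cross the cut, so its first coordinate is literally
    -- `m` times the original one.
    refine ⟨linSource ∩ {x | |m * (chart x).1| < 1 / 2},
      inter_mem (isOpen_linSource.mem_nhds hps) hev, inter_subset_left, fun x hx => ?_⟩
    have h1 : solenoidMap m lam lam η x =
        (((m * (chart x).1 : ℝ) : UnitAddCircle), lam • x.2 + η • circ x.1) := by
      rw [solenoidMap_eq, ← nsmul_eq_mul, AddCircle.coe_nsmul, coe_chart_fst]
    refine ⟨⟨?_, mapsTo_solidTorus_openSolidTorus H (openSolidTorus_subset hx.1.2)⟩, ?_⟩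
    · rw [mem_ofPred_eq, h1]
      exact coe_ne_half hx.2
    · have h2 : linChart H (solenoidMap m lam lam η x) = (Real.exp (Real.log m) * (linChart H x).1,
          Real.exp (-Real.log (1 / lam)) • (linChart H x).2) := by
        rw [linChart_apply, h1, chart_coe hx.2, linChart_apply, Real.exp_log hm0, one_div,
          Real.log_inv, neg_neg, Real.exp_log hl, unstableGraph_mul H, coe_chart_fst, smul_sub]
        simp
      rw [h2]
      exact isTimeOneImage_linearField _ _ _

end

/-! ### Distance of iterates, and invariant measures on the attractor -/

section

variable {m : ℕ} {lam η : ℝ}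

/-- Initial differences in the plane contract by `lam`, and those in the circle grow by `m`. The
forcing term closes the induction because `lam + η < 1 ≤ m`. -/
theorem dist_iterate_le (H : IsAdmissible m lam η) {x y : Space} (hx : x ∈ solidTorus)
    (hy : y ∈ solidTorus) (n : ℕ) :
    dist ((solenoidMap m lam lam η)^[n] x) ((solenoidMap m lam lam η)^[n] y) ≤
      2 * lam ^ n + 2 * Real.pi * (m ^ n * ‖x.1 - y.1‖) := by
  set F := solenoidMap m lam lam η
  have hl := H.lam_pos
  have hm := H.two_le_real
  have h1 : ∀ n, ‖(F^[n] x).1 - (F^[n] y).1‖ ≤ m ^ n * ‖x.1 - y.1‖ := fun n => by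
    rw [iterate_solenoidMap_fst, iterate_solenoidMap_fst, ← nsmul_sub]
    simpa using norm_nsmul_le (n := m ^ n) (a := x.1 - y.1)
  have h2 : ∀ n, ‖(F^[n] x).2 - (F^[n] y).2‖ ≤
      2 * lam ^ n + 2 * Real.pi * (m ^ n * ‖x.1 - y.1‖) := by
    intro n
    induction n with
    | zero =>
      have : ‖x.2 - y.2‖ ≤ 1 + 1 := (norm_sub_le _ _).trans (add_le_add hx hy)
      simp only [Function.iterate_zero, id_eq, pow_zero, mul_one, one_mul]
      have : 0 ≤ 2 * Real.pi * ‖x.1 - y.1‖ := by positivity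
      linarith
    | succ n ih =>
      set d := (m : ℝ) ^ n * ‖x.1 - y.1‖ with hd
      have hd0 : 0 ≤ d := by positivity
      have e : (F^[n + 1] x).2 - (F^[n + 1] y).2 = lam • ((F^[n] x).2 - (F^[n] y).2) +
          η • (circ (F^[n] x).1 - circ (F^[n] y).1) := by
        rw [Function.iterate_succ_apply', Function.iterate_succ_apply']
        simp only [F, solenoidMap_eq, smul_sub]
        abel
      have h3 : ‖circ (F^[n] x).1 - circ (F^[n] y).1‖ ≤ 2 * Real.pi * d :=
        (norm_circ_sub_le _ _).trans (by gcongr; exact h1 n)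
      have h4 := norm_add_le (lam • ((F^[n] x).2 - (F^[n] y).2))
        (η • (circ (F^[n] x).1 - circ (F^[n] y).1))
      rw [← e, norm_smul, norm_smul, Real.norm_of_nonneg hl.le,
        Real.norm_of_nonneg H.η_pos.le] at h4
      have h5 := mul_le_mul_of_nonneg_left ih hl.le
      have h6 := mul_le_mul_of_nonneg_left h3 H.η_pos.le
      have h7 : (lam + η) * (2 * Real.pi * d) ≤ m * (2 * Real.pi * d) := by
        gcongr
        linarith [H.add_lt]
      have e2 : (m : ℝ) ^ (n + 1) * ‖x.1 - y.1‖ = m * d := by rw [hd, pow_succ]; ring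
      rw [e2, pow_succ]
      linarith
  rw [dist_eq_norm, Prod.norm_def]
  refine max_le ((h1 n).trans ?_) (h2 n)
  have h3 : 0 ≤ (m : ℝ) ^ n * ‖x.1 - y.1‖ := by positivity
  have h4 : 0 ≤ 2 * lam ^ n := by positivity
  nlinarith [Real.pi_gt_three]

theorem IsInvariantOn.measurePreserving {f : Space → Space} {K : Set Space}
    {ν : ProbabilityMeasure Space} (h : IsInvariantOn f K ν) (hf : Measurable f) :
    MeasurePreserving f (ν : Measure Space) ν := ⟨hf, h.2⟩

theorem attractor_subset_solidTorus (m : ℕ) (lam η : ℝ) :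
    attractor (solenoidMap m lam lam η) openSolidTorus ⊆ solidTorus := by
  rw [attractor_solenoidMap]
  exact (iInter_subset _ 0).trans (by simp)

theorem IsInvariantOn.ae_mem_solidTorus {ν : ProbabilityMeasure Space}
    (h : IsInvariantOn (solenoidMap m lam lam η)
      (attractor (solenoidMap m lam lam η) openSolidTorus) ν) :
    ∀ᵐ x ∂(ν : Measure Space), x ∈ solidTorus :=
  measure_mono_null (compl_subset_compl.2 (attractor_subset_solidTorus m lam η)) h.1

/-! ### The partitions of the circle into intervals of length `m⁻ⁿ` -/

/-- The representative in `[0, 1)` of a point of the circle. -/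
def fr (a : UnitAddCircle) : ℝ := AddCircle.equivIco (1 : ℝ) 0 a

theorem fr_mem (a : UnitAddCircle) : fr a ∈ Ico (0 : ℝ) 1 := by
  have := (AddCircle.equivIco (1 : ℝ) 0 a).2
  exact ⟨this.1, this.2.trans_eq (zero_add 1)⟩

theorem coe_fr (a : UnitAddCircle) : (fr a : UnitAddCircle) = a := AddCircle.coe_equivIco

theorem fr_coe (s : ℝ) : fr (s : UnitAddCircle) = Int.fract s := by
  have h := AddCircle.coe_equivIco_mk_apply (1 : ℝ) s
  rw [div_one, mul_one] at h
  exact h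

theorem measurable_fr : Measurable fr :=
  measurable_subtype_coe.comp (AddCircle.measurableEquivIco (1 : ℝ) 0).measurable

theorem fr_nsmul (k : ℕ) (a : UnitAddCircle) : fr (k • a) = Int.fract (k * fr a) := by
  conv_lhs => rw [← coe_fr a]
  rw [← AddCircle.coe_nsmul, nsmul_eq_mul, fr_coe]

variable [NeZero m]

theorem cast_pos_of_neZero : (0 : ℝ) < m := Nat.cast_pos.2 (Nat.pos_of_ne_zero (NeZero.ne m))

theorem floor_lt_pow (n : ℕ) (a : UnitAddCircle) : ⌊(m : ℝ) ^ n * fr a⌋₊ < m ^ n := by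
  have hm := cast_pos_of_neZero (m := m)
  have h := fr_mem a
  rw [Nat.floor_lt (mul_nonneg (by positivity) h.1)]
  push_cast
  exact mul_lt_of_lt_one_right (by positivity) h.2

/-- The index of the interval of length `m⁻ⁿ` containing a point of the circle. -/
def cell (m : ℕ) [NeZero m] (n : ℕ) (a : UnitAddCircle) : Fin (m ^ n) :=
  ⟨⌊(m : ℝ) ^ n * fr a⌋₊, floor_lt_pow n a⟩

theorem cell_val (n : ℕ) (a : UnitAddCircle) : (cell m n a : ℕ) = ⌊(m : ℝ) ^ n * fr a⌋₊ := rfl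

theorem measurable_cell (n : ℕ) : Measurable (cell m n) := by
  have h : Measurable fun a => (cell m n a : ℕ) :=
    Nat.measurable_floor.comp (measurable_fr.const_mul _)
  refine measurable_to_countable' fun k => ?_
  have e : cell m n ⁻¹' {k} = (fun a => (cell m n a : ℕ)) ⁻¹' {(k : ℕ)} := by
    ext a; simp [Fin.ext_iff]
  rw [e]
  exact h (measurableSet_singleton _)

/-- Base `m` digits: the first `a + b` digits of `t` are its first `a` digits followed by the first
`b` digits of `m ^ a • t`. -/
theorem cell_add (a b : ℕ) (t : UnitAddCircle) :
    (cell m (a + b) t : ℕ) = m ^ b * cell m a t + cell m b (m ^ a • t) := by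
  have h0 : 0 ≤ (m : ℝ) ^ a * fr t := mul_nonneg (by positivity) (fr_mem t).1
  have h1 : fr (m ^ a • t) = (m : ℝ) ^ a * fr t - ⌊(m : ℝ) ^ a * fr t⌋₊ := by
    rw [fr_nsmul, Nat.cast_pow, Int.fract, natCast_floor_eq_intCast_floor h0]
  simp only [cell_val]
  rw [add_comm (m ^ b * _), ← Nat.floor_add_natCast (mul_nonneg (by positivity) (fr_mem _).1)]
  congr 1
  rw [h1]
  push_cast
  ring

theorem cell_add_eq_iff {a b : ℕ} {t u : UnitAddCircle} :
    cell m (a + b) t = cell m (a + b) u ↔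
      cell m a t = cell m a u ∧ cell m b (m ^ a • t) = cell m b (m ^ a • u) := by
  simp only [Fin.ext_iff, cell_add]
  have h1 := (cell m b (m ^ a • t)).2
  have h2 := (cell m b (m ^ a • u)).2
  constructor
  · intro h
    have h3 := congrArg (· / m ^ b) h
    simp only [Nat.mul_add_div (Nat.zero_lt_of_lt h1), Nat.div_eq_of_lt h1, Nat.div_eq_of_lt h2,
      add_zero] at h3
    rw [h3] at h
    exact ⟨h3, Nat.add_left_cancel h⟩
  · rintro ⟨h, h'⟩
    rw [h, h']

theorem norm_sub_le_of_cell_eq {n : ℕ} {t u : UnitAddCircle} (h : cell m n t = cell m n u) :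
    ‖t - u‖ ≤ ((m : ℝ) ^ n)⁻¹ := by
  have hm := cast_pos_of_neZero (m := m)
  have h0 : ∀ a, 0 ≤ (m : ℝ) ^ n * fr a := fun a => mul_nonneg (by positivity) (fr_mem a).1
  rw [← coe_fr t, ← coe_fr u, ← AddCircle.coe_sub]
  refine (norm_coe_le _).trans ?_
  have h1 : ⌊(m : ℝ) ^ n * fr t⌋₊ = ⌊(m : ℝ) ^ n * fr u⌋₊ := congrArg Fin.val h
  have h2 := Nat.floor_le (h0 t)
  have h3 := Nat.lt_floor_add_one ((m : ℝ) ^ n * fr t)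
  have h4 := Nat.floor_le (h0 u)
  have h5 := Nat.lt_floor_add_one ((m : ℝ) ^ n * fr u)
  rw [h1] at h2 h3
  have h6 : |(m : ℝ) ^ n * (fr t - fr u)| ≤ 1 := by
    rw [abs_le, mul_sub]; constructor <;> linarith
  rw [abs_mul, abs_of_pos (by positivity)] at h6
  rw [inv_eq_one_div, le_div_iff₀ (by positivity)]
  linarith

theorem volume_cell (n : ℕ) (k : Fin (m ^ n)) :
    (volume : Measure UnitAddCircle) (cell m n ⁻¹' {k}) = ENNReal.ofReal ((m : ℝ) ^ n)⁻¹ := by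
  have hm := cast_pos_of_neZero (m := m)
  have hp : 0 < (m : ℝ) ^ n := by positivity
  have h := UnitAddCircle.measurePreserving_mk 0
  rw [zero_add] at h
  rw [← h.measure_preimage ((measurable_cell n) (measurableSet_singleton k)).nullMeasurableSet,
    ← Measure.restrict_congr_set Ico_ae_eq_Ioc, Measure.restrict_apply (AddCircle.measurable_mk'
      ((measurable_cell n) (measurableSet_singleton k)))]
  have hk : ((k : ℕ) : ℝ) + 1 ≤ (m : ℝ) ^ n := by exact_mod_cast k.2
  have e : (fun s : ℝ => (s : UnitAddCircle)) ⁻¹' (cell m n ⁻¹' {k}) ∩ Ico 0 1 =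
      Ico ((k : ℕ) / (m : ℝ) ^ n) (((k : ℕ) + 1) / (m : ℝ) ^ n) := by
    ext s
    simp only [mem_inter_iff, mem_preimage, mem_singleton_iff, Fin.ext_iff, cell_val, fr_coe]
    constructor
    · rintro ⟨h1, h2⟩
      rw [Int.fract_eq_self.2 h2, Nat.floor_eq_iff (mul_nonneg hp.le h2.1)] at h1
      exact ⟨by rw [div_le_iff₀ hp]; linarith [h1.1], by rw [lt_div_iff₀ hp]; linarith [h1.2]⟩
    · rintro ⟨h1, h2⟩
      have h3 : 0 ≤ s := le_trans (by positivity) h1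
      have h4 : s < 1 := h2.trans_le ((div_le_one hp).2 hk)
      rw [div_le_iff₀ hp] at h1
      rw [lt_div_iff₀ hp] at h2
      refine ⟨?_, h3, h4⟩
      rw [Int.fract_eq_self.2 ⟨h3, h4⟩, Nat.floor_eq_iff (mul_nonneg hp.le h3)]
      constructor <;> linarith
  rw [e, Real.volume_Ico]
  congr 1
  field_simp
  ring

/-! ### Approximation by cells -/

/-- Of the `2N` common digits, `N` pay for the expansion by `m ^ N` and the other `N` leave a
distance of order `m ^ (-N)`; the plane part contributes `2 * lam ^ N`. Thus cells of the circle
alone locate the iterates in the whole torus. -/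
theorem eventually_dist_iterate_lt (H : IsAdmissible m lam η) {r : ℝ} (hr : 0 < r) :
    ∀ᶠ N : ℕ in atTop, ∀ x ∈ solidTorus, ∀ y ∈ solidTorus,
      cell m (N + N) x.1 = cell m (N + N) y.1 →
      dist ((solenoidMap m lam lam η)^[N] x) ((solenoidMap m lam lam η)^[N] y) < r := by
  have hm := H.two_le_real
  have h1 := tendsto_pow_atTop_nhds_zero_of_lt_one H.lam_pos.le H.lam_lt_one
  have h2 := tendsto_pow_atTop_nhds_zero_of_lt_one (r := (m : ℝ)⁻¹) (by positivity)
    (inv_lt_one_of_one_lt₀ (by linarith))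
  have h3 := (h1.const_mul 2).add (h2.const_mul (2 * Real.pi))
  rw [mul_zero, mul_zero, add_zero] at h3
  filter_upwards [h3.eventually (gt_mem_nhds hr)] with N hN x hx y hy hxy
  refine (dist_iterate_le H hx hy N).trans_lt (lt_of_le_of_lt ?_ hN)
  gcongr
  calc (m : ℝ) ^ N * ‖x.1 - y.1‖ ≤ (m : ℝ) ^ N * ((m : ℝ) ^ (N + N))⁻¹ := by
        gcongr
        exact norm_sub_le_of_cell_eq hxy
    _ = (m : ℝ)⁻¹ ^ N := by
        rw [pow_add, inv_pow]
        field_simp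

/-- Every closed set is approximated, after some iterates, by unions of cells. -/
theorem eventually_exists_cells (H : IsAdmissible m lam η) (C : Set Space) {r : ℝ} (hr : 0 < r) :
    ∀ᶠ N : ℕ in atTop, ∃ S : Set (Fin (m ^ (N + N))),
      (∀ x ∈ solidTorus, (solenoidMap m lam lam η)^[N] x ∈ C → cell m (N + N) x.1 ∈ S) ∧
      ∀ x ∈ solidTorus, cell m (N + N) x.1 ∈ S →
        (solenoidMap m lam lam η)^[N] x ∈ Metric.thickening r C := by
  filter_upwards [eventually_dist_iterate_lt H hr] with N hN
  refine ⟨{k | ∃ y ∈ solidTorus, (solenoidMap m lam lam η)^[N] y ∈ C ∧ cell m (N + N) y.1 = k},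
    fun x hx hxC => ⟨x, hx, hxC, rfl⟩, ?_⟩
  rintro x hx ⟨y, hy, hyC, hyk⟩
  exact Metric.mem_thickening_iff.2 ⟨_, hyC, hN x hx y hy hyk.symm⟩

theorem measurable_cell_fst (n : ℕ) : Measurable fun x : Space => cell m n x.1 :=
  (measurable_cell n).comp measurable_fst

/-- An invariant measure on the attractor is determined by the measures of the cells. -/
theorem eq_of_measure_cell_eq (H : IsAdmissible m lam η) {ν ν' : ProbabilityMeasure Space}
    (hν : IsInvariantOn (solenoidMap m lam lam η)
      (attractor (solenoidMap m lam lam η) openSolidTorus) ν)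
    (hν' : IsInvariantOn (solenoidMap m lam lam η)
      (attractor (solenoidMap m lam lam η) openSolidTorus) ν')
    (h : ∀ n k, (ν : Measure Space) ((fun x => cell m n x.1) ⁻¹' {k}) =
      (ν' : Measure Space) ((fun x => cell m n x.1) ⁻¹' {k})) : ν = ν' := by
  have hF : Measurable (solenoidMap m lam lam η) := (continuous_solenoidMap m lam η).measurable
  have hmap : ∀ n, (ν : Measure Space).map (fun x => cell m n x.1) =
      (ν' : Measure Space).map (fun x => cell m n x.1) := fun n =>
    Measure.ext_of_singleton fun k => by
      rw [Measure.map_apply (measurable_cell_fst n) (measurableSet_singleton k),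
        Measure.map_apply (measurable_cell_fst n) (measurableSet_singleton k), h]
  have key : ∀ {ν ν' : ProbabilityMeasure Space}, IsInvariantOn (solenoidMap m lam lam η)
      (attractor (solenoidMap m lam lam η) openSolidTorus) ν →
      IsInvariantOn (solenoidMap m lam lam η)
      (attractor (solenoidMap m lam lam η) openSolidTorus) ν' →
      (∀ n, (ν : Measure Space).map (fun x => cell m n x.1) =
        (ν' : Measure Space).map (fun x => cell m n x.1)) →
      ∀ C, IsClosed C → (ν : Measure Space) C ≤ (ν' : Measure Space) C := by
    intro ν ν' hν hν' hmap C hC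
    -- By invariance `ν C` is the measure of `F^(-N) C`. A union of cells, on which the two measures
    -- agree, separates this from the preimage of a thickening of `C`; then the thickening shrinks
    -- to `C`.
    have ht := tendsto_measure_thickening_of_isClosed (μ := (ν' : Measure Space)) (s := C)
      ⟨1, one_pos, measure_ne_top _ _⟩ hC
    refine ge_of_tendsto ht (eventually_mem_nhdsWithin.mono fun r hr => ?_)
    obtain ⟨N, S, hS1, hS2⟩ := (eventually_exists_cells H C (r := r) hr).exists
    have hcell : MeasurableSet S := S.toFinite.measurableSet
    calc (ν : Measure Space) C = (ν : Measure Space) ((solenoidMap m lam lam η)^[N] ⁻¹' C) :=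
          (((hν.measurePreserving hF).iterate N).measure_preimage
            hC.measurableSet.nullMeasurableSet).symm
      _ ≤ (ν : Measure Space) ((fun x => cell m (N + N) x.1) ⁻¹' S) :=
          measure_mono_ae (hν.ae_mem_solidTorus.mono fun x hx => hS1 x hx)
      _ = (ν' : Measure Space) ((fun x => cell m (N + N) x.1) ⁻¹' S) := by
          rw [← Measure.map_apply (measurable_cell_fst _) hcell, hmap,
            Measure.map_apply (measurable_cell_fst _) hcell]
      _ ≤ (ν' : Measure Space) ((solenoidMap m lam lam η)^[N] ⁻¹' Metric.thickening r C) :=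
          measure_mono_ae (hν'.ae_mem_solidTorus.mono fun x hx => hS2 x hx)
      _ = (ν' : Measure Space) (Metric.thickening r C) :=
          ((hν'.measurePreserving hF).iterate N).measure_preimage
            Metric.isOpen_thickening.measurableSet.nullMeasurableSet
  refine Subtype.ext (show (ν : Measure Space) = ν' from ?_)
  refine ext_of_generate_finite _ (BorelSpace.measurable_eq.trans borel_eq_generateFrom_isClosed)
    isPiSystem_isClosed (fun C hC => ?_) (by simp)
  exact (key hν hν' hmap C hC).antisymm (key hν' hν (fun n => (hmap n).symm) C hC)

/-- Every measurable set is approximated, after some iterates, by unions of cells. -/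
theorem eventually_exists_cells_symmDiff (H : IsAdmissible m lam η) {ν : ProbabilityMeasure Space}
    (hν : IsInvariantOn (solenoidMap m lam lam η)
      (attractor (solenoidMap m lam lam η) openSolidTorus) ν)
    {E : Set Space} (hE : MeasurableSet E) {δ : ℝ} (hδ : 0 < δ) :
    ∀ᶠ N : ℕ in atTop, ∃ S : Set (Fin (m ^ (N + N))),
      (ν : Measure Space).real (symmDiff ((solenoidMap m lam lam η)^[N] ⁻¹' E)
        ((fun x => cell m (N + N) x.1) ⁻¹' S)) < δ := by
  have hF : Measurable (solenoidMap m lam lam η) := (continuous_solenoidMap m lam η).measurable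
  have hδ' : ENNReal.ofReal (δ / 2) ≠ 0 := by simpa using hδ
  -- `E` is squeezed: the cells contain the preimage of `C ⊆ E` and lie in that of a thickening of
  -- `C`, so the error is covered by `E \ C` and the collar, each of measure below `δ / 2`.
  obtain ⟨C, hCE, hC, hlt⟩ := hE.exists_isClosed_sdiff_lt (μ := (ν : Measure Space))
    (measure_ne_top _ _) hδ'
  have ht := tendsto_measure_thickening_of_isClosed (μ := (ν : Measure Space)) (s := C)
    ⟨1, one_pos, measure_ne_top _ _⟩ hC
  have hlt' : (ν : Measure Space) C < (ν : Measure Space) C + ENNReal.ofReal (δ / 2) :=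
    ENNReal.lt_add_right (measure_ne_top _ _) hδ'
  obtain ⟨r, hr1, hr⟩ := ((ht.eventually (gt_mem_nhds hlt')).and
    self_mem_nhdsWithin).exists
  have hthick : (ν : Measure Space) (Metric.thickening r C \ C) < ENNReal.ofReal (δ / 2) := by
    rw [measure_sdiff (Metric.self_subset_thickening hr C) hC.measurableSet.nullMeasurableSet
      (measure_ne_top _ _)]
    exact ENNReal.sub_lt_of_lt_add (measure_mono (Metric.self_subset_thickening hr C))
      (by rwa [add_comm])
  filter_upwards [eventually_exists_cells H C hr] with N ⟨S, hS1, hS2⟩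
  refine ⟨S, ?_⟩
  have hpre : ∀ A : Set Space, MeasurableSet A → (ν : Measure Space)
      ((solenoidMap m lam lam η)^[N] ⁻¹' A) = (ν : Measure Space) A := fun A hA =>
    ((hν.measurePreserving hF).iterate N).measure_preimage hA.nullMeasurableSet
  rw [measureReal_def, ← ENNReal.toReal_ofReal hδ.le]
  refine (ENNReal.toReal_lt_toReal (measure_ne_top _ _) ENNReal.ofReal_ne_top).2 ?_
  calc (ν : Measure Space) (symmDiff ((solenoidMap m lam lam η)^[N] ⁻¹' E)
        ((fun x => cell m (N + N) x.1) ⁻¹' S))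
      ≤ (ν : Measure Space) (((solenoidMap m lam lam η)^[N] ⁻¹' (E \ C)) ∪
          ((solenoidMap m lam lam η)^[N] ⁻¹' (Metric.thickening r C \ C))) := by
        refine measure_mono_ae (hν.ae_mem_solidTorus.mono fun x hx => ?_)
        rintro (⟨h1, h2⟩ | ⟨h1, h2⟩)
        · exact Or.inl ⟨h1, fun h => h2 (hS1 x hx h)⟩
        · exact Or.inr ⟨hS2 x hx h1, fun h => h2 (hCE h)⟩
    _ ≤ (ν : Measure Space) (E \ C) + (ν : Measure Space) (Metric.thickening r C \ C) := by
        refine (measure_union_le _ _).trans_eq ?_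
        rw [hpre _ (hE.diff hC.measurableSet),
          hpre _ (Metric.isOpen_thickening.measurableSet.diff hC.measurableSet)]
    _ < ENNReal.ofReal (δ / 2) + ENNReal.ofReal (δ / 2) := ENNReal.add_lt_add hlt hthick
    _ = ENNReal.ofReal δ := by
        rw [← ENNReal.ofReal_add (by positivity) (by positivity), add_halves]

end

section

variable {m : ℕ} {lam η : ℝ}

/-! ### The measure of maximal entropy -/

theorem fin_pow_zero_eq {q : ℕ} (hq : q = 0) (a b : Fin (m ^ q)) : a = b := by
  subst hq
  have h : Subsingleton (Fin (m ^ 0)) := by rw [pow_zero]; infer_instance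
  exact h.elim a b

/-- The image of Haar measure on the attractor. -/
def solenoidMeasure (H : IsAdmissible m lam η) : ProbabilityMeasure Space :=
  ⟨(haar m).map (embed m lam η),
    Measure.isProbabilityMeasure_map (continuous_embed H).measurable.aemeasurable⟩

theorem coe_solenoidMeasure (H : IsAdmissible m lam η) :
    (solenoidMeasure H : Measure Space) = (haar m).map (embed m lam η) := rfl

theorem isInvariantOn_solenoidMeasure (H : IsAdmissible m lam η)
    (hinj : InjOn (solenoidMap m lam lam η) solidTorus) :
    IsInvariantOn (solenoidMap m lam lam η)
      (attractor (solenoidMap m lam lam η) openSolidTorus) (solenoidMeasure H) := by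
  have hc := (continuous_embed H).measurable
  have hF : Measurable (solenoidMap m lam lam η) := (continuous_solenoidMap m lam η).measurable
  rw [← range_embed H hinj]
  refine ⟨?_, ?_⟩
  · rw [coe_solenoidMeasure,
      Measure.map_apply hc (isClosedEmbedding_embed H hinj).isClosed_range.measurableSet.compl]
    simp
  · have e : solenoidMap m lam lam η ∘ embed m lam η = embed m lam η ∘ fun t => m • t :=
      funext fun t => solenoidMap_embed H t
    rw [coe_solenoidMeasure, Measure.map_map hF hc, e,
      ← Measure.map_map hc measurePreserving_nsmul_haar.measurable,
      measurePreserving_nsmul_haar.map_eq]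

variable [NeZero m]

theorem partitionEntropy_eq_shannon (f : Space → Space) (μ : ProbabilityMeasure Space) {k : ℕ}
    (ξ : Space → Fin k) (n : ℕ) :
    partitionEntropy f μ ξ n =
      shannon (μ : Measure Space) fun x (i : Fin n) => ξ (f^[i] x) := by
  refine Finset.sum_congr rfl fun w _ => ?_
  congr 2
  ext x
  simp [funext_iff]

theorem cell_le_of_eq {a b : ℕ} (hab : a ≤ b) {t u : UnitAddCircle}
    (h : cell m b t = cell m b u) : cell m a t = cell m a u := by
  obtain ⟨k, rfl⟩ := Nat.exists_eq_add_of_le hab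
  exact (cell_add_eq_iff.1 h).1

/-- A cell of order `p * (j + 1)` is a cell of order `p * j` together with the `p`-cell of a later
iterate; invariance and subadditivity do the rest. -/
theorem shannon_cell_mul_le {ν : ProbabilityMeasure Space}
    (hν : MeasurePreserving (solenoidMap m lam lam η) (ν : Measure Space) ν) (p j : ℕ) :
    shannon (ν : Measure Space) (fun x => cell m (p * j) x.1) ≤
      j * shannon (ν : Measure Space) fun x => cell m p x.1 := by
  induction j with
  | zero =>
    have h : ∀ a, (fun x : Space => cell m (p * 0) x.1) ⁻¹' {a} = univ := fun a =>
      eq_univ_of_forall fun x => fin_pow_zero_eq (mul_zero p) _ _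
    simp only [shannon, h, probReal_univ, Real.negMulLog_one, Finset.sum_const_zero]
    simp
  | succ j ih =>
    have hc := measurable_cell_fst (m := m) p
    calc shannon (ν : Measure Space) (fun x => cell m (p * (j + 1)) x.1)
        ≤ shannon (ν : Measure Space) fun x => (cell m (p * j) x.1,
            ((fun x : Space => cell m p x.1) ∘ (solenoidMap m lam lam η)^[p * j]) x) := by
          refine shannon_le_of_determined _ (measurable_cell_fst _) ((measurable_cell_fst _).prodMk
            (hc.comp (hν.iterate _).measurable)) fun x y h => ?_
          simp only [Prod.ext_iff, Function.comp_apply, iterate_solenoidMap_fst] at h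
          rw [mul_add, mul_one]
          exact cell_add_eq_iff.2 h
      _ ≤ _ := shannon_prodMk_le _ (measurable_cell_fst _) (hc.comp (hν.iterate _).measurable)
      _ ≤ j * shannon (ν : Measure Space) (fun x => cell m p x.1) +
          shannon (ν : Measure Space) fun x => cell m p x.1 :=
          add_le_add ih (shannon_comp_measurePreserving (hν.iterate _) hc).le
      _ = _ := by push_cast; ring

theorem shannon_cell_le {ν : ProbabilityMeasure Space}
    (hν : MeasurePreserving (solenoidMap m lam lam η) (ν : Measure Space) ν) {p : ℕ} (hp : 0 < p)
    (q : ℕ) : shannon (ν : Measure Space) (fun x => cell m q x.1) ≤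
      (q / p + 1) * shannon (ν : Measure Space) fun x => cell m p x.1 := by
  have h1 : q ≤ p * (q / p + 1) := by
    have := Nat.div_add_mod q p
    have := Nat.mod_lt q hp
    rw [mul_add]
    omega
  refine (shannon_le_of_determined _ (measurable_cell_fst q) (measurable_cell_fst _)
    fun x y h => cell_le_of_eq h1 h).trans ((shannon_cell_mul_le hν p _).trans ?_)
  refine mul_le_mul_of_nonneg_right ?_ (shannon_nonneg _ _)
  push_cast
  gcongr
  exact Nat.cast_div_le

-- The atoms of `ξ` pulled back by `F^N` are approximated by unions of cells of order `2N`, with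
-- error flags `D`. The `(2N + n)`-cell of `x` and the flags along its orbit determine the
-- `ξ`-itinerary of `F^N x`. There are `n * k` flags of entropy at most `ε / (k + 1)`, the
-- denominator being safe for `k = 0`.
open Classical in
theorem partitionEntropy_le (H : IsAdmissible m lam η) {ν : ProbabilityMeasure Space}
    (hν : IsInvariantOn (solenoidMap m lam lam η)
      (attractor (solenoidMap m lam lam η) openSolidTorus) ν) {k : ℕ} {ξ : Space → Fin k}
    (hξ : Measurable ξ) {ε : ℝ} (hε : 0 < ε) :
    ∃ M : ℕ, ∀ n : ℕ, partitionEntropy (solenoidMap m lam lam η) ν ξ n ≤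
      shannon (ν : Measure Space) (fun x => cell m (M + n) x.1) + n * ε := by
  set F := solenoidMap m lam lam η
  have hF : Measurable F := (continuous_solenoidMap m lam η).measurable
  have hmp : MeasurePreserving F (ν : Measure Space) ν := hν.measurePreserving hF
  obtain ⟨δ, hδ, hsmall⟩ := shannon_indicator_lt (ν : Measure Space)
    (show 0 < ε / (k + 1) by positivity)
  have hev : ∀ᶠ N : ℕ in atTop, ∀ a : Fin k, ∃ S : Set (Fin (m ^ (N + N))),
      (ν : Measure Space).real (symmDiff (F^[N] ⁻¹' (ξ ⁻¹' {a}))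
        ((fun x => cell m (N + N) x.1) ⁻¹' S)) < δ :=
    eventually_all.2 fun a =>
      eventually_exists_cells_symmDiff H hν (hξ (measurableSet_singleton a)) hδ
  obtain ⟨N, hN⟩ := hev.exists
  choose S hS using hN
  set D : Fin k → Space → Bool := fun a x => decide (x ∈ symmDiff (F^[N] ⁻¹' (ξ ⁻¹' {a}))
    ((fun x => cell m (N + N) x.1) ⁻¹' (S a)))
  have hDpre : ∀ a, D a ⁻¹' {true} = symmDiff (F^[N] ⁻¹' (ξ ⁻¹' {a}))
      ((fun x => cell m (N + N) x.1) ⁻¹' (S a)) := fun a => by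
    ext x; simp [D]
  have hD : ∀ a, Measurable (D a) := fun a => by
    refine measurable_to_bool ?_
    rw [hDpre]
    exact (hF.iterate N (hξ (measurableSet_singleton a))).symmDiff
      (measurable_cell_fst _ (S a).toFinite.measurableSet)
  have hDs : ∀ a, shannon (ν : Measure Space) (D a) ≤ ε / (k + 1) := fun a =>
    (hsmall _ (hD a) (by rw [hDpre]; exact hS a)).le
  refine ⟨N + N, fun n => ?_⟩
  set X : Space → (Fin n → Fin k) := fun x i => ξ (F^[i] x)
  set Y : Space → Fin (m ^ (N + N + n)) := fun x => cell m (N + N + n) x.1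
  set Z : Space → (Fin n → Fin k → Bool) := fun x i a => D a (F^[i] x)
  have hX : Measurable X := measurable_pi_lambda _ fun i => hξ.comp (hF.iterate _)
  have hY : Measurable Y := measurable_cell_fst _
  have hZi : ∀ i : Fin n, Measurable fun x (a : Fin k) => D a (F^[i] x) := fun i =>
    measurable_pi_lambda _ fun a => (hD a).comp (hF.iterate _)
  have hZ : Measurable Z := measurable_pi_lambda _ hZi
  have hdet : ∀ x y, (Y x, Z x) = (Y y, Z y) → (X ∘ F^[N]) x = (X ∘ F^[N]) y := by
    intro x y h
    obtain ⟨hYxy, hZxy⟩ := Prod.ext_iff.1 h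
    funext i
    have hcell : cell m (N + N) (F^[i] x).1 = cell m (N + N) (F^[i] y).1 := by
      have e : N + N + n = i + (N + N + (n - i)) := by omega
      have hYxy' : cell m (N + N + n) x.1 = cell m (N + N + n) y.1 := hYxy
      rw [e] at hYxy'
      rw [iterate_solenoidMap_fst, iterate_solenoidMap_fst]
      exact cell_le_of_eq (Nat.le_add_right _ _) (cell_add_eq_iff.1 hYxy').2
    have hmem : ∀ a, ξ (F^[N] (F^[i] x)) = a ↔ ξ (F^[N] (F^[i] y)) = a := by
      intro a
      have h1 : D a (F^[i] x) = D a (F^[i] y) := congrFun (congrFun hZxy i) a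
      simp only [D, decide_eq_decide, mem_symmDiff, mem_preimage, mem_singleton_iff, hcell] at h1
      tauto
    change ξ (F^[i] (F^[N] x)) = ξ (F^[i] (F^[N] y))
    rw [← Function.iterate_add_apply, ← Function.iterate_add_apply, add_comm,
      Function.iterate_add_apply, Function.iterate_add_apply]
    exact ((hmem _).1 rfl).symm
  rw [partitionEntropy_eq_shannon]
  calc shannon (ν : Measure Space) X = shannon (ν : Measure Space) (X ∘ F^[N]) :=
        (shannon_comp_measurePreserving (hmp.iterate N) hX).symm
    _ ≤ shannon (ν : Measure Space) fun x => (Y x, Z x) :=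
        shannon_le_of_determined _ (hX.comp (hF.iterate N)) (hY.prodMk hZ) hdet
    _ ≤ shannon (ν : Measure Space) Y + shannon (ν : Measure Space) Z :=
        shannon_prodMk_le _ hY hZ
    _ ≤ shannon (ν : Measure Space) Y + n * ε := by
        gcongr
        calc shannon (ν : Measure Space) Z
            ≤ ∑ i : Fin n, shannon (ν : Measure Space) fun x (a : Fin k) => D a (F^[i] x) :=
              shannon_pi_le _ n hZi
          _ ≤ ∑ i : Fin n, ∑ a : Fin k, shannon (ν : Measure Space) (D a ∘ F^[i]) :=
              Finset.sum_le_sum fun i _ => shannon_pi_le _ k fun a => (hD a).comp (hF.iterate _)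
          _ ≤ ∑ i : Fin n, ∑ a : Fin k, ε / (k + 1) :=
              Finset.sum_le_sum fun i _ => Finset.sum_le_sum fun a _ =>
                (shannon_comp_measurePreserving (hmp.iterate _) (hD a)).trans_le (hDs a)
          _ = n * (ε * (k / (k + 1))) := by
              simp only [Finset.sum_const, Finset.card_univ, Fintype.card_fin, nsmul_eq_mul]
              ring
          _ ≤ n * (ε * 1) := by
              gcongr
              rw [div_le_one (by positivity)]
              linarith
          _ = n * ε := by rw [mul_one]

/-- The entropy of an invariant measure is at most the normalised entropy of each of the
partitions into cells. -/
theorem entropy_le (H : IsAdmissible m lam η) {ν : ProbabilityMeasure Space}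
    (hν : IsInvariantOn (solenoidMap m lam lam η)
      (attractor (solenoidMap m lam lam η) openSolidTorus) ν) {p : ℕ} (hp : 0 < p) :
    entropy (solenoidMap m lam lam η) ν ≤
      ((shannon (ν : Measure Space) (fun x => cell m p x.1) / p : ℝ) : EReal) := by
  set F := solenoidMap m lam lam η
  have hF : Measurable F := (continuous_solenoidMap m lam η).measurable
  set h := shannon (ν : Measure Space) (fun x => cell m p x.1)
  have hp' : (p : ℝ) ≠ 0 := Nat.cast_ne_zero.2 hp.ne'
  refine iSup_le fun k => iSup_le fun ξ => iSup_le fun hξ => ?_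
  have key : ∀ ε : ℝ, 0 < ε → limsup (fun n : ℕ => ((partitionEntropy F ν ξ n / n : ℝ) : EReal))
      atTop ≤ ((h / p + ε : ℝ) : EReal) := by
    intro ε hε
    obtain ⟨M, hM⟩ := partitionEntropy_le H hν hξ hε
    -- This is `((M + n) / p + 1) * h + n * ε` divided by `n`; the offset `M` and the rounding up to
    -- a multiple of `p` disappear in the limit.
    have ht : Tendsto (fun n : ℕ => h / p + ε + (M / p + 1) * h / (n : ℝ)) atTop
        (𝓝 (h / p + ε + 0)) :=
      tendsto_const_nhds.add (tendsto_const_div_atTop_nhds_zero_nat _)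
    rw [add_zero] at ht
    refine (limsup_le_limsup ?_).trans_eq
      ((continuous_coe_real_ereal.tendsto _).comp ht).limsup_eq
    filter_upwards [eventually_gt_atTop 0] with n hn
    have hn' : (0 : ℝ) < n := Nat.cast_pos.2 hn
    refine EReal.coe_le_coe_iff.2 ?_
    rw [div_le_iff₀ hn']
    refine (hM n).trans ((add_le_add_left (shannon_cell_le (hν.measurePreserving hF) hp _) _).trans
      (le_of_eq ?_))
    push_cast
    field_simp
    ring
  have ht : Tendsto (fun j : ℕ => ((h / p + 1 / ((j : ℝ) + 1) : ℝ) : EReal)) atTop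
      (𝓝 ((h / p + 0 : ℝ) : EReal)) :=
    (continuous_coe_real_ereal.tendsto _).comp
      (tendsto_const_nhds.add tendsto_one_div_add_atTop_nhds_zero_nat)
  rw [add_zero] at ht
  exact ge_of_tendsto' ht fun j => key _ (by positivity)

theorem word_determines_cell (n : ℕ) {x y : Space}
    (h : ∀ i < n, cell m 1 ((solenoidMap m lam lam η)^[i] x).1 =
      cell m 1 ((solenoidMap m lam lam η)^[i] y).1) : cell m n x.1 = cell m n y.1 := by
  induction n with
  | zero => exact fin_pow_zero_eq rfl _ _
  | succ n ih =>
    refine cell_add_eq_iff.2 ⟨ih fun i hi => h i (by omega), ?_⟩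
    have := h n (by omega)
    rwa [iterate_solenoidMap_fst, iterate_solenoidMap_fst] at this

/-- The partition by the first digit suffices: its `n`-th refinement determines the `n`-cell, whose
entropy is `n * log m`. -/
theorem le_entropy_of_uniform {ν : ProbabilityMeasure Space}
    (h : ∀ n k, (ν : Measure Space).real ((fun x => cell m n x.1) ⁻¹' {k}) =
      (Fintype.card (Fin (m ^ n)) : ℝ)⁻¹) :
    ((Real.log m : ℝ) : EReal) ≤ entropy (solenoidMap m lam lam η) ν := by
  have hF : Measurable (solenoidMap m lam lam η) := (continuous_solenoidMap m lam η).measurable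
  have hc := measurable_cell_fst (m := m) 1
  refine le_trans ?_ (le_iSup_of_le (m ^ 1) (le_iSup_of_le (fun x => cell m 1 x.1)
    (le_iSup_of_le hc le_rfl)))
  refine le_limsup_of_frequently_le (Eventually.frequently ?_) (by isBoundedDefault)
  filter_upwards [eventually_gt_atTop 0] with n hn
  have hn' : (0 : ℝ) < n := Nat.cast_pos.2 hn
  refine EReal.coe_le_coe_iff.2 ?_
  rw [le_div_iff₀ hn', partitionEntropy_eq_shannon]
  calc Real.log m * n = shannon (ν : Measure Space) fun x => cell m n x.1 := by
        rw [shannon_of_uniform _ (h n), Fintype.card_fin]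
        push_cast
        rw [Real.log_pow, mul_comm]
    _ ≤ _ := shannon_le_of_determined _ (measurable_cell_fst n)
        (measurable_pi_lambda (fun x (i : Fin n) => cell m 1 ((solenoidMap m lam lam η)^[i] x).1)
          fun i => hc.comp (hF.iterate _)) fun x y h =>
        word_determines_cell (lam := lam) (η := η) n fun i hi => congrFun h ⟨i, hi⟩

/-- `entropy_le` holds for each `n`, so entropy at least `log m` forces the `n`-cells to have the
maximal Shannon entropy `n * log m`. -/
theorem uniform_of_le_entropy (H : IsAdmissible m lam η) {ν : ProbabilityMeasure Space}
    (hν : IsInvariantOn (solenoidMap m lam lam η)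
      (attractor (solenoidMap m lam lam η) openSolidTorus) ν)
    (h : ((Real.log m : ℝ) : EReal) ≤ entropy (solenoidMap m lam lam η) ν) {n : ℕ} (hn : 0 < n)
    (k : Fin (m ^ n)) : (ν : Measure Space).real ((fun x => cell m n x.1) ⁻¹' {k}) =
      (Fintype.card (Fin (m ^ n)) : ℝ)⁻¹ := by
  refine eq_uniform_of_log_card_le_shannon _ (measurable_cell_fst n) ?_ k
  have h1 := EReal.coe_le_coe_iff.1 (h.trans (entropy_le H hν hn))
  rw [le_div_iff₀ (Nat.cast_pos.2 hn)] at h1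
  rw [Fintype.card_fin]
  push_cast
  rw [Real.log_pow, mul_comm]
  exact h1

theorem map_fst_solenoidMeasure (H : IsAdmissible m lam η) :
    (solenoidMeasure H : Measure Space).map Prod.fst = (volume : Measure UnitAddCircle) := by
  rw [coe_solenoidMeasure, Measure.map_map measurable_fst (continuous_embed H).measurable]
  exact measurePreserving_val_zero.map_eq

theorem solenoidMeasure_cell (H : IsAdmissible m lam η) (n : ℕ) (k : Fin (m ^ n)) :
    (solenoidMeasure H : Measure Space) ((fun x => cell m n x.1) ⁻¹' {k}) =
      ENNReal.ofReal ((m : ℝ) ^ n)⁻¹ := by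
  rw [← volume_cell, ← map_fst_solenoidMeasure H, Measure.map_apply measurable_fst
    (measurable_cell n (measurableSet_singleton k))]
  rfl

theorem solenoidMeasure_real_cell (H : IsAdmissible m lam η) (n : ℕ) (k : Fin (m ^ n)) :
    (solenoidMeasure H : Measure Space).real ((fun x => cell m n x.1) ⁻¹' {k}) =
      (Fintype.card (Fin (m ^ n)) : ℝ)⁻¹ := by
  rw [measureReal_def, solenoidMeasure_cell, ENNReal.toReal_ofReal (by positivity)]
  simp

theorem isMaximalEntropy_iff (H : IsAdmissible m lam η)
    (hinj : InjOn (solenoidMap m lam lam η) solidTorus) (ν : ProbabilityMeasure Space) :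
    IsMaximalEntropy (solenoidMap m lam lam η)
      (attractor (solenoidMap m lam lam η) openSolidTorus) ν ↔ ν = solenoidMeasure H := by
  have hinv := isInvariantOn_solenoidMeasure H hinj
  have hlow := le_entropy_of_uniform (lam := lam) (η := η) (solenoidMeasure_real_cell H)
  constructor
  · rintro ⟨hν, hmax⟩
    refine eq_of_measure_cell_eq H hν hinv fun n k => ?_
    rcases Nat.eq_zero_or_pos n with rfl | hn
    · have h : (fun x : Space => cell m 0 x.1) ⁻¹' {k} = univ :=
        eq_univ_of_forall fun x => fin_pow_zero_eq rfl _ _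
      rw [h, measure_univ, measure_univ]
    · rw [← ENNReal.toReal_eq_toReal_iff' (measure_ne_top _ _) (measure_ne_top _ _)]
      exact (uniform_of_le_entropy H hν (hlow.trans (hmax _ hinv)) hn k).trans
        (solenoidMeasure_real_cell H n k).symm
  · rintro rfl
    refine ⟨hinv, fun ν hν => (entropy_le H hν one_pos).trans (le_trans ?_ hlow)⟩
    refine EReal.coe_le_coe_iff.2 ?_
    rw [Nat.cast_one, div_one]
    -- A Shannon entropy above `log m` would make the `m` cells uniform, and then it equals `log m`.
    by_contra! hlt
    have hcard : Real.log (Fintype.card (Fin (m ^ 1))) = Real.log m := by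
      rw [Fintype.card_fin, pow_one]
    have hu := shannon_of_uniform (ν : Measure Space) (eq_uniform_of_log_card_le_shannon _
      (measurable_cell_fst (m := m) 1) (hcard.trans_le hlt.le))
    rw [hu, hcard] at hlt
    exact lt_irrefl _ hlt

end

section

variable {m : ℕ} {lam η : ℝ}

/-! ### Lyapunov exponents -/

theorem tendsto_log_div_of_le {x : ℕ → ℝ} {a b r : ℝ} (ha : 0 < a) (hr : 0 < r)
    (h1 : ∀ n, a * r ^ n ≤ x n) (h2 : ∀ n, x n ≤ b * r ^ n) :
    Tendsto (fun n : ℕ => Real.log (x n) / n) atTop (𝓝 (Real.log r)) := by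
  have hb : 0 < b := by
    have := (h1 0).trans (h2 0)
    simp only [pow_zero, mul_one] at this
    linarith
  have hx : ∀ n, 0 < x n := fun n => lt_of_lt_of_le (by positivity) (h1 n)
  have key : ∀ c, 0 < c → Tendsto (fun n : ℕ => Real.log (c * r ^ n) / n) atTop
      (𝓝 (Real.log r)) := by
    intro c hc
    have h := (tendsto_const_div_atTop_nhds_zero_nat (Real.log c)).add_const (Real.log r)
    rw [zero_add] at h
    refine h.congr' ?_
    filter_upwards [eventually_gt_atTop 0] with n hn
    have : (n : ℝ) ≠ 0 := Nat.cast_ne_zero.2 hn.ne'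
    rw [Real.log_mul hc.ne' (by positivity), Real.log_pow]
    field_simp
  refine tendsto_of_tendsto_of_tendsto_of_le_of_le (key a ha) (key b hb) (fun n => ?_) fun n => ?_
  · have := Real.log_le_log (by positivity) (h1 n)
    simp only
    gcongr
  · have := Real.log_le_log (hx n) (h2 n)
    simp only
    gcongr

theorem iterDifferential_fst (m : ℕ) (lam η : ℝ) (x : Space) (v : Tan) (n : ℕ) :
    (iterDifferential (solenoidMap m lam lam η) x n v).1 = m ^ n * v.1 := by
  induction n with
  | zero => simp [iterDifferential]
  | succ n ih =>
    rw [iterDifferential, ContinuousLinearMap.comp_apply, differential_solenoidMap_apply, ih,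
      pow_succ]
    ring

/-- Vertical vectors contract exactly by `lam`. Any other vector has first component `m ^ n * v.1`,
and its plane component grows no faster than `m ^ n` since `lam + η < m`. The exponents are `log
lam` and `log m` at every point. -/
theorem exists_lyapunov (H : IsAdmissible m lam η) (x : Space) {v : Tan} (hv : v ≠ 0) :
    ∃ χ : ℝ, χ ≠ 0 ∧ Tendsto (fun n : ℕ => Real.log
      ‖iterDifferential (solenoidMap m lam lam η) x n v‖ / n) atTop (𝓝 χ) := by
  have hm := H.two_le_real
  have hl := H.lam_pos
  by_cases h : v.1 = 0
  · have h2 : v.2 ≠ 0 := fun h2 => hv (Prod.ext h h2)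
    have key : ∀ n, iterDifferential (solenoidMap m lam lam η) x n v = (0, lam ^ n • v.2) := by
      intro n
      induction n with
      | zero => exact Prod.ext h (by simp [iterDifferential])
      | succ n ih =>
        rw [iterDifferential, ContinuousLinearMap.comp_apply, differential_solenoidMap_apply, ih]
        simp [smul_smul, pow_succ']
    have hnorm : ∀ n, ‖iterDifferential (solenoidMap m lam lam η) x n v‖ = ‖v.2‖ * lam ^ n := by
      intro n
      rw [key, Prod.norm_mk, norm_zero, max_eq_right (norm_nonneg _), norm_smul,
        Real.norm_of_nonneg (by positivity), mul_comm]
    exact ⟨Real.log lam, (Real.log_neg hl H.lam_lt_one).ne,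
      tendsto_log_div_of_le (norm_pos_iff.2 h2) hl (fun n => (hnorm n).ge) fun n => (hnorm n).le⟩
  · have hupper : ∀ n, ‖(iterDifferential (solenoidMap m lam lam η) x n v).2‖ ≤
        2 * Real.pi * ‖v‖ * m ^ n := by
      intro n
      induction n with
      | zero =>
        have h1 : ‖v.2‖ ≤ ‖v‖ := norm_snd_le v
        simp only [iterDifferential, ContinuousLinearMap.coe_id', id_eq, pow_zero, mul_one]
        nlinarith [Real.pi_gt_three, norm_nonneg v]
      | succ n ih =>
        rw [iterDifferential, ContinuousLinearMap.comp_apply, differential_solenoidMap_apply,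
          iterDifferential_fst]
        refine (norm_add_le _ _).trans ?_
        rw [norm_smul, norm_smul, norm_smul, norm_dcirc, Real.norm_of_nonneg hl.le,
          Real.norm_of_nonneg H.η_pos.le, norm_mul,
          Real.norm_of_nonneg (show (0 : ℝ) ≤ (m : ℝ) ^ n by positivity)]
        have h1 : ‖v.1‖ ≤ ‖v‖ := norm_fst_le v
        calc lam * ‖(iterDifferential (solenoidMap m lam lam η) x n v).2‖ +
              (m : ℝ) ^ n * ‖v.1‖ * (η * (2 * Real.pi))
            ≤ lam * (2 * Real.pi * ‖v‖ * m ^ n) + (m : ℝ) ^ n * ‖v‖ * (η * (2 * Real.pi)) := by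
              have := H.η_pos
              gcongr
          _ = (lam + η) * (2 * Real.pi * ‖v‖ * m ^ n) := by ring
          _ ≤ m * (2 * Real.pi * ‖v‖ * m ^ n) := by
              gcongr
              linarith [H.add_lt]
          _ = 2 * Real.pi * ‖v‖ * m ^ (n + 1) := by ring
    refine ⟨Real.log m, (Real.log_pos (by linarith)).ne', tendsto_log_div_of_le (a := ‖v.1‖)
      (b := 2 * Real.pi * ‖v‖) (norm_pos_iff.2 h) (by linarith) (fun n => ?_) fun n => ?_⟩
    · refine le_trans (le_of_eq ?_) (norm_fst_le _)
      rw [iterDifferential_fst, norm_mul,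
        Real.norm_of_nonneg (show (0 : ℝ) ≤ (m : ℝ) ^ n by positivity), mul_comm]
    · rw [Prod.norm_def]
      refine max_le ?_ (hupper n)
      rw [iterDifferential_fst, norm_mul,
        Real.norm_of_nonneg (show (0 : ℝ) ≤ (m : ℝ) ^ n by positivity), mul_comm]
      gcongr
      have h1 : ‖v.1‖ ≤ ‖v‖ := norm_fst_le v
      nlinarith [Real.pi_gt_three, norm_nonneg v]

/-! ### Unstable leaves -/

theorem norm_sub_val_le_dist (t u : Sol m) :
    ‖(u - t).1 0‖ ≤ dist (embed m lam η t) (embed m lam η u) := by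
  rw [dist_comm, dist_eq_norm]
  exact norm_fst_le (embed m lam η u - embed m lam η t)

theorem shift_iterate_sub_val (t u : Sol m) (n : ℕ) :
    (shift^[n] u - shift^[n] t).1 0 = (u - t).1 n := by
  change (shift^[n] u).1 0 - (shift^[n] t).1 0 = u.1 n - t.1 n
  rw [shift_iterate_val, shift_iterate_val, zero_add]

variable [NeZero m]

/-- Every coordinate moves by at most `|s - s'|`, and the weights `lam ^ n * η` of the series add up
to `η / (1 - lam) ≤ 1`. -/
theorem dist_embed_flow_le (H : IsAdmissible m lam η) (t : Sol m) (s s' : ℝ) :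
    dist (embed m lam η (t + flow m s)) (embed m lam η (t + flow m s')) ≤
      2 * Real.pi * |s - s'| := by
  have hl := H.lam_pos
  have hm : (1 : ℝ) ≤ m := by linarith [H.two_le_real]
  have hcoord : ∀ n, ‖(t + flow m s).1 n - (t + flow m s').1 n‖ ≤ |s - s'| := by
    intro n
    change ‖(t.1 n + (flow m s).1 n) - (t.1 n + (flow m s').1 n)‖ ≤ _
    rw [add_sub_add_left_eq_sub, flow_val, flow_val, ← AddCircle.coe_sub, ← sub_div]
    refine (norm_coe_le _).trans ?_
    rw [abs_div, abs_of_pos (show (0 : ℝ) < (m : ℝ) ^ n by positivity)]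
    exact div_le_self (abs_nonneg _) (one_le_pow₀ hm)
  rw [dist_eq_norm, Prod.norm_def]
  refine max_le ((hcoord 0).trans ?_) ?_
  · nlinarith [Real.pi_gt_three, abs_nonneg (s - s')]
  · simp only [embed, Prod.snd_sub]
    rw [← (summable_embed H _).tsum_sub (summable_embed H _)]
    refine (tsum_of_norm_bounded (g := fun n => lam ^ n * (η * (2 * Real.pi * |s - s'|)))
      (summable_pow_mul H _).hasSum fun n => ?_).trans ?_
    · rw [← smul_sub, norm_smul, Real.norm_of_nonneg (by have := H.η_pos; positivity), mul_assoc]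
      have := H.η_pos
      gcongr
      exact (norm_circ_sub_le _ _).trans (by gcongr; exact hcoord _)
    · rw [tsum_mul_right, tsum_geometric_of_lt_one hl.le H.lam_lt_one, ← mul_assoc]
      refine mul_le_of_le_one_left (by positivity) ?_
      rw [inv_mul_eq_div, div_le_one] <;> linarith [H.add_lt, H.lam_lt_one]

theorem shift_iterate_add_flow (t : Sol m) (s : ℝ) (n : ℕ) :
    shift^[n] (t + flow m s) = shift^[n] t + flow m (s / m ^ n) := by
  refine Subtype.ext (funext fun k => ?_)
  change _ = (shift^[n] t).1 k + (flow m (s / m ^ n)).1 k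
  rw [shift_iterate_val, shift_iterate_val, flow_val, div_div, ← pow_add, add_comm n k]
  rfl

/-- Backward orbits are the shifts. If they are asymptotic, the coordinates of `u - t` tend to zero
and `u - t` lies on the one-parameter subgroup; conversely the shift divides flow time by `m`. -/
theorem unstableSet_embed (H : IsAdmissible m lam η)
    (hinj : InjOn (solenoidMap m lam lam η) solidTorus) (t : Sol m) :
    unstableSet (solenoidMap m lam lam η)
      (attractor (solenoidMap m lam lam η) openSolidTorus) (embed m lam η t) =
      range fun s => embed m lam η (t + flow m s) := by
  ext y
  constructor
  · rintro ⟨X, Y, hX, hY, hXY⟩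
    have hy : y ∈ range (embed m lam η) := by
      rw [range_embed H hinj, ← hY.1]
      exact (hY.2 0).1
    obtain ⟨u, rfl⟩ := hy
    rw [isBackwardOrbit_iff H hinj] at hX hY
    obtain ⟨s, hs⟩ := exists_eq_flow_of_tendsto (d := u - t) (squeeze_zero (fun n => norm_nonneg _)
      (fun n => by
        have h := norm_sub_val_le_dist (lam := lam) (η := η) (shift^[n] t) (shift^[n] u)
        rwa [shift_iterate_sub_val, ← hX, ← hY] at h) hXY)
    exact ⟨s, by simp only [← hs, add_sub_cancel]⟩
  · rintro ⟨s, rfl⟩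
    refine ⟨fun n => embed m lam η (shift^[n] t), fun n => embed m lam η (shift^[n] (t + flow m s)),
      (isBackwardOrbit_iff H hinj _ _).2 fun n => rfl,
      (isBackwardOrbit_iff H hinj _ _).2 fun n => rfl, ?_⟩
    have hm : (1 : ℝ) < m := by linarith [H.two_le_real]
    have h1 : Tendsto (fun n : ℕ => 2 * Real.pi * |s| / (m : ℝ) ^ n) atTop (𝓝 0) :=
      tendsto_const_nhds.div_atTop (tendsto_pow_atTop_atTop_of_one_lt hm)
    refine squeeze_zero (fun n => dist_nonneg) (fun n => ?_) h1
    have h2 := dist_embed_flow_le H (shift^[n] t) 0 (s / m ^ n)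
    rw [flow_zero, add_zero, ← shift_iterate_add_flow, zero_sub, abs_neg, abs_div, abs_pow,
      Nat.abs_cast, ← mul_div_assoc] at h2
    exact h2

theorem embed_flow_mem_localUnstableSet (H : IsAdmissible m lam η)
    (hinj : InjOn (solenoidMap m lam lam η) solidTorus) (t : Sol m) {s r : ℝ}
    (hs : 2 * Real.pi * |s| ≤ r) : embed m lam η (t + flow m s) ∈
      localUnstableSet (solenoidMap m lam lam η)
        (attractor (solenoidMap m lam lam η) openSolidTorus) r (embed m lam η t) := by
  refine ⟨fun n => embed m lam η (shift^[n] t), fun n => embed m lam η (shift^[n] (t + flow m s)),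
    (isBackwardOrbit_iff H hinj _ _).2 fun n => rfl,
    (isBackwardOrbit_iff H hinj _ _).2 fun n => rfl, fun n => ?_⟩
  have hm : (1 : ℝ) ≤ m := by linarith [H.two_le_real]
  have h2 := dist_embed_flow_le H (shift^[n] t) 0 (s / m ^ n)
  rw [flow_zero, add_zero, ← shift_iterate_add_flow, zero_sub, abs_neg, abs_div, abs_pow,
    Nat.abs_cast, ← mul_div_assoc] at h2
  exact h2.trans ((div_le_self (by positivity) (one_le_pow₀ hm)).trans hs)

theorem exists_of_mem_localUnstableSet (H : IsAdmissible m lam η)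
    (hinj : InjOn (solenoidMap m lam lam η) solidTorus) {t : Sol m} {r : ℝ}
    (hr : r < 1 / (m + 1)) {y : Space} (hy : y ∈ localUnstableSet (solenoidMap m lam lam η)
        (attractor (solenoidMap m lam lam η) openSolidTorus) r (embed m lam η t)) :
    ∃ s, |s| ≤ r ∧ y = embed m lam η (t + flow m s) := by
  obtain ⟨X, Y, hX, hY, hXY⟩ := hy
  have hy : y ∈ range (embed m lam η) := by
    rw [range_embed H hinj, ← hY.1]
    exact (hY.2 0).1
  obtain ⟨u, rfl⟩ := hy
  rw [isBackwardOrbit_iff H hinj] at hX hY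
  have h1 : ∀ n, ‖(u - t).1 n‖ ≤ r := fun n => by
    have h := norm_sub_val_le_dist (lam := lam) (η := η) (shift^[n] t) (shift^[n] u)
    rw [shift_iterate_sub_val, ← hX, ← hY] at h
    exact h.trans (hXY n)
  obtain ⟨s, hs, hs'⟩ := exists_eq_flow_of_forall_norm_lt fun n => (h1 n).trans_lt hr
  exact ⟨s, hs.trans_le (h1 0), by rw [← hs', add_sub_cancel]⟩

theorem volume_coe_preimage_null {N : Set UnitAddCircle}
    (hN : (volume : Measure UnitAddCircle) N = 0) :
    volume ((fun s : ℝ => (s : UnitAddCircle)) ⁻¹' N) = 0 := by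
  have h : ∀ k : ℤ, (volume.restrict (Ioc (k : ℝ) (k + 1)))
      ((fun s : ℝ => (s : UnitAddCircle)) ⁻¹' N) = 0 := fun k =>
    (UnitAddCircle.measurePreserving_mk k).quasiMeasurePreserving.preimage_null hN
  rw [← Measure.restrict_univ (μ := (volume : Measure ℝ)), ← iUnion_Ioc_intCast ℝ]
  refine le_antisymm ((Measure.restrict_iUnion_le _).trans_eq ?_) zero_le
  rw [Measure.sum_apply_eq_zero.2 h]

/-- Leaves meet the preimages of null sets of the circle in sets of length zero. -/
theorem hausdorffMeasure_leaf_null (H : IsAdmissible m lam η)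
    (hinj : InjOn (solenoidMap m lam lam η) solidTorus) (t : Sol m) {N : Set UnitAddCircle}
    (hN : (volume : Measure UnitAddCircle) N = 0) :
    μH[1] (Prod.fst ⁻¹' N ∩ unstableSet (solenoidMap m lam lam η)
      (attractor (solenoidMap m lam lam η) openSolidTorus) (embed m lam η t)) = 0 := by
  have hL : LipschitzWith (Real.toNNReal (2 * Real.pi))
      fun s => embed m lam η (t + flow m s) := LipschitzWith.of_dist_le_mul fun s s' => by
    rw [Real.coe_toNNReal _ (by positivity), Real.dist_eq]
    exact dist_embed_flow_le H t s s'
  set S : Set ℝ := {s | t.1 0 + (s : UnitAddCircle) ∈ N}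
  have hS : volume S = 0 := by
    have h1 : (volume : Measure UnitAddCircle) ((fun a => t.1 0 + a) ⁻¹' N) = 0 := by
      rw [measure_preimage_add]; exact hN
    exact volume_coe_preimage_null h1
  have hsub : Prod.fst ⁻¹' N ∩ unstableSet (solenoidMap m lam lam η)
      (attractor (solenoidMap m lam lam η) openSolidTorus) (embed m lam η t) ⊆
      (fun s => embed m lam η (t + flow m s)) '' S := by
    rw [unstableSet_embed H hinj]
    rintro _ ⟨h1, s, rfl⟩
    refine ⟨s, ?_, rfl⟩
    have h2 : (t + flow m s).1 0 ∈ N := h1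
    have h3 : (t + flow m s).1 0 = t.1 0 + (flow m s).1 0 := rfl
    rwa [h3, flow_val, pow_zero, div_one] at h2
  refine measure_mono_null hsub (le_antisymm ?_ zero_le)
  refine (hL.hausdorffMeasure_image_le zero_le_one S).trans_eq ?_
  rw [hausdorffMeasure_real, hS, mul_zero]

/-- Sets of length zero in a leaf have measure zero in the affine parameter. -/
theorem volume_leaf_null (H : IsAdmissible m lam η)
    (hinj : InjOn (solenoidMap m lam lam η) solidTorus) (t : Sol m) {N : Set Space}
    (hN : μH[1] (N ∩ unstableSet (solenoidMap m lam lam η)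
      (attractor (solenoidMap m lam lam η) openSolidTorus) (embed m lam η t)) = 0) :
    volume {s : ℝ | embed m lam η (t + flow m s) ∈ N} = 0 := by
  set e : ℝ → Space := fun s => embed m lam η (t + flow m s)
  -- Over half a turn the circle coordinate recovers the flow time, so the inverse of the leaf
  -- parametrisation is 1-Lipschitz there. The line is therefore cut into intervals of length `1 /
  -- 2`.
  have hexp : ∀ s s', |s - s'| ≤ 1 / 2 → |s - s'| ≤ dist (e s) (e s') := by
    intro s s' h
    have h1 := norm_sub_val_le_dist (lam := lam) (η := η) (t + flow m s') (t + flow m s)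
    rw [add_sub_add_left_eq_sub, sub_eq_add_neg, ← flow_neg, ← flow_add, flow_val, pow_zero,
      div_one, ← sub_eq_add_neg, norm_coe_eq h, dist_comm] at h1
    exact h1
  have hpiece : ∀ k : ℤ, volume ({s : ℝ | e s ∈ N} ∩ Icc ((k : ℝ) / 2) ((k + 1) / 2)) = 0 := by
    intro k
    set A := {s : ℝ | e s ∈ N} ∩ Icc ((k : ℝ) / 2) ((k + 1) / 2)
    have hA : ∀ s ∈ A, ∀ s' ∈ A, |s - s'| ≤ dist (e s) (e s') := fun s hs s' hs' =>
      hexp s s' (by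
        have h1 := hs.2
        have h2 := hs'.2
        rw [mem_Icc] at h1 h2
        rw [abs_le]
        constructor <;> linarith)
    have hAinj : InjOn e A := fun s hs s' hs' h => by
      have := hA s hs s' hs'
      rw [h, dist_self] at this
      exact sub_eq_zero.1 (abs_nonpos_iff.1 this)
    have hlip : LipschitzOnWith 1 (Function.invFunOn e A) (e '' A) := by
      refine LipschitzOnWith.of_dist_le_mul ?_
      rintro _ ⟨s, hs, rfl⟩ _ ⟨s', hs', rfl⟩
      rw [hAinj.leftInvOn_invFunOn hs, hAinj.leftInvOn_invFunOn hs', NNReal.coe_one, one_mul,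
        Real.dist_eq]
      exact hA s hs s' hs'
    have hnull : μH[1] (e '' A) = 0 := by
      refine measure_mono_null ?_ hN
      rintro _ ⟨s, hs, rfl⟩
      exact ⟨hs.1, by rw [unstableSet_embed H hinj]; exact ⟨s, rfl⟩⟩
    have h1 := hlip.hausdorffMeasure_image_le zero_le_one
    rw [hAinj.leftInvOn_invFunOn.image_image, hnull, mul_zero, hausdorffMeasure_real] at h1
    exact le_antisymm h1 zero_le
  have hcover : {s : ℝ | e s ∈ N} ⊆
      ⋃ k : ℤ, {s : ℝ | e s ∈ N} ∩ Icc ((k : ℝ) / 2) ((k + 1) / 2) := by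
    intro s hs
    refine mem_iUnion.2 ⟨⌊2 * s⌋, hs, ?_, ?_⟩
    · linarith [Int.floor_le (2 * s)]
    · linarith [Int.lt_floor_add_one (2 * s)]
  exact measure_mono_null hcover (measure_iUnion_null hpiece)

/-! ### Uniqueness of the SRB measure -/

/-- Disintegrate along a subordinate partition. Each conditional measure is absolutely continuous on
a leaf, and the leaf meets the preimage of a null set of the circle in length zero. -/
theorem map_fst_absolutelyContinuous (H : IsAdmissible m lam η)
    (hinj : InjOn (solenoidMap m lam lam η) solidTorus) {ν : ProbabilityMeasure Space}
    (hν : IsSRB (solenoidMap m lam lam η)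
      (attractor (solenoidMap m lam lam η) openSolidTorus) ν) :
    (ν : Measure Space).map Prod.fst ≪ (volume : Measure UnitAddCircle) := by
  obtain ⟨q, hq⟩ := hν.exists_subordinate
  refine Measure.AbsolutelyContinuous.mk fun N hN hN0 => ?_
  have hpre : MeasurableSet (Prod.fst ⁻¹' N : Set Space) := measurable_fst hN
  rw [Measure.map_apply measurable_fst hN]
  have h1 : (ν : Measure Space) (Prod.fst ⁻¹' N) =
      ∫⁻ x, condDistrib id q (ν : Measure Space) (q x) (Prod.fst ⁻¹' N) ∂(ν : Measure Space) := by
    have h2 : ((ν : Measure Space).map q) ⊗ₘ condDistrib id q (ν : Measure Space) =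
        (ν : Measure Space).map fun a => (q a, id a) := compProd_map_condDistrib aemeasurable_id
    have h3 := congrArg (fun M => M (univ ×ˢ (Prod.fst ⁻¹' N))) h2
    rw [Measure.compProd_apply_prod MeasurableSet.univ hpre, Measure.restrict_univ,
      lintegral_map (Kernel.measurable_coe _ hpre) hq.1,
      Measure.map_apply (hq.1.prodMk measurable_id) (MeasurableSet.univ.prod hpre)] at h3
    rw [h3]
    congr 1
    ext x
    simp
  rw [h1]
  refine lintegral_eq_zero_of_ae_eq_zero ?_
  have hmem : ∀ᵐ x ∂(ν : Measure Space),
      x ∈ attractor (solenoidMap m lam lam η) openSolidTorus := hν.invariant.1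
  filter_upwards [hν.absolutelyContinuous q hq, hmem] with x hx hxK
  rw [← range_embed H hinj] at hxK
  obtain ⟨t, rfl⟩ := hxK
  refine hx ?_
  rw [Measure.restrict_apply hpre]
  exact hausdorffMeasure_leaf_null H hinj t hN0

/-- The projection to the circle is invariant and absolutely continuous, so it is Lebesgue by
ergodicity of multiplication by `m`. Cells depend only on this projection, and they determine the
measure. -/
theorem eq_solenoidMeasure_of_isSRB (H : IsAdmissible m lam η)
    (hinj : InjOn (solenoidMap m lam lam η) solidTorus) {ν : ProbabilityMeasure Space}
    (hν : IsSRB (solenoidMap m lam lam η)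
      (attractor (solenoidMap m lam lam η) openSolidTorus) ν) : ν = solenoidMeasure H := by
  have hF : Measurable (solenoidMap m lam lam η) := (continuous_solenoidMap m lam η).measurable
  have herg : Ergodic (fun a : UnitAddCircle => m • a) volume :=
    AddCircle.ergodic_nsmul (T := (1 : ℝ)) (by have := H.two_le; omega)
  have : IsProbabilityMeasure ((ν : Measure Space).map Prod.fst) :=
    Measure.isProbabilityMeasure_map measurable_fst.aemeasurable
  have hinv : MeasurePreserving (fun a : UnitAddCircle => m • a)
      ((ν : Measure Space).map Prod.fst) ((ν : Measure Space).map Prod.fst) := by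
    refine ⟨herg.measurable, ?_⟩
    rw [Measure.map_map herg.measurable measurable_fst]
    conv_rhs => rw [← hν.invariant.2, Measure.map_map measurable_fst hF]
    rfl
  have : IsProbabilityMeasure (volume : Measure UnitAddCircle) := ⟨UnitAddCircle.measure_univ⟩
  have hvol := herg.eq_of_absolutelyContinuous hinv (map_fst_absolutelyContinuous H hinj hν)
  refine eq_of_measure_cell_eq H hν.invariant (isInvariantOn_solenoidMeasure H hinj) fun n k => ?_
  have hk := measurable_cell (m := m) n (measurableSet_singleton k)
  rw [solenoidMeasure_cell, ← volume_cell, ← hvol, Measure.map_apply measurable_fst hk]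
  rfl

end

/-! ### Existence of the SRB measure: conditional measures of Haar measure -/

section

variable {m : ℕ} {lam η : ℝ}

/-- The joint law of `Q` and the identity is carried by the graph of `Q`, and this is read off in
the disintegration. -/
theorem ae_condDistrib_fibre {Q : Sol m → ℝ} (hQ : Measurable Q) :
    ∀ᵐ b ∂(haar m).map Q, ∀ᵐ u ∂condDistrib id Q (haar m) b, Q u = b := by
  have h2 : ((haar m).map Q) ⊗ₘ condDistrib id Q (haar m) =
      (haar m).map fun a => (Q a, id a) := compProd_map_condDistrib aemeasurable_id
  have hQi : Measurable fun a : Sol m => (Q a, id a) := hQ.prodMk measurable_id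
  have h3 : ∀ᵐ p ∂((haar m).map Q) ⊗ₘ condDistrib id Q (haar m), Q p.2 = p.1 := by
    rw [h2, ae_map_iff hQi.aemeasurable (show MeasurableSet {p : ℝ × Sol m | Q p.2 = p.1} from
      measurableSet_eq_fun (hQ.comp measurable_snd) measurable_fst)]
    exact ae_of_all _ fun _ => rfl
  exact Measure.ae_ae_of_ae_compProd h3

variable [NeZero m]

/-! ### A partition subordinate to the unstable leaves -/

/-- `m ^ n • t.1 n = t.1 0`, so multiplying the representative by `m ^ n` gives the cell as integer
part and the representative of `t.1 0` as fractional part. -/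
theorem pow_mul_fr (t : Sol m) (n : ℕ) :
    (m : ℝ) ^ n * fr (t.1 n) = (cell m n (t.1 n) : ℕ) + fr (t.1 0) := by
  have h := Sol.pow_nsmul_add t 0 n
  rw [zero_add] at h
  have h0 : (0 : ℝ) ≤ (m : ℝ) ^ n * fr (t.1 n) :=
    mul_nonneg (by positivity) (fr_mem (t.1 n)).1
  rw [← h, fr_nsmul, cell_val, natCast_floor_eq_intCast_floor h0, Nat.cast_pow, Int.floor_add_fract]

theorem eq_add_flow_of_cell_eq {t u : Sol m}
    (h : ∀ n, cell m n (u.1 n) = cell m n (t.1 n)) : u = t + flow m (fr (u.1 0) - fr (t.1 0)) := by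
  refine Subtype.ext (funext fun n => ?_)
  change u.1 n = t.1 n + (flow m _).1 n
  have hm : (0 : ℝ) < (m : ℝ) ^ n := pow_pos cast_pos_of_neZero n
  have h1 := pow_mul_fr t n
  have h2 := pow_mul_fr u n
  rw [h n] at h2
  have h3 : fr (u.1 n) = fr (t.1 n) + (fr (u.1 0) - fr (t.1 0)) / (m : ℝ) ^ n := by
    field_simp
    linarith
  rw [flow_val, ← coe_fr (u.1 n), h3, AddCircle.coe_add, coe_fr]

/-- The converse of the previous lemma: flowing without letting coordinate `0` cross the cut changes
the fractional part only, in every coordinate. -/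
theorem cell_add_flow (t : Sol m) {s : ℝ} (h0 : 0 ≤ fr (t.1 0) + s) (h1 : fr (t.1 0) + s < 1)
    (n : ℕ) : cell m n ((t + flow m s).1 n) = cell m n (t.1 n) := by
  have hm : (0 : ℝ) < (m : ℝ) ^ n := pow_pos cast_pos_of_neZero n
  set x := fr (t.1 n) + s / (m : ℝ) ^ n with hx
  have e : (m : ℝ) ^ n * x = (cell m n (t.1 n) : ℕ) + (fr (t.1 0) + s) := by
    rw [hx, mul_add, pow_mul_fr, mul_div_cancel₀ _ hm.ne', add_assoc]
  have hlt : ((cell m n (t.1 n) : ℕ) : ℝ) + 1 ≤ (m : ℝ) ^ n := by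
    exact_mod_cast (cell m n (t.1 n)).2
  have hx0 : 0 ≤ x := by
    refine nonneg_of_mul_nonneg_right ?_ hm
    rw [e]
    positivity
  have hx1 : x < 1 := by
    refine lt_of_mul_lt_mul_left (a := (m : ℝ) ^ n) ?_ hm.le
    rw [e]
    linarith
  have h2 : (t + flow m s).1 n = (x : UnitAddCircle) := by
    change t.1 n + (flow m s).1 n = _
    rw [hx, AddCircle.coe_add, coe_fr, flow_val]
  refine Fin.ext ?_
  rw [h2, cell_val, fr_coe, Int.fract_eq_self.2 ⟨hx0, hx1⟩, e]
  refine (Nat.floor_eq_iff (by positivity)).2 ⟨by linarith, by linarith⟩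

/-- A measurable function on the solenoid which is constant exactly on the pieces of unstable
leaves that project injectively onto the circle cut at `0`. -/
def leafLabel (m : ℕ) [NeZero m] (t : Sol m) : ℝ :=
  embeddingReal (ℕ → ℕ) fun n => (cell m n (t.1 n) : ℕ)

theorem measurable_leafLabel : Measurable (leafLabel m) := by
  refine (measurableEmbedding_embeddingReal (ℕ → ℕ)).measurable.comp
    (measurable_pi_lambda _ fun n => ?_)
  exact (measurable_of_countable (fun k : Fin (m ^ n) => (k : ℕ))).comp
    ((measurable_cell n).comp ((measurable_pi_apply n).comp measurable_subtype_coe))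

theorem leafLabel_eq_iff {t u : Sol m} :
    leafLabel m u = leafLabel m t ↔ ∀ n, cell m n (u.1 n) = cell m n (t.1 n) := by
  rw [leafLabel, leafLabel, (measurableEmbedding_embeddingReal (ℕ → ℕ)).injective.eq_iff,
    funext_iff]
  exact forall_congr' fun n => Fin.ext_iff.symm

theorem volume_singleton_zero : (volume : Measure UnitAddCircle) {0} = 0 := by
  rw [← Metric.closedBall_zero, AddCircle.volume_closedBall]
  simp

theorem ae_val_zero_ne_zero : ∀ᵐ t ∂haar m, t.1 0 ≠ 0 := by
  have h := (measurePreserving_val_zero (m := m)).measure_preimage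
    (measurableSet_singleton 0).nullMeasurableSet
  rw [volume_singleton_zero] at h
  rw [ae_iff]
  simp only [ne_eq, not_not]
  exact h

theorem exists_isSubordinate (H : IsAdmissible m lam η)
    (hinj : InjOn (solenoidMap m lam lam η) solidTorus) :
    ∃ q, IsSubordinate (solenoidMap m lam lam η)
      (attractor (solenoidMap m lam lam η) openSolidTorus) (solenoidMeasure H) q := by
  have hemb := measurableEmbedding_embed H hinj
  obtain ⟨q, hq, hqe⟩ := hemb.exists_measurable_extend measurable_leafLabel fun _ => ⟨0⟩
  have hqe' : ∀ t, q (embed m lam η t) = leafLabel m t := fun t => congrFun hqe t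
  refine ⟨q, hq, ?_⟩
  rw [coe_solenoidMeasure, hemb.ae_map_iff]
  -- Over the cut itself the leaf piece is no neighbourhood of the point in its leaf; these points
  -- form a null set.
  filter_upwards [ae_val_zero_ne_zero] with t ht
  constructor
  · rintro y ⟨hy, hqy⟩
    rw [← range_embed H hinj] at hy
    obtain ⟨u, rfl⟩ := hy
    rw [hqe', hqe', leafLabel_eq_iff] at hqy
    rw [unstableSet_embed H hinj]
    exact ⟨_, congrArg (embed m lam η) (eq_add_flow_of_cell_eq hqy).symm⟩
  · have hf := fr_mem (t.1 0)
    have hf0 : 0 < fr (t.1 0) := lt_of_le_of_ne hf.1 fun h => ht (by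
      rw [← coe_fr (t.1 0), ← h, AddCircle.coe_zero])
    have hm := cast_pos_of_neZero (m := m)
    -- The distance to the cut on either side, capped by the size below which local leaves are flow
    -- segments; halving makes the inequalities strict.
    refine ⟨min (min (fr (t.1 0)) (1 - fr (t.1 0))) (1 / (m + 1)) / 2, ?_, ?_⟩
    · have : 0 < 1 - fr (t.1 0) := by linarith [hf.2]
      positivity
    · set R := min (min (fr (t.1 0)) (1 - fr (t.1 0))) (1 / ((m : ℝ) + 1)) with hR
      have hR0 : 0 < R := by
        have : 0 < 1 - fr (t.1 0) := by linarith [hf.2]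
        positivity
      have hR1 : R ≤ fr (t.1 0) := (min_le_left _ _).trans (min_le_left _ _)
      have hR2 : R ≤ 1 - fr (t.1 0) := (min_le_left _ _).trans (min_le_right _ _)
      have hR3 : R ≤ 1 / ((m : ℝ) + 1) := min_le_right _ _
      intro y hy
      obtain ⟨s, hs, rfl⟩ := exists_of_mem_localUnstableSet H hinj (by linarith) hy
      have hs' := abs_le.1 hs
      refine ⟨by rw [← range_embed H hinj]; exact mem_range_self _, ?_⟩
      rw [hqe', hqe', leafLabel_eq_iff]
      exact cell_add_flow t (by linarith) (by linarith)

/-! ### Conditional measures along the flow -/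

/-- The pairs `(t, s)` such that `t` and its translate along the flow by the time `s ∈ [-1, 1]`
have the same label. -/
def sameFibre (Q : Sol m → ℝ) : Set (Sol m × ℝ) :=
  {p | p.2 ∈ Icc (-1 : ℝ) 1 ∧ Q (p.1 + flow m p.2) = Q p.1}

theorem measurable_add_flow : Measurable fun p : Sol m × ℝ => p.1 + flow m p.2 :=
  (continuous_fst.add (continuous_flow.comp continuous_snd)).measurable

theorem measurableSet_sameFibre {Q : Sol m → ℝ} (hQ : Measurable Q) :
    MeasurableSet (sameFibre Q) :=
  (measurable_snd measurableSet_Icc).inter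
    (measurableSet_eq_fun (hQ.comp measurable_add_flow) (hQ.comp measurable_fst))

/-- The relation is symmetric under exchanging the endpoints and reversing time; this is used after
the change of variables in `setLIntegral_fibreMeasure`. -/
theorem add_flow_neg_mem_sameFibre {Q : Sol m → ℝ} (u : Sol m) (s : ℝ) :
    (u + flow m (-s), s) ∈ sameFibre Q ↔ (u, -s) ∈ sameFibre Q := by
  have h : u + flow m (-s) + flow m s = u := by
    rw [add_assoc, ← flow_add, neg_add_cancel, flow_zero, add_zero]
  have h2 : s ∈ Icc (-1 : ℝ) 1 ↔ -s ∈ Icc (-1 : ℝ) 1 := by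
    rw [mem_Icc, mem_Icc]
    constructor <;> rintro ⟨h1, h2⟩ <;> constructor <;> linarith
  change (s ∈ Icc (-1 : ℝ) 1 ∧ Q (u + flow m (-s) + flow m s) = Q (u + flow m (-s))) ↔
    (-s ∈ Icc (-1 : ℝ) 1 ∧ Q (u + flow m (-s)) = Q u)
  rw [h, ← h2, eq_comm]

/-- The length of the part of the fibre of `Q` through `t` within time `1`. -/
def fibreLength (Q : Sol m → ℝ) (t : Sol m) : ℝ≥0∞ := volume (Prod.mk t ⁻¹' sameFibre Q)

theorem measurable_fibreLength {Q : Sol m → ℝ} (hQ : Measurable Q) :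
    Measurable (fibreLength Q) :=
  measurable_measure_prodMk_left (measurableSet_sameFibre hQ)

theorem fibreLength_ne_top (Q : Sol m → ℝ) (t : Sol m) : fibreLength Q t ≠ ⊤ :=
  ne_top_of_le_ne_top (measure_Icc_lt_top (μ := volume) (a := (-1 : ℝ)) (b := 1)).ne
    (measure_mono fun _ hs => hs.1)

/-- The measure on the orbit of `t` with density `1 / fibreLength` on the part of the fibre of `Q`
through `t` within time `1`. -/
def fibreMeasure (Q : Sol m → ℝ) (t : Sol m) : Measure (Sol m) :=
  ((volume.restrict (Prod.mk t ⁻¹' sameFibre Q)).withDensity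
    fun s => (fibreLength Q (t + flow m s))⁻¹).map fun s => t + flow m s

theorem measurable_orbit (t : Sol m) : Measurable fun s : ℝ => t + flow m s :=
  measurable_add_flow.comp measurable_prodMk_left

theorem fibreMeasure_apply {Q : Sol m → ℝ} (hQ : Measurable Q) (t : Sol m) {A : Set (Sol m)}
    (hA : MeasurableSet A) : fibreMeasure Q t A =
      ∫⁻ s : ℝ, (sameFibre Q ∩ (fun p => p.1 + flow m p.2) ⁻¹' A).indicator
        (fun p => (fibreLength Q (p.1 + flow m p.2))⁻¹) (t, s) := by
  have h1 := measurable_orbit t hA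
  have h2 : MeasurableSet (Prod.mk t ⁻¹' sameFibre Q) :=
    measurable_prodMk_left (measurableSet_sameFibre hQ)
  rw [fibreMeasure, Measure.map_apply (measurable_orbit t) hA, withDensity_apply _ h1,
    Measure.restrict_restrict h1, inter_comm, ← lintegral_indicator (h2.inter h1)]
  rfl

theorem measurable_indicator_inv_fibreLength {Q : Sol m → ℝ} (hQ : Measurable Q)
    {S : Set (Sol m × ℝ)} (hS : MeasurableSet S) :
    Measurable (S.indicator fun p => (fibreLength Q (p.1 + flow m p.2))⁻¹) :=
  (((measurable_fibreLength hQ).comp measurable_add_flow).inv).indicator hS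

theorem measurable_fibreMeasure {Q : Sol m → ℝ} (hQ : Measurable Q) :
    Measurable (fibreMeasure Q) := by
  refine Measure.measurable_of_measurable_coe _ fun A hA => ?_
  simp only [fibreMeasure_apply hQ _ hA]
  exact (measurable_indicator_inv_fibreLength hQ
    ((measurableSet_sameFibre hQ).inter (measurable_add_flow hA))).lintegral_prod_right'

/-- From a point at time `s` in a window of length one, all other times of the fibre in that window
lie within time `1`. So the length in the denominator is at least that of the domain of integration.
-/
theorem lintegral_inv_fibreLength_le {Q : Sol m → ℝ} (t : Sol m) (a : ℝ) :
    ∫⁻ s in (Prod.mk t ⁻¹' sameFibre Q) ∩ Icc a (a + 1),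
      (fibreLength Q (t + flow m s))⁻¹ ≤ 1 := by
  set S := (Prod.mk t ⁻¹' sameFibre Q) ∩ Icc a (a + 1)
  have h : ∀ s ∈ S, (fibreLength Q (t + flow m s))⁻¹ ≤ (volume S)⁻¹ := by
    intro s hs
    refine ENNReal.inv_le_inv.2 ?_
    rw [← measure_preimage_add volume s S]
    refine measure_mono fun s' (hs' : s + s' ∈ S) => ?_
    have h1 := hs.2
    have h2 := hs'.2
    rw [mem_Icc] at h1 h2
    refine ⟨⟨?_, ?_⟩, ?_⟩
    · change -1 ≤ s'
      linarith
    · change s' ≤ 1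
      linarith
    · have h3 : Q (t + flow m s) = Q t := hs.1.2
      have h4 : Q (t + flow m (s + s')) = Q t := hs'.1.2
      change Q (t + flow m s + flow m s') = Q (t + flow m s)
      rw [add_assoc, ← flow_add, h3, h4]
  calc ∫⁻ s in S, (fibreLength Q (t + flow m s))⁻¹ ≤ ∫⁻ _ in S, (volume S)⁻¹ :=
        setLIntegral_mono measurable_const h
    _ = (volume S)⁻¹ * volume S := setLIntegral_const _ _
    _ ≤ 1 := ENNReal.inv_mul_le_one _

theorem fibreMeasure_univ_le {Q : Sol m → ℝ} (t : Sol m) : fibreMeasure Q t univ ≤ 2 := by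
  rw [fibreMeasure, Measure.map_apply (measurable_orbit t) MeasurableSet.univ, preimage_univ,
    withDensity_apply _ MeasurableSet.univ, Measure.restrict_univ]
  have hsub : Prod.mk t ⁻¹' sameFibre Q ⊆
      ((Prod.mk t ⁻¹' sameFibre Q) ∩ Icc (-1) (-1 + 1)) ∪
      ((Prod.mk t ⁻¹' sameFibre Q) ∩ Icc 0 (0 + 1)) := by
    intro s hs
    have h1 : s ∈ Icc (-1 : ℝ) 1 := hs.1
    rcases le_total s 0 with h | h
    · exact Or.inl ⟨hs, h1.1, by linarith⟩
    · exact Or.inr ⟨hs, h, by linarith [h1.2]⟩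
  refine (lintegral_mono_set hsub).trans ((lintegral_union_le _ _ _).trans ?_)
  rw [← one_add_one_eq_two]
  exact add_le_add (lintegral_inv_fibreLength_le t (-1)) (lintegral_inv_fibreLength_le t 0)

/-- The measures `fibreMeasure Q t` as a kernel. -/
def fibreKernel {Q : Sol m → ℝ} (hQ : Measurable Q) : Kernel (Sol m) (Sol m) :=
  ⟨fibreMeasure Q, measurable_fibreMeasure hQ⟩

instance {Q : Sol m → ℝ} (hQ : Measurable Q) : IsFiniteKernel (fibreKernel hQ) :=
  ⟨⟨2, by simp, fun t => fibreMeasure_univ_le t⟩⟩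

/-- The spreading kernel preserves Haar measure, even on each fibre of `Q`. By Fubini and invariance
under the flow the starting point is replaced by the end point `u`. The density is then constant in
`s`, and by symmetry the admissible times have total length `fibreLength Q u`, which cancels it.
Placing the density at the end point is what makes this work. -/
theorem setLIntegral_fibreMeasure {Q : Sol m → ℝ} (hQ : Measurable Q)
    (hpos : ∀ᵐ t ∂haar m, fibreLength Q t ≠ 0) {B : Set ℝ} (hB : MeasurableSet B)
    {A : Set (Sol m)} (hA : MeasurableSet A) :
    ∫⁻ t in Q ⁻¹' B, fibreMeasure Q t A ∂haar m = haar m (Q ⁻¹' B ∩ A) := by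
  set S : Set (Sol m × ℝ) := Prod.fst ⁻¹' (Q ⁻¹' B) ∩
    (sameFibre Q ∩ (fun p => p.1 + flow m p.2) ⁻¹' A)
  have hS : MeasurableSet S := (measurable_fst (hQ hB)).inter
    ((measurableSet_sameFibre hQ).inter (measurable_add_flow hA))
  set G : Sol m × ℝ → ℝ≥0∞ := S.indicator fun p => (fibreLength Q (p.1 + flow m p.2))⁻¹
  have hG : Measurable G := measurable_indicator_inv_fibreLength hQ hS
  have hshift : Measurable fun p : Sol m × ℝ => (p.1 + flow m (-p.2), p.2) :=
    ((continuous_fst.add (continuous_flow.comp continuous_snd.neg)).prodMk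
      continuous_snd).measurable
  calc ∫⁻ t in Q ⁻¹' B, fibreMeasure Q t A ∂haar m
      = ∫⁻ t, (∫⁻ s : ℝ, G (t, s)) ∂haar m := by
        rw [← lintegral_indicator (hQ hB)]
        refine lintegral_congr fun t => ?_
        by_cases ht : t ∈ Q ⁻¹' B
        · rw [indicator_of_mem ht, fibreMeasure_apply hQ t hA]
          refine lintegral_congr fun s => ?_
          have h : (t, s) ∈ Prod.fst ⁻¹' (Q ⁻¹' B) := ht
          classical
          simp only [G, S, indicator_apply, mem_inter_iff, h, true_and]
        · rw [indicator_of_notMem ht]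
          refine (lintegral_eq_zero_of_ae_eq_zero (ae_of_all _ fun s => ?_)).symm
          exact indicator_of_notMem (fun h => ht h.1) _
    _ = ∫⁻ s : ℝ, ∫⁻ t, G (t, s) ∂haar m := 
        lintegral_lintegral_swap (f := fun t s => G (t, s)) hG.aemeasurable
    _ = ∫⁻ s : ℝ, ∫⁻ u, G (u + flow m (-s), s) ∂haar m := lintegral_congr fun s =>
        (lintegral_add_right_eq_self (fun t => G (t, s)) (flow m (-s))).symm
    _ = ∫⁻ u, (∫⁻ s : ℝ, G (u + flow m (-s), s)) ∂haar m :=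
        (lintegral_lintegral_swap (f := fun u s => G (u + flow m (-s), s))
          (hG.comp hshift).aemeasurable).symm
    _ = ∫⁻ u, (Q ⁻¹' B ∩ A).indicator 1 u ∂haar m := by
        refine lintegral_congr_ae ?_
        filter_upwards [hpos] with u hu
        have hcancel : ∀ s : ℝ, u + flow m (-s) + flow m s = u := fun s => by
          rw [add_assoc, ← flow_add, neg_add_cancel, flow_zero, add_zero]
        by_cases hu' : u ∈ Q ⁻¹' B ∩ A
        · have e : ∀ s : ℝ, G (u + flow m (-s), s) = ((fun s : ℝ => -s) ⁻¹'
              (Prod.mk u ⁻¹' sameFibre Q)).indicator (fun _ => (fibreLength Q u)⁻¹) s := by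
            intro s
            classical
            simp only [G, indicator_apply, hcancel]
            refine if_congr ⟨fun h => (add_flow_neg_mem_sameFibre u s).1 h.2.1, fun h => ?_⟩ rfl rfl
            have h1 := (add_flow_neg_mem_sameFibre u s).2 h
            refine ⟨?_, h1, ?_⟩
            · have h2 : Q (u + flow m (-s) + flow m s) = Q (u + flow m (-s)) := h1.2
              change Q (u + flow m (-s)) ∈ B
              rw [← h2, hcancel]
              exact hu'.1
            · change u + flow m (-s) + flow m s ∈ A
              rw [hcancel]
              exact hu'.2
          have hm : MeasurableSet (Prod.mk u ⁻¹' sameFibre Q) :=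
            measurable_prodMk_left (measurableSet_sameFibre hQ)
          simp only [e]
          rw [lintegral_indicator_const (measurable_neg hm), Measure.measure_preimage_neg,
            indicator_of_mem hu', Pi.one_apply]
          exact ENNReal.inv_mul_cancel hu (fibreLength_ne_top Q u)
        · rw [indicator_of_notMem hu']
          refine lintegral_eq_zero_of_ae_eq_zero (ae_of_all _ fun s => ?_)
          refine indicator_of_notMem (fun h => hu' ?_) _
          have h2 : Q (u + flow m (-s) + flow m s) = Q (u + flow m (-s)) := h.2.1.2
          have h3 : Q (u + flow m (-s)) ∈ B := h.1
          have h4 : u + flow m (-s) + flow m s ∈ A := h.2.2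
          rw [hcancel] at h2 h4
          exact ⟨by rw [mem_preimage, h2]; exact h3, h4⟩
    _ = haar m (Q ⁻¹' B ∩ A) := lintegral_indicator_one ((hQ hB).inter hA)

/-- Both kernels disintegrate the same joint law, by `setLIntegral_fibreMeasure`, and
disintegrations are almost surely unique. Hence conditional measures are mixtures of measures that
are absolutely continuous along orbits. -/
theorem condDistrib_eq_comp {Q : Sol m → ℝ} (hQ : Measurable Q)
    (hpos : ∀ᵐ t ∂haar m, fibreLength Q t ≠ 0) :
    condDistrib id Q (haar m) =ᵐ[(haar m).map Q]
      fibreKernel hQ ∘ₖ condDistrib id Q (haar m) := by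
  have h2 : ((haar m).map Q) ⊗ₘ condDistrib id Q (haar m) =
      (haar m).map fun a => (Q a, id a) := compProd_map_condDistrib aemeasurable_id
  have hQi : Measurable fun a : Sol m => (Q a, id a) := hQ.prodMk measurable_id
  have : IsProbabilityMeasure ((haar m).map Q) :=
    Measure.isProbabilityMeasure_map hQ.aemeasurable
  have : IsFiniteMeasure ((haar m).map fun a => (Q a, id a)) := inferInstance
  refine condDistrib_ae_eq_of_measure_eq_compProd Q aemeasurable_id ?_
  refine Measure.ext_prod fun {B A} hB hA => ?_
  have hκ : Measurable fun t => fibreMeasure Q t A := (fibreKernel hQ).measurable_coe hA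
  have e1 : ((haar m).map fun a => (Q a, id a)) (B ×ˢ A) = haar m (Q ⁻¹' B ∩ A) := by
    rw [Measure.map_apply hQi (hB.prod hA)]
    rfl
  rw [e1, ← setLIntegral_fibreMeasure hQ hpos hB hA, Measure.compProd_apply_prod hB hA]
  simp only [Kernel.comp_apply' _ _ _ hA]
  have e3 := Measure.setLIntegral_compProd (μ := (haar m).map Q) (κ := condDistrib id Q (haar m))
    (f := fun p => fibreMeasure Q p.2 A) (hκ.comp measurable_snd) hB MeasurableSet.univ
  rw [h2, Measure.restrict_map hQi (hB.prod MeasurableSet.univ),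
    lintegral_map (show Measurable fun p : ℝ × Sol m => fibreMeasure Q p.2 A from
      hκ.comp measurable_snd) hQi] at e3
  simp only [Measure.restrict_univ] at e3
  refine Eq.trans ?_ e3
  congr 2
  ext t
  simp

theorem fibreMeasure_null {Q : Sol m → ℝ} {t : Sol m} {A : Set (Sol m)} (hA : MeasurableSet A)
    (h : volume {s : ℝ | t + flow m s ∈ A} = 0) : fibreMeasure Q t A = 0 := by
  rw [fibreMeasure, Measure.map_apply (measurable_orbit t) hA]
  exact withDensity_absolutelyContinuous _ _
    (Measure.absolutelyContinuous_of_le Measure.restrict_le_self h)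

theorem condDistrib_absolutelyContinuous (H : IsAdmissible m lam η)
    (hinj : InjOn (solenoidMap m lam lam η) solidTorus) {q : Space → ℝ}
    (hq : IsSubordinate (solenoidMap m lam lam η)
      (attractor (solenoidMap m lam lam η) openSolidTorus) (solenoidMeasure H) q) :
    ∀ᵐ x ∂(solenoidMeasure H : Measure Space),
      condDistrib id q (solenoidMeasure H : Measure Space) (q x) ≪
        (μH[1]).restrict (unstableSet (solenoidMap m lam lam η)
          (attractor (solenoidMap m lam lam η) openSolidTorus) x) := by
  have hemb := measurableEmbedding_embed H hinj
  obtain ⟨hqm, hsub⟩ := hq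
  set Q := q ∘ embed m lam η
  have hQ : Measurable Q := hqm.comp hemb.measurable
  rw [coe_solenoidMeasure, hemb.ae_map_iff] at hsub
  change ∀ᵐ x ∂(haar m).map (embed m lam η),
    condDistrib id q ((haar m).map (embed m lam η)) (q x) ≪ _
  rw [hemb.ae_map_iff]
  -- Subordinate elements contain a local leaf, which is an interval of flow times of positive
  -- length.
  have hpos : ∀ᵐ t ∂haar m, fibreLength Q t ≠ 0 := by
    filter_upwards [hsub] with t ht h0
    obtain ⟨-, r, hr, hloc⟩ := ht
    set r' := min (r / (2 * Real.pi)) 1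
    have hr' : 0 < r' := lt_min (by positivity) one_pos
    have hsub' : Icc (-r') r' ⊆ Prod.mk t ⁻¹' sameFibre Q := by
      intro s hs
      have h1 : r' ≤ 1 := min_le_right _ _
      have h2 : |s| ≤ r / (2 * Real.pi) := (abs_le.2 hs).trans (min_le_left _ _)
      refine ⟨⟨by linarith [hs.1], by linarith [hs.2]⟩, ?_⟩
      refine (hloc (embed_flow_mem_localUnstableSet H hinj t ?_)).2
      rwa [le_div_iff₀' (by positivity)] at h2
    have h3 := measure_mono_null hsub' h0
    rw [Real.volume_Icc, ENNReal.ofReal_eq_zero] at h3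
    linarith
  -- Conditional measures on the attractor are images of those on the group, where the flow acts.
  have hcomp : ∀ᵐ b ∂(haar m).map Q, condDistrib id q ((haar m).map (embed m lam η)) b =
      (condDistrib id Q (haar m) b).map (embed m lam η) := by
    have h1 := condDistrib_map (X := q) (Y := (id : Space → Space)) (ν := haar m)
      (f := embed m lam η) hqm.aemeasurable aemeasurable_id hemb.measurable.aemeasurable
    have h2 := condDistrib_comp (mβ := Real.measurableSpace) (μ := haar m) Q (Y := (id : Sol m → Sol m)) aemeasurable_id
      hemb.measurable
    filter_upwards [h1, h2] with b hb1 hb2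
    rw [hb1, ← Kernel.map_apply _ hemb.measurable, ← hb2]
    rfl
  filter_upwards [hsub, ae_of_ae_map hQ.aemeasurable hcomp,
    ae_of_ae_map hQ.aemeasurable (condDistrib_eq_comp hQ hpos),
    ae_of_ae_map hQ.aemeasurable (ae_condDistrib_fibre hQ)] with t ht h1 h2 h3
  refine Measure.AbsolutelyContinuous.mk fun N hN hN0 => ?_
  rw [Measure.restrict_apply hN] at hN0
  have hA := hemb.measurable hN
  have h4 : condDistrib id q ((haar m).map (embed m lam η)) (q (embed m lam η t)) =
    (condDistrib id Q (haar m) (Q t)).map (embed m lam η) := h1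
  rw [h4, Measure.map_apply hemb.measurable hN, h2, Kernel.comp_apply' _ _ _ hA]
  refine lintegral_eq_zero_of_ae_eq_zero ?_
  filter_upwards [h3] with u hu
  have hmem : embed m lam η u ∈ unstableSet (solenoidMap m lam lam η)
      (attractor (solenoidMap m lam lam η) openSolidTorus) (embed m lam η t) :=
    ht.1 ⟨by rw [← range_embed H hinj]; exact mem_range_self u, hu⟩
  rw [unstableSet_embed H hinj] at hmem
  obtain ⟨s, hs⟩ := hmem
  obtain rfl := embed_injective H hinj hs
  refine fibreMeasure_null hA ?_
  have h5 := volume_leaf_null H hinj t hN0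
  -- The null set of times was measured from `t`; a translation by `s` measures it from `u = t +
  -- flow m s`.
  rw [← measure_preimage_add volume s] at h5
  refine (congrArg volume ?_).trans h5
  ext s'
  change embed m lam η (t + flow m s + flow m s') ∈ N ↔ embed m lam η (t + flow m (s + s')) ∈ N
  rw [add_assoc, ← flow_add]

theorem isSRB_iff (H : IsAdmissible m lam η)
    (hinj : InjOn (solenoidMap m lam lam η) solidTorus) (ν : ProbabilityMeasure Space) :
    IsSRB (solenoidMap m lam lam η) (attractor (solenoidMap m lam lam η) openSolidTorus) ν ↔
      ν = solenoidMeasure H := by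
  refine ⟨eq_solenoidMeasure_of_isSRB H hinj, ?_⟩
  rintro rfl
  exact ⟨isInvariantOn_solenoidMeasure H hinj, ae_of_all _ fun x v hv => exists_lyapunov H x hv,
    exists_isSubordinate H hinj, fun q hq => condDistrib_absolutelyContinuous H hinj hq⟩

end

/-! ### The solenoid map as a model map -/

section

variable {m : ℕ} {lam η : ℝ}

theorem isModelMap_solenoidMap (H : IsAdmissible m lam η)
    (hinj : InjOn (solenoidMap m lam lam η) solidTorus) {θ : ℝ≥0} (hθ : θ ≤ 1)
    {W : Space → Plane} (hc : Continuous W) (hW : ∀ t, W (embed m lam η t) = slope m lam η t) :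
    IsModelMap θ (adaptedMetric W hc) openSolidTorus (solenoidMap m lam lam η) := by
  have := H.neZero
  refine ⟨isAttractorMap_solenoidMap H hinj hθ, ⟨unstableLine W, stablePlane,
    hypA2_adaptedMetric H hinj hc hW, fun x _ => finrank_unstableLine W x, m,
    by linarith [H.two_le_real], fun x hx v hv => adaptedMetric_expansion H hinj hc hW hx hv⟩,
    solenoidMeasure H, isSRB_iff H hinj, isMaximalEntropy_iff H hinj⟩

end

end Solenoid

end

/-! ### The main theorem -/

theorem mainTheorem3 (m : ℕ) (hm : 2 ≤ m) (η lam : ℝ) (hη : 0 < η) (hη1 : η < 1)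
    (hlam : 0 < lam) (hlamη : lam < min η (1 - η)) (hlamm : lam < 1 / (m : ℝ))
    (hinj : Set.InjOn (Solenoid.solenoidMap m lam lam η) Solenoid.solidTorus)
    (θ : NNReal) (hθ : 0 < θ) (hθ1 : θ < 1) :
    Solenoid.attractor (Solenoid.solenoidMap m lam lam η) Solenoid.openSolidTorus =
        ⋂ n : ℕ, (Solenoid.solenoidMap m lam lam η)^[n] '' Solenoid.solidTorus ∧
    ∃ Eu Es : Solenoid.Space → Submodule ℝ Solenoid.Tan,
      Solenoid.IsAttractorMap θ Solenoid.openSolidTorus (Solenoid.solenoidMap m lam lam η) ∧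
      Solenoid.HypA1 (Solenoid.solenoidMap m lam lam η)
        (Solenoid.attractor (Solenoid.solenoidMap m lam lam η) Solenoid.openSolidTorus) ∧
      Solenoid.HypA2 Solenoid.flatMetric (Solenoid.solenoidMap m lam lam η)
        (Solenoid.attractor (Solenoid.solenoidMap m lam lam η) Solenoid.openSolidTorus) Eu Es ∧
      Solenoid.HypA3
        (Solenoid.attractor (Solenoid.solenoidMap m lam lam η) Solenoid.openSolidTorus) Eu ∧
      Solenoid.HypA4 (Solenoid.solenoidMap m lam lam η) Solenoid.openSolidTorus Eu Es
        (((0 : ℝ) : UnitAddCircle), !₂[η / (1 - lam), 0]) (Real.log m) (Real.log (1 / lam)) ∧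
      ∃ g : Solenoid.RiemannianMetric,
        Solenoid.HypA2 g (Solenoid.solenoidMap m lam lam η)
          (Solenoid.attractor (Solenoid.solenoidMap m lam lam η) Solenoid.openSolidTorus) Eu Es ∧
        Solenoid.HypA5 θ g Solenoid.openSolidTorus (Solenoid.solenoidMap m lam lam η) := by
  have hm0 : (0 : ℝ) < m := by exact_mod_cast (by omega : 0 < m)
  have H : Solenoid.IsAdmissible m lam η :=
    { two_le := hm
      η_pos := hη
      lam_pos := hlam
      add_lt := by linarith [(lt_min_iff.1 hlamη).2]
      mul_lt := by rwa [lt_div_iff₀' hm0] at hlamm }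
  obtain ⟨W, hc, hW⟩ := Solenoid.exists_slope_extension H hinj
  refine ⟨Solenoid.attractor_solenoidMap m lam η, Solenoid.unstableLine W, Solenoid.stablePlane,
    Solenoid.isAttractorMap_solenoidMap H hinj hθ1.le, Solenoid.hypA1_solenoidMap H hinj,
    Solenoid.hypA2_flatMetric H hinj hW, fun x _ => Solenoid.finrank_unstableLine W x,
    Solenoid.hypA4_solenoidMap H hinj hW, Solenoid.adaptedMetric W hc,
    -- The solenoid map is its own model map for the adapted metric, so both `C¹` distances are zero
    -- for any prescribed size.
    Solenoid.hypA2_adaptedMetric H hinj hc hW, fun ε hε => ⟨_,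
      Solenoid.isModelMap_solenoidMap H hinj hθ1.le hc hW, fun x _ => ?_⟩⟩
  rw [dist_self, sub_self, norm_zero]
  exact ⟨hε _, hε _⟩
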